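/- Let $k=k_1+\dots+k_d$ with $d\ge 1$ and all $k_i\ge 1$, and write $x=(x^1,\dots,x^d)\in\mathbb R^k=\mathbb R^{k_1}\times\cdots\times\mathbb R^{k_d}$, with Euclidean norm $|\cdot|$. Let $\psi:\mathbb R^k\to\mathbb R$ be convex with $\int_{\mathbb R^k} e^{-\psi(x)}\,dx<\infty$, and let $\rho$ be the probability measure with density proportional to $e^{-\psi}$. Assume that there are constants $c>0$ and $p\ge 2$ such that $$|\psi(x)|\le c(1+|x|^p),\qquad |\nabla\psi(x)|\le c(1+|x|^p)\qquad\text{for a.e. }x\in\mathbb R^k,$$ where $\nabla\psi$ is the weak gradient. Let $\mu_0=\mu_0^1\otimes\cdots\otimes\mu_0^d$ be a product of probability measures $\mu_0^i$ on $\mathbb R^{k_i}$ with $\int|x|^p\,\mu_0(dx)<\infty$. The iterates $\mu_n=\mu_n^1\otimes\cdots\otimes\mu_n^d$ of coordinate ascent variational inference (CAVI) are defined, for $n\ge 0$ and successively for $i=1,\dots,d$, by letting $\mu_{n+1}^i$ be the probability measure on $\mathbb R^{k_i}$ with density $$\mu_{n+1}^i(x^i)\ \propto\ \exp\Big(-\int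 \psi(x^1,\dots,x^d)\,\bigotimes_{j<i}\mu_{n+1}^j(dx^j)\bigotimes_{j>i}\mu_n^j(dx^j)\Big).$$ A minimizer is a measure that minimizes the relative entropy $H(\mu\,\|\,\rho)$ over all products $\mu=\mu^1\otimes\cdots\otimes\mu^d$ of probability measures $\mu^i$ on $\mathbb R^{k_i}$. Then, for every $q\in[1,\infty)$: 1. The iterates are well defined: for all $n\ge0$ and $i$, the integral in the exponent exists for every $x^i$, and the normalizing constant is finite and positive. For every $n\ge 1$, $\mu_n$ has a Lebesgue density that belongs to $L^q(\mathbb R^k)$, and the set of the densities of $(\mu_n)_{n\ge 1}$ has compact closure in the norm topology of $L^q(\mathbb R^k)$. 2. Every subsequence of $(\mu_n)$ has a further subsequence whose densities converge in $L^q(\mathbb R^k)$ to the density of a minimizer. Whenever a subsequence $(\mu_{n_t})$ converges weakly to a probability measure $\nu$, the measure $\nu$ is a minimizer, it has a density in $L^q(\mathbb R^k)$, and the densities of $\mu_{n_t}$ converge to the density of $\nu$ in $L^q(\mathbb R^k)$. 3. If $\psi$ is strictly convex, then there is exactly one minimizer $\mu_*$, it has a density in $L^q(\mathbb R^k)$,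 and the densities of $\mu_n$ converge to the density of $\mu_*$ in $L^q(\mathbb R^k)$. -/

import Mathlib

open MeasureTheory Filter Topology
open scoped ENNReal ContDiff BoundedContinuousFunction

noncomputable section

namespace CAVI

/-- The block space `ℝ^{k i}`, with its Euclidean norm and Lebesgue measure. -/
abbrev Block {d : ℕ} (k : Fin d → ℕ) (i : Fin d) : Type := EuclideanSpace ℝ (Fin (k i))

/-- The space `ℝ^{k 1} × ⋯ × ℝ^{k d}`. Its `volume` is the product Lebesgue measure. The norm
that Lean puts on this product type is not used; see `euclNorm`. -/
abbrev Pt {d : ℕ} (k : Fin d → ℕ) : Type := (i : Fin d) → Block k i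

variable {d : ℕ} {k : Fin d → ℕ}

/-- The Euclidean norm `|x| = (∑ i, |x i| ^ 2) ^ (1/2)`. -/
def euclNorm (x : Pt k) : ℝ := ‖(WithLp.toLp 2 x : PiLp 2 (Block k))‖

/-- `g` is the weak gradient of `ψ`, tested against smooth compactly supported functions. -/
structure HasWeakGradient (ψ : Pt k → ℝ) (g : Pt k → Pt k) : Prop where
  locallyIntegrable_fun : LocallyIntegrable ψ
  locallyIntegrable_grad : LocallyIntegrable g
  integral_by_parts : ∀ φ : Pt k → ℝ, ContDiff ℝ ∞ φ → HasCompactSupport φ → ∀ v : Pt k,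
    ∫ x, ψ x * fderiv ℝ φ x v = - ∫ x, (∑ i, inner ℝ (g x i) (v i)) * φ x

/-- The probability measure `ρ` with density proportional to `exp (-ψ)`
(`Measure.tilted` contains the normalization). -/
def target (ψ : Pt k → ℝ) : Measure (Pt k) := volume.tilted (fun x => - ψ x)

/-- The function `x ↦ ∫ ψ (x, y^{-i}) m^{-i}(dy^{-i})` of the block variable `x`. The `i`-th block
of `y` is overwritten by `x`, and `m i` is a probability measure, so integrating against the full
product of the `m j` is integrating against the product of the `m j` with `j ≠ i`. -/
def blockPotential (ψ : Pt k → ℝ) (m : (i : Fin d) → Measure (Block k i)) (i : Fin d)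
    (x : Block k i) : ℝ :=
  ∫ y, ψ (Function.update y i x) ∂(Measure.pi m)

/-- The coordinate update: the probability measure on the `i`-th block with density proportional
to `exp (- ∫ ψ (x, y^{-i}) m^{-i}(dy^{-i}))`. -/
def blockUpdate (ψ : Pt k → ℝ) (m : (i : Fin d) → Measure (Block k i)) (i : Fin d) :
    Measure (Block k i) :=
  volume.tilted (fun x => - blockPotential ψ m i x)

/-- The vector of marginals after the first `j` blocks of `m` have been updated, one after
the other. -/
def partialSweep (ψ : Pt k → ℝ) (m : (i : Fin d) → Measure (Block k i)) :
    ℕ → (i : Fin d) → Measure (Block k i)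
  | 0 => m
  | j + 1 =>
    if h : j < d then
      Function.update (partialSweep ψ m j) ⟨j, h⟩ (blockUpdate ψ (partialSweep ψ m j) ⟨j, h⟩)
    else partialSweep ψ m j

/-- The marginals `(μ_n^1, …, μ_n^d)` of the `n`-th CAVI iterate started from `μ₀`. -/
def marginals (ψ : Pt k → ℝ) (μ₀ : (i : Fin d) → Measure (Block k i)) :
    ℕ → (i : Fin d) → Measure (Block k i)
  | 0 => μ₀
  | n + 1 => partialSweep ψ (marginals ψ μ₀ n) d

/-- The `n`-th CAVI iterate `μ_n = μ_n^1 ⊗ ⋯ ⊗ μ_n^d`. -/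
def iterate (ψ : Pt k → ℝ) (μ₀ : (i : Fin d) → Measure (Block k i)) (n : ℕ) : Measure (Pt k) :=
  Measure.pi (marginals ψ μ₀ n)

/-- The update of block `i` from the marginals `m` is well defined: the integral in the exponent
exists for every `x`, and the normalizing constant is finite and positive. -/
def UpdateWellDefined (ψ : Pt k → ℝ) (m : (i : Fin d) → Measure (Block k i)) (i : Fin d) : Prop :=
  (∀ x : Block k i, Integrable (fun y => ψ (Function.update y i x)) (Measure.pi m)) ∧
  Integrable (fun x => Real.exp (- blockPotential ψ m i x)) ∧
  0 < ∫ x, Real.exp (- blockPotential ψ m i x)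

/-- `ν` is a product of probability measures on the blocks. -/
def IsProductProbability (ν : Measure (Pt k)) : Prop :=
  ∃ m : (i : Fin d) → Measure (Block k i), (∀ i, IsProbabilityMeasure (m i)) ∧ ν = Measure.pi m

/-- `ν` minimizes the relative entropy `H(· ‖ ρ)`, `ρ ∝ exp (-ψ)`, over all products of
probability measures on the blocks. -/
def IsMinimizer (ψ : Pt k → ℝ) (ν : Measure (Pt k)) : Prop :=
  IsProductProbability ν ∧ ∀ ν' : Measure (Pt k), IsProductProbability ν' →
    InformationTheory.klDiv ν (target ψ) ≤ InformationTheory.klDiv ν' (target ψ)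

/-- Weak convergence of measures: convergence of the integrals of bounded continuous functions. -/
def WeaklyTendsto (μ : ℕ → Measure (Pt k)) (ν : Measure (Pt k)) : Prop :=
  ∀ f : Pt k →ᵇ ℝ, Tendsto (fun t => ∫ x, f x ∂(μ t)) atTop (𝓝 (∫ x, f x ∂ν))

/-- The Lebesgue density of a measure (meaningful when `μ ≪ volume`). -/
def density (μ : Measure (Pt k)) (x : Pt k) : ℝ := (μ.rnDeriv volume x).toReal

/-- `μ` has a Lebesgue density, and this density is in `L^q`. -/
def HasLqDensity (q : ℝ≥0∞) (μ : Measure (Pt k)) : Prop :=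
  μ ≪ volume ∧ MemLp (density μ) q volume

/-- Convergence of the densities in the norm of `L^q`. -/
def LqTendsto (q : ℝ≥0∞) (μ : ℕ → Measure (Pt k)) (ν : Measure (Pt k)) : Prop :=
  Tendsto (fun t => eLpNorm (density (μ t) - density ν) q volume) atTop (𝓝 0)

theorem partialSweep_eq_of_le (ψ : Pt k → ℝ) (m : (i : Fin d) → Measure (Block k i)) (i : Fin d)
    (j : ℕ) (hj : j ≤ i) : partialSweep ψ m j i = m i := by
  induction j with
  | zero => rfl
  | succ j ih =>
    have h : j < d := by omega
    have hne : i ≠ ⟨j, h⟩ := by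
      intro e
      rw [e] at hj
      simp at hj
    simp only [partialSweep, h, dif_pos, Function.update_of_ne hne]
    exact ih (by omega)

theorem partialSweep_eq_of_lt (ψ : Pt k → ℝ) (m : (i : Fin d) → Measure (Block k i)) (i : Fin d)
    (j : ℕ) (hj : (i : ℕ) < j) :
    partialSweep ψ m j i = blockUpdate ψ (partialSweep ψ m i) i := by
  induction j, hj using Nat.le_induction with
  | base => simp [partialSweep]
  | succ j hj ih =>
    simp only [partialSweep]
    split_ifs with h
    · have hne : i ≠ ⟨j, h⟩ := by
        intro e
        rw [e] at hj
        simp at hj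
      rw [Function.update_of_ne hne, ih]
    · exact ih

/-- The recursion for the iterates: `μ_{n+1}^i` has density proportional to the exponential of
minus the integral of `ψ` in the other blocks against `μ_{n+1}^j`, `j < i`, and `μ_n^j`, `j > i`. -/
theorem marginals_succ (ψ : Pt k → ℝ) (μ₀ : (i : Fin d) → Measure (Block k i)) (n : ℕ)
    (i : Fin d) :
    marginals ψ μ₀ (n + 1) i =
      blockUpdate ψ (fun j => if j < i then marginals ψ μ₀ (n + 1) j else marginals ψ μ₀ n j) i := by
  have key : partialSweep ψ (marginals ψ μ₀ n) i =
      fun j => if j < i then marginals ψ μ₀ (n + 1) j else marginals ψ μ₀ n j := by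
    funext j
    split_ifs with h
    · rw [marginals, partialSweep_eq_of_lt _ _ _ _ (Fin.lt_def.mp h),
        partialSweep_eq_of_lt _ _ _ _ j.isLt]
    · exact partialSweep_eq_of_le _ _ _ _ (Fin.le_def.mp (not_lt.mp h))
  rw [← key]
  exact partialSweep_eq_of_lt _ _ _ _ i.isLt

end CAVI

end

/-!
Coordinate ascent for the mean-field approximation of `ρ ∝ exp (-ψ)` converges because it is a
descent method for a functional that has no spurious critical points.

*Growth.* Convexity and integrability of `exp (-ψ)` give `ψ x ≥ a ‖x‖ - b` with `a > 0`
(`ConvexOn.exists_mul_norm_sub_le`), and by continuity the polynomial upper bound holds everywhere.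
These are the only properties of `ψ` that enter (`Admissible`). Consequently every block update is
a density bounded by `C exp (-a ‖x‖)` (`ExpDensity`), and on such densities the relative entropy
is, up to a constant, the functional `energy ψ f = ∫ ψ f + ∑ i, ∫ f i log (f i)`
(`Admissible.klDiv_eq`), which is continuous under pointwise convergence.

*Descent and compactness.* By the Gibbs variational principle (`gibbs_variational`) an update
minimizes the energy in one block, strictly unless the block is already equal to its update
(`Admissible.energy_step`). The energy bound along the iterates bounds the moments and the
normalizing constants, hence the constant `C` and a local Lipschitz constant of the densities
(`Admissible.exists_isRun`); a diagonal argument then gives pointwise convergent subsequences, and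
the exponential bound upgrades this to convergence in `L^q` and to weak convergence. Since the
energy decreases, limit points are fixed points of the updates
(`Admissible.eq_stepDens_of_tendsto`).

*Fixed points are minimizers.* This is displacement convexity of the energy, with the Knothe
rearrangement in each block in place of optimal transport. Let `f` be a fixed point and `g` a
product of positive continuous densities. In each block let the maps `knotheE (f i)` and
`knotheE (g i)` push the uniform measure on the cube forward to `f i` and `g i`. Both are
triangular with increasing diagonal, so the Jacobian determinant of
`(1 - t) • knotheE (f i) + t • knotheE (g i)` dominates the geometric mean of the two
determinants, and the entropy of the interpolation is at most the interpolation of the entropies;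
this enters in the form `integral_log_knotheE_interpolate_le`. Moving along the interpolation in
one block at a time and letting `t → 0`, the first-order optimality of `f` in each block and the
convexity of `ψ` give `energy ψ f ≤ energy ψ g`, with equality for strictly convex `ψ` only if the
two product measures agree (`Admissible.energy_le_of_eq_stepDens`). A general competitor of finite
entropy is first conditioned on bounded sets, which makes it exponentially decaying and changes
its entropy by little, and is then improved by one sweep, which makes it positive and continuous.

*Uniqueness.* A minimizer is compared with its conditionings on events `y i ∉ S`. This bounds
from above the average of the logarithm of its density over the blocks other than `i`, and the
lower bound on `ψ` turns this into exponential decay of each `h i` (`Admissible.exists_ae_le`).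
Hence a minimizer has an energy, is a fixed point, and the strict part of the convexity argument
applies.
-/

set_option linter.unusedSectionVars false

noncomputable section

namespace CAVI

/-! ### Exponential tails -/

section ExpTails

/-- Polynomial weights are dominated by exponential ones. -/
theorem one_add_rpow_le_exp {s a : ℝ} (hs : 0 ≤ s) (ha : 0 < a) :
    ∃ C : ℝ, 0 < C ∧ ∀ t : ℝ, 0 ≤ t → (1 + t) ^ s ≤ C * Real.exp (a * t) := by
  rcases hs.eq_or_lt with rfl | hs
  · refine ⟨1, one_pos, fun t ht => ?_⟩
    simpa using mul_nonneg ha.le ht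
  · set M : ℝ := max 1 (s / a) with hM
    have hM1 : 1 ≤ M := le_max_left _ _
    have hM2 : 1 ≤ M * (a / s) := by
      have : s / a ≤ M := le_max_right _ _
      calc (1 : ℝ) = s / a * (a / s) := by field_simp
        _ ≤ M * (a / s) := by gcongr
    refine ⟨M ^ s, by positivity, fun t ht => ?_⟩
    have h1 : 1 + t ≤ M * Real.exp (a / s * t) := by
      have := Real.add_one_le_exp (a / s * t)
      calc 1 + t ≤ M + (M * (a / s)) * t := by nlinarith
        _ = M * (a / s * t + 1) := by ring
        _ ≤ _ := by gcongr
    calc (1 + t) ^ s ≤ (M * Real.exp (a / s * t)) ^ s := by gcongr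
      _ = M ^ s * Real.exp (a * t) := by
        rw [Real.mul_rpow (by positivity) (Real.exp_pos _).le, ← Real.exp_mul]
        congr 2
        field_simp

variable {E : Type*} [NormedAddCommGroup E] [NormedSpace ℝ E] [FiniteDimensional ℝ E]
  [MeasurableSpace E] [BorelSpace E] (μ : Measure E) [μ.IsAddHaarMeasure]

theorem integrable_exp_neg_mul_norm {a : ℝ} (ha : 0 < a) :
    Integrable (fun x : E => Real.exp (-(a * ‖x‖))) μ := by
  set r : ℝ := Module.finrank ℝ E + 1 with hr
  have hr0 : 0 ≤ r := by positivity
  obtain ⟨C, hC, h⟩ := one_add_rpow_le_exp hr0 ha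
  have hi : Integrable (fun x : E => (1 + ‖x‖) ^ (-r)) μ := integrable_one_add_norm (by simp [hr])
  refine (hi.const_mul C).mono' (by fun_prop) (ae_of_all _ fun x => ?_)
  have hx := h ‖x‖ (norm_nonneg x)
  rw [Real.norm_of_nonneg (Real.exp_pos _).le, Real.exp_neg, Real.rpow_neg (by positivity),
    ← div_eq_mul_inv, ← one_div, div_le_div_iff₀ (Real.exp_pos _) (by positivity)]
  linarith

theorem integrable_one_add_norm_rpow_mul_exp {s a : ℝ} (hs : 0 ≤ s) (ha : 0 < a) :
    Integrable (fun x : E => (1 + ‖x‖) ^ s * Real.exp (-(a * ‖x‖))) μ := by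
  obtain ⟨C, hC, h⟩ := one_add_rpow_le_exp hs (half_pos ha)
  refine ((integrable_exp_neg_mul_norm μ (half_pos ha)).const_mul C).mono' ?_
    (ae_of_all _ fun x => ?_)
  · exact Measurable.aestronglyMeasurable (by fun_prop)
  · rw [Real.norm_of_nonneg (by positivity)]
    calc (1 + ‖x‖) ^ s * Real.exp (-(a * ‖x‖))
        ≤ C * Real.exp (a / 2 * ‖x‖) * Real.exp (-(a * ‖x‖)) := by
          gcongr
          exact h _ (norm_nonneg _)
      _ = C * Real.exp (-(a / 2 * ‖x‖)) := by
          rw [mul_assoc, ← Real.exp_add]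
          ring_nf

/-- A convex function `ψ` with `∫ exp (-ψ) < ∞` grows at least linearly: if `ψ` were small at a
far away point `x`, convexity would make `ψ` bounded on the ball of fixed radius around `x / 2`, and
the integral of `exp (-ψ)` over such balls tends to zero. -/
theorem _root_.ConvexOn.exists_mul_norm_sub_le {ψ : E → ℝ} (hψ : ConvexOn ℝ Set.univ ψ)
    (hint : Integrable (fun x => Real.exp (-ψ x)) μ) :
    ∃ a b : ℝ, 0 < a ∧ ∀ x, a * ‖x‖ - b ≤ ψ x := by
  have hcont : Continuous ψ := hψ.locallyLipschitz.continuous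
  obtain ⟨r, hr, hball⟩ : ∃ r > 0, ∀ y ∈ Metric.ball (0 : E) r, ψ y < ψ 0 + 1 := by
    have : ∀ᶠ y in 𝓝 (0 : E), ψ y < ψ 0 + 1 :=
      hcont.continuousAt.eventually (gt_mem_nhds (by linarith : ψ 0 < ψ 0 + 1))
    exact Metric.eventually_nhds_iff_ball.mp this
  set ε : ℝ := μ.real (Metric.ball (0 : E) (r / 2)) * Real.exp (-(ψ 0 + 1)) with hε
  have hε0 : 0 < ε := by
    have h1 : 0 < μ (Metric.ball (0 : E) (r / 2)) := Metric.measure_ball_pos _ _ (by positivity)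
    have h2 : μ (Metric.ball (0 : E) (r / 2)) < ⊤ := measure_ball_lt_top
    have : 0 < μ.real (Metric.ball (0 : E) (r / 2)) := ENNReal.toReal_pos h1.ne' h2.ne
    positivity
  -- the tails of the integral of `exp (-ψ)`
  have htail : Tendsto (fun n : ℕ => ∫ x in (Metric.closedBall (0 : E) n)ᶜ, Real.exp (-ψ x) ∂μ)
      atTop (𝓝 0) := by
    have h := tendsto_setIntegral_of_antitone (μ := μ) (f := fun x => Real.exp (-ψ x))
      (s := fun n : ℕ => (Metric.closedBall (0 : E) n)ᶜ)
      (fun n => Metric.isClosed_closedBall.measurableSet.compl)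
      (fun m n hmn => Set.compl_subset_compl.mpr
        (Metric.closedBall_subset_closedBall (by exact_mod_cast hmn))) ⟨0, hint.integrableOn⟩
    have he : (⋂ n : ℕ, (Metric.closedBall (0 : E) n)ᶜ) = ∅ := by
      ext x
      obtain ⟨n, hn⟩ := exists_nat_ge ‖x‖
      simp only [Set.mem_iInter, Set.mem_compl_iff, Metric.mem_closedBall, dist_zero_right,
        Set.mem_empty_iff_false, iff_false, not_forall, not_not]
      exact ⟨n, hn⟩
    simpa [he] using h
  obtain ⟨N, hN⟩ := (htail.eventually (gt_mem_nhds hε0)).exists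
  set R : ℝ := 2 * (N + r) with hR
  have hRpos : 0 < R := by positivity
  have key : ∀ x : E, R ≤ ‖x‖ → ψ 0 + 1 ≤ ψ x := by
    intro x hx
    by_contra! hlt
    set z : E := (1 / 2 : ℝ) • x with hz
    have hzn : ‖z‖ = ‖x‖ / 2 := by
      rw [hz, norm_smul]
      norm_num
      ring
    have hsub : Metric.ball z (r / 2) ⊆ (Metric.closedBall (0 : E) N)ᶜ := by
      intro y hy
      simp only [Set.mem_compl_iff, Metric.mem_closedBall, dist_zero_right, not_le]
      rw [Metric.mem_ball, dist_eq_norm] at hy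
      have : ‖z‖ ≤ ‖y‖ + ‖y - z‖ := by
        calc ‖z‖ = ‖y - (y - z)‖ := by congr 1; abel
          _ ≤ _ := norm_sub_le _ _
      linarith
    have hval : ∀ y ∈ Metric.ball z (r / 2), ψ y ≤ ψ 0 + 1 := by
      intro y hy
      set w : E := (2 : ℝ) • (y - z) with hw
      have hwr : w ∈ Metric.ball (0 : E) r := by
        rw [Metric.mem_ball, dist_zero_right, hw, norm_smul]
        rw [Metric.mem_ball, dist_eq_norm] at hy
        norm_num
        linarith
      have hy' : y = (1 / 2 : ℝ) • x + (1 / 2 : ℝ) • w := by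
        rw [hw, smul_smul, ← hz]
        norm_num
      have := hψ.2 (Set.mem_univ x) (Set.mem_univ w) (by norm_num : (0 : ℝ) ≤ 1 / 2)
        (by norm_num : (0 : ℝ) ≤ 1 / 2) (by norm_num)
      rw [hy']
      have h1 := hball w hwr
      simp only [smul_eq_mul] at this
      linarith
    have h1 : ε ≤ ∫ y in Metric.ball z (r / 2), Real.exp (-ψ y) ∂μ := by
      have hc : ∫ y in Metric.ball z (r / 2), Real.exp (-(ψ 0 + 1)) ∂μ = ε := by
        rw [setIntegral_const, smul_eq_mul, hε]
        congr 1
        simp only [Measure.real]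
        rw [Measure.addHaar_ball_center]
      rw [← hc]
      refine setIntegral_mono_on ?_ hint.integrableOn Metric.isOpen_ball.measurableSet ?_
      · exact integrableOn_const (measure_ball_lt_top).ne
      · intro y hy
        exact Real.exp_le_exp.mpr (by linarith [hval y hy])
    have h2 : ∫ y in Metric.ball z (r / 2), Real.exp (-ψ y) ∂μ
        ≤ ∫ x in (Metric.closedBall (0 : E) N)ᶜ, Real.exp (-ψ x) ∂μ :=
      setIntegral_mono_set hint.integrableOn (ae_of_all _ fun _ => (Real.exp_pos _).le)
        hsub.eventuallyLE
    linarith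
  -- outside of the ball of radius `R`, compare along the ray; inside, use compactness
  obtain ⟨b₀, hb₀⟩ := (isCompact_closedBall (0 : E) R).bddBelow_image hcont.continuousOn
  refine ⟨1 / R, |ψ 0| + 1 + |b₀|, by positivity, fun x => ?_⟩
  rcases le_total R ‖x‖ with hx | hx
  · have hxpos : 0 < ‖x‖ := hRpos.trans_le hx
    have hs0 : 0 ≤ R / ‖x‖ := by positivity
    have hs1 : R / ‖x‖ ≤ 1 := (div_le_one hxpos).mpr hx
    have hc := hψ.2 (Set.mem_univ (0 : E)) (Set.mem_univ x) (by linarith : 0 ≤ 1 - R / ‖x‖) hs0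
      (by ring)
    have hn : ‖(R / ‖x‖) • x‖ = R := by
      rw [norm_smul, Real.norm_of_nonneg hs0]
      field_simp
    have hk := key ((R / ‖x‖) • x) hn.ge
    simp only [smul_zero, zero_add, smul_eq_mul] at hc
    have h1 : 1 ≤ R / ‖x‖ * (ψ x - ψ 0) := by nlinarith
    have h2 : 1 / R * ‖x‖ ≤ ψ x - ψ 0 := by
      rw [div_mul_eq_mul_div, one_mul, div_le_iff₀ hRpos]
      rw [div_mul_eq_mul_div, le_div_iff₀ hxpos] at h1
      linarith
    have := neg_abs_le (ψ 0)
    have := abs_nonneg b₀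
    linarith
  · have h1 : b₀ ≤ ψ x := hb₀ ⟨x, by simpa using hx, rfl⟩
    have h2 : 1 / R * ‖x‖ ≤ 1 := by
      rw [div_mul_eq_mul_div, one_mul]
      exact (div_le_one hRpos).mpr hx
    have := neg_abs_le b₀
    have := abs_nonneg (ψ 0)
    linarith

/-- A convex function of polynomial growth has increments of polynomial growth. The increment from
`x` to `y` is compared with the one from `x` to the point at distance one beyond `y`. -/
theorem _root_.ConvexOn.abs_sub_le_of_growth {ψ : E → ℝ} (hψ : ConvexOn ℝ Set.univ ψ) {c p : ℝ}
    (hc : 0 ≤ c) (hp : 0 ≤ p) (hg : ∀ x, |ψ x| ≤ c * (1 + ‖x‖) ^ p) (x y : E) :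
    |ψ x - ψ y| ≤ 2 * c * (2 + ‖x‖ + ‖y‖) ^ p * ‖x - y‖ := by
  have main : ∀ x y : E, ψ y - ψ x ≤ 2 * c * (2 + ‖x‖ + ‖y‖) ^ p * ‖x - y‖ := by
    intro x y
    rcases eq_or_ne x y with rfl | hxy
    · simp
    set δ := ‖x - y‖ with hδ
    have hδ0 : 0 < δ := norm_pos_iff.mpr (sub_ne_zero.mpr hxy)
    set z : E := y + (1 / δ) • (y - x) with hz
    set s := δ / (1 + δ) with hs
    have hs0 : 0 ≤ s := by positivity
    have hs1 : 0 ≤ 1 - s := by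
      rw [hs, sub_nonneg]
      exact (div_le_one (by positivity)).mpr (by linarith)
    have hy : (1 - s) • x + s • z = y := by
      have e1 : s * (1 / δ) = 1 - s := by
        rw [hs]
        field_simp
        ring
      rw [hz, smul_add, smul_smul, e1, smul_sub, sub_smul, sub_smul]
      simp only [one_smul]
      abel
    have hcx := hψ.2 (Set.mem_univ x) (Set.mem_univ z) hs1 hs0 (by ring)
    rw [hy] at hcx
    simp only [smul_eq_mul] at hcx
    have hzn : ‖z‖ ≤ ‖y‖ + 1 := by
      calc ‖z‖ ≤ ‖y‖ + ‖(1 / δ) • (y - x)‖ := norm_add_le _ _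
        _ = ‖y‖ + 1 := by
          rw [norm_smul, norm_sub_rev, ← hδ, Real.norm_of_nonneg (by positivity)]
          field_simp
    have b1 : |ψ x| ≤ c * (2 + ‖x‖ + ‖y‖) ^ p := by
      refine (hg x).trans ?_
      gcongr ?_ * ?_ ^ p
      have := norm_nonneg y
      linarith
    have b2 : |ψ z| ≤ c * (2 + ‖x‖ + ‖y‖) ^ p := by
      refine (hg z).trans ?_
      gcongr ?_ * ?_ ^ p
      have := norm_nonneg x
      linarith
    have hsδ : s ≤ δ := div_le_self hδ0.le (by linarith)
    calc ψ y - ψ x ≤ s * (ψ z - ψ x) := by linarith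
      _ ≤ s * (2 * (c * (2 + ‖x‖ + ‖y‖) ^ p)) := by
        gcongr
        have := le_abs_self (ψ z)
        have := neg_abs_le (ψ x)
        linarith
      _ ≤ δ * (2 * (c * (2 + ‖x‖ + ‖y‖) ^ p)) := by gcongr
      _ = _ := by ring
  rw [abs_le]
  constructor
  · linarith [main x y]
  · have := main y x
    rw [norm_sub_rev, show 2 + ‖y‖ + ‖x‖ = 2 + ‖x‖ + ‖y‖ by ring] at this
    linarith

end ExpTails

/-! ### Densities with exponential tails and Gibbs' variational principle -/

section Densities

variable {E : Type*} [NormedAddCommGroup E] [NormedSpace ℝ E] [FiniteDimensional ℝ E]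
  [MeasureSpace E] [BorelSpace E]

/-- `f` is a probability density bounded by `C * exp (-a ‖x‖)`. -/
structure ExpDensity (a C : ℝ) (f : E → ℝ) : Prop where
  measurable : Measurable f
  nonneg : ∀ x, 0 ≤ f x
  le : ∀ x, f x ≤ C * Real.exp (-(a * ‖x‖))
  integral_eq : ∫ x, f x = 1

variable {a C : ℝ} {f : E → ℝ}

theorem ExpDensity.C_nonneg (hf : ExpDensity a C f) : 0 ≤ C := by
  have := (hf.nonneg 0).trans (hf.le 0)
  simpa using this

theorem ExpDensity.mono (hf : ExpDensity a C f) {C' : ℝ} (h : C ≤ C') : ExpDensity a C' f where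
  measurable := hf.measurable
  nonneg := hf.nonneg
  le x := (hf.le x).trans (by gcongr)
  integral_eq := hf.integral_eq

variable [(volume : Measure E).IsAddHaarMeasure]

theorem ExpDensity.integrable_weight_mul (hf : ExpDensity a C f) (ha : 0 < a) {s : ℝ}
    (hs : 0 ≤ s) : Integrable (fun x => (1 + ‖x‖) ^ s * f x) := by
  refine ((integrable_one_add_norm_rpow_mul_exp volume hs ha).const_mul C).mono' ?_
    (ae_of_all _ fun x => ?_)
  · have := hf.measurable
    exact Measurable.aestronglyMeasurable (by fun_prop)
  · have := hf.nonneg x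
    rw [Real.norm_of_nonneg (by positivity)]
    calc (1 + ‖x‖) ^ s * f x ≤ (1 + ‖x‖) ^ s * (C * Real.exp (-(a * ‖x‖))) := by
          gcongr
          exact hf.le x
      _ = _ := by ring

theorem ExpDensity.integrable (hf : ExpDensity a C f) (ha : 0 < a) : Integrable f := by
  simpa using hf.integrable_weight_mul ha le_rfl

theorem ExpDensity.integrable_mul (hf : ExpDensity a C f) (ha : 0 < a) {V : E → ℝ}
    (hV : Measurable V) {c s : ℝ} (hs : 0 ≤ s) (hb : ∀ x, |V x| ≤ c * (1 + ‖x‖) ^ s) :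
    Integrable (fun x => V x * f x) := by
  refine ((hf.integrable_weight_mul ha hs).const_mul c).mono'
    (hV.mul hf.measurable).aestronglyMeasurable (ae_of_all _ fun x => ?_)
  rw [norm_mul, Real.norm_of_nonneg (hf.nonneg x), ← mul_assoc]
  exact mul_le_mul_of_nonneg_right (hb x) (hf.nonneg x)

theorem abs_mul_log_le {t : ℝ} (ht : 0 ≤ t) : |t * Real.log t| ≤ 2 * √t + t ^ 2 := by
  rcases ht.eq_or_lt with rfl | ht
  · simp
  have hs : 0 < √t := Real.sqrt_pos.mpr ht
  have hsq : √t * √t = t := Real.mul_self_sqrt ht.le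
  have h1 : Real.log t ≤ t := (Real.log_le_sub_one_of_pos ht).trans (by linarith)
  have h2 : -Real.log t ≤ 2 * (1 / √t) := by
    have e : Real.log t = 2 * Real.log (√t) := by rw [Real.log_sqrt ht.le]; ring
    have := Real.log_le_sub_one_of_pos (inv_pos.mpr hs)
    rw [Real.log_inv] at this
    rw [one_div, e]
    linarith
  rw [abs_le]
  have h3 : t * (1 / √t) = √t := by
    rw [mul_one_div, div_eq_iff hs.ne', hsq]
  constructor
  · nlinarith
  · nlinarith

theorem ExpDensity.abs_mul_log_le (hf : ExpDensity a C f) (ha : 0 < a) (x : E) :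
    |f x * Real.log (f x)| ≤ (2 * √C + C ^ 2) * Real.exp (-(a / 2 * ‖x‖)) := by
  have hC := hf.C_nonneg
  have h0 := hf.nonneg x
  have hle := hf.le x
  have h1 : √(f x) ≤ √C * Real.exp (-(a / 2 * ‖x‖)) := by
    calc √(f x) ≤ √(C * Real.exp (-(a * ‖x‖))) := Real.sqrt_le_sqrt hle
      _ = _ := by
        rw [Real.sqrt_mul hC, ← Real.exp_half]
        ring_nf
  have h2 : f x ^ 2 ≤ C ^ 2 * Real.exp (-(a / 2 * ‖x‖)) := by
    calc f x ^ 2 ≤ (C * Real.exp (-(a * ‖x‖))) ^ 2 := by gcongr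
      _ = C ^ 2 * Real.exp (-(2 * a * ‖x‖)) := by
        rw [mul_pow, ← Real.exp_nat_mul]
        push_cast
        ring_nf
      _ ≤ _ := by
        gcongr
        linarith
  calc |f x * Real.log (f x)| ≤ 2 * √(f x) + f x ^ 2 := CAVI.abs_mul_log_le h0
    _ ≤ 2 * (√C * Real.exp (-(a / 2 * ‖x‖))) + C ^ 2 * Real.exp (-(a / 2 * ‖x‖)) := by gcongr
    _ = _ := by ring

theorem ExpDensity.integrable_mul_log (hf : ExpDensity a C f) (ha : 0 < a) :
    Integrable (fun x => f x * Real.log (f x)) := by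
  refine ((integrable_exp_neg_mul_norm volume (half_pos ha)).const_mul (2 * √C + C ^ 2)).mono'
    (hf.measurable.mul hf.measurable.log).aestronglyMeasurable (ae_of_all _ fun x => ?_)
  exact hf.abs_mul_log_le ha x

/-- The negative differential entropy of a density. -/
def negEnt (f : E → ℝ) : ℝ := ∫ x, f x * Real.log (f x)

theorem tendsto_negEnt {u : ℕ → E → ℝ} (hu : ∀ n, ExpDensity a C (u n))
    (ha : 0 < a) (h : ∀ᵐ x, Tendsto (fun n => u n x) atTop (𝓝 (f x))) :
    Tendsto (fun n => negEnt (u n)) atTop (𝓝 (negEnt f)) := by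
  refine tendsto_integral_of_dominated_convergence
    (fun x => (2 * √C + C ^ 2) * Real.exp (-(a / 2 * ‖x‖)))
    (fun n => ((hu n).measurable.mul (hu n).measurable.log).aestronglyMeasurable)
    ((integrable_exp_neg_mul_norm volume (half_pos ha)).const_mul _)
    (fun n => ae_of_all _ fun x => (hu n).abs_mul_log_le ha x) ?_
  filter_upwards [h] with x hx
  exact (Real.continuous_mul_log.tendsto (f x)).comp hx

/-- The probability density proportional to `exp (-V)`. -/
def gibbs (V : E → ℝ) (x : E) : ℝ := Real.exp (-V x) / ∫ y, Real.exp (-V y)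

section Gibbs

variable {V : E → ℝ} {b : ℝ}

theorem integrable_exp_neg_of_le (ha : 0 < a) (hV : Measurable V)
    (hlow : ∀ x, a * ‖x‖ - b ≤ V x) : Integrable (fun x => Real.exp (-V x)) := by
  refine ((integrable_exp_neg_mul_norm volume ha).const_mul (Real.exp b)).mono'
    (hV.neg.exp).aestronglyMeasurable (ae_of_all _ fun x => ?_)
  rw [Real.norm_of_nonneg (Real.exp_pos _).le, ← Real.exp_add]
  exact Real.exp_le_exp.mpr (by linarith [hlow x])

theorem integral_exp_neg_pos (hi : Integrable (fun x => Real.exp (-V x))) :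
    0 < ∫ x, Real.exp (-V x) := by
  have : NeZero (volume : Measure E) := inferInstance
  exact integral_exp_pos hi

theorem gibbs_pos (hi : Integrable (fun x => Real.exp (-V x))) (x : E) : 0 < gibbs V x :=
  div_pos (Real.exp_pos _) (integral_exp_neg_pos hi)

theorem gibbs_expDensity (ha : 0 < a) (hV : Measurable V) (hlow : ∀ x, a * ‖x‖ - b ≤ V x) :
    ExpDensity a (Real.exp b / ∫ y, Real.exp (-V y)) (gibbs V) := by
  have hi := integrable_exp_neg_of_le ha hV hlow
  have hZ := integral_exp_neg_pos hi
  refine ⟨?_, fun x => (gibbs_pos hi x).le, fun x => ?_, ?_⟩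
  · exact hV.neg.exp.div_const _
  · rw [gibbs, div_mul_eq_mul_div, ← Real.exp_add]
    gcongr
    linarith [hlow x]
  · simp only [gibbs]
    rw [integral_div, div_self hZ.ne']

theorem mul_log_sub_nonneg {t s : ℝ} (ht : 0 ≤ t) (hs : 0 < s) :
    0 ≤ t * Real.log t - t * Real.log s - t + s ∧
      (t * Real.log t - t * Real.log s - t + s = 0 → t = s) := by
  have e : t * Real.log t - t * Real.log s - t + s = s * InformationTheory.klFun (t / s) := by
    rcases ht.eq_or_lt with rfl | ht
    · simp [InformationTheory.klFun]
    · rw [InformationTheory.klFun, Real.log_div ht.ne' hs.ne']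
      field_simp
      ring
  rw [e]
  refine ⟨mul_nonneg hs.le (InformationTheory.klFun_nonneg (by positivity)), fun h => ?_⟩
  have := (mul_eq_zero.mp h).resolve_left hs.ne'
  rw [InformationTheory.klFun_eq_zero_iff (by positivity)] at this
  field_simp at this
  exact this

/-- Gibbs' variational principle: `∫ f log f + ∫ V f` is minimal, with value
`-log ∫ exp (-V)`, exactly at the density proportional to `exp (-V)`. -/
theorem gibbs_variational {a' b : ℝ} (hf : ExpDensity a C f) (ha : 0 < a) (ha' : 0 < a')
    (hV : Measurable V) (hlow : ∀ x, a' * ‖x‖ - b ≤ V x) (hVf : Integrable (fun x => V x * f x)) :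
    -Real.log (∫ x, Real.exp (-V x)) ≤ negEnt f + ∫ x, V x * f x ∧
    (negEnt f + ∫ x, V x * f x = -Real.log (∫ x, Real.exp (-V x)) ↔ f =ᵐ[volume] gibbs V) := by
  have hi := integrable_exp_neg_of_le ha' hV hlow
  have hZ := integral_exp_neg_pos hi
  have hg := gibbs_expDensity ha' hV hlow
  set Z := ∫ x, Real.exp (-V x) with hZdef
  set D : E → ℝ := fun x => f x * Real.log (f x) - f x * Real.log (gibbs V x) - f x + gibbs V x
    with hD
  have hlog : ∀ x, Real.log (gibbs V x) = -V x - Real.log Z := by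
    intro x
    rw [gibbs, Real.log_div (Real.exp_pos _).ne' hZ.ne', Real.log_exp]
  have hDeq : D = fun x => f x * Real.log (f x) + V x * f x + (Real.log Z - 1) * f x
      + gibbs V x := by
    funext x
    simp only [hD, hlog]
    ring
  have i1 := hf.integrable_mul_log ha
  have i2 := hf.integrable ha
  have i3 := hg.integrable ha'
  have hDint : Integrable D := by
    rw [hDeq]
    exact ((i1.add hVf).add (i2.const_mul _)).add i3
  have hDval : ∫ x, D x = negEnt f + (∫ x, V x * f x) + Real.log Z := by
    rw [hDeq, integral_add (f := fun x => f x * Real.log (f x) + V x * f x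
        + (Real.log Z - 1) * f x) ((i1.add hVf).add (i2.const_mul _)) i3,
      integral_add (f := fun x => f x * Real.log (f x) + V x * f x)
        (i1.add hVf) (i2.const_mul _), integral_add i1 hVf,
      integral_const_mul, hf.integral_eq, hg.integral_eq, negEnt]
    ring
  have hD0 : ∀ x, 0 ≤ D x := fun x => (mul_log_sub_nonneg (hf.nonneg x) (gibbs_pos hi x)).1
  have h0 : 0 ≤ ∫ x, D x := integral_nonneg hD0
  refine ⟨by linarith, ?_⟩
  have : negEnt f + ∫ x, V x * f x = -Real.log Z ↔ ∫ x, D x = 0 := by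
    rw [hDval]
    constructor <;> intro h <;> linarith
  rw [this, integral_eq_zero_iff_of_nonneg hD0 hDint]
  constructor
  · intro h
    filter_upwards [h] with x hx
    exact (mul_log_sub_nonneg (hf.nonneg x) (gibbs_pos hi x)).2 hx
  · intro h
    filter_upwards [h] with x hx
    simp [hD, hx]

end Gibbs

end Densities

/-! ### The Knothe map from the cube -/

section Knothe

/-- A continuous positive function with an exponential tail. -/
structure PosExpDecay {E : Type*} [NormedAddCommGroup E] (f : E → ℝ) : Prop where
  continuous : Continuous f
  pos : ∀ x, 0 < f x
  exists_le : ∃ a C : ℝ, 0 < a ∧ ∀ x, f x ≤ C * Real.exp (-(a * ‖x‖))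

theorem PosExpDecay.integrable {E : Type*} [NormedAddCommGroup E] [NormedSpace ℝ E]
    [FiniteDimensional ℝ E] [MeasureSpace E] [BorelSpace E]
    [(volume : Measure E).IsAddHaarMeasure] {f : E → ℝ} (hf : PosExpDecay f) : Integrable f := by
  obtain ⟨a, C, ha, h⟩ := hf.exists_le
  refine ((integrable_exp_neg_mul_norm volume ha).const_mul C).mono'
    hf.continuous.aestronglyMeasurable (ae_of_all _ fun x => ?_)
  rw [Real.norm_of_nonneg (hf.pos x).le]
  exact h x

theorem PosExpDecay.integral_pos {E : Type*} [NormedAddCommGroup E] [NormedSpace ℝ E]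
    [FiniteDimensional ℝ E] [MeasureSpace E] [BorelSpace E]
    [(volume : Measure E).IsAddHaarMeasure] {f : E → ℝ} (hf : PosExpDecay f) : 0 < ∫ x, f x := by
  rw [integral_pos_iff_support_of_nonneg (fun x => (hf.pos x).le) hf.integrable]
  have : Function.support f = Set.univ := by
    ext x
    simp [(hf.pos x).ne']
  rw [this]
  exact Measure.measure_univ_pos.mpr (NeZero.ne _)

/-! #### Quantile functions -/

/-- The unnormalized distribution function of the density `f` on the line. -/
def cdfInt (f : ℝ → ℝ) (x : ℝ) : ℝ := ∫ t in Set.Iic x, f t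

/-- The quantile function of the unnormalized density `f`, with value `0` outside `(0, 1)`. -/
def quantile (f : ℝ → ℝ) (u : ℝ) : ℝ := sInf {x | u * ∫ t, f t ≤ cdfInt f x}

section

variable {f g : ℝ → ℝ} (hf : PosExpDecay f) (hg : PosExpDecay g)

include hf

theorem hasDerivAt_cdfInt (x : ℝ) : HasDerivAt (cdfInt f) (f x) x := by
  have h1 : HasDerivAt (fun y => ∫ t in (0 : ℝ)..y, f t) (f x) x :=
    intervalIntegral.integral_hasDerivAt_right (hf.continuous.intervalIntegrable _ _)
      (hf.continuous.stronglyMeasurableAtFilter _ _) hf.continuous.continuousAt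
  have h2 : cdfInt f = fun y => cdfInt f 0 + ∫ t in (0 : ℝ)..y, f t := by
    funext y
    have := intervalIntegral.integral_Iic_sub_Iic (μ := volume) (f := f) (a := 0) (b := y)
      hf.integrable.integrableOn hf.integrable.integrableOn
    rw [← this, cdfInt, cdfInt]
    ring
  rw [h2]
  exact h1.const_add _

theorem strictMono_cdfInt : StrictMono (cdfInt f) :=
  strictMono_of_hasDerivAt_pos (hasDerivAt_cdfInt hf) hf.pos

theorem continuous_cdfInt : Continuous (cdfInt f) :=
  continuous_iff_continuousAt.mpr fun x => (hasDerivAt_cdfInt hf x).continuousAt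

theorem tendsto_cdfInt_atTop : Tendsto (cdfInt f) atTop (𝓝 (∫ t, f t)) := by
  have := (aecover_Iic (μ := volume) (tendsto_id (α := ℝ) (x := atTop)))
  exact this.integral_tendsto_of_countably_generated hf.integrable

theorem tendsto_cdfInt_atBot : Tendsto (cdfInt f) atBot (𝓝 0) := by
  have h := (aecover_Ioi (μ := volume) (tendsto_id (α := ℝ) (x := atBot)))
  have h2 := h.integral_tendsto_of_countably_generated hf.integrable
  have h3 : cdfInt f = fun x => (∫ t, f t) - ∫ t in Set.Ioi x, f t := by
    funext x
    have := integral_add_compl (measurableSet_Iic (a := x)) hf.integrable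
    rw [Set.compl_Iic] at this
    rw [← this, cdfInt]
    ring
  rw [h3]
  simpa using h2.const_sub (∫ t, f t)

theorem cdfInt_mem (x : ℝ) : 0 < cdfInt f x ∧ cdfInt f x < ∫ t, f t := by
  constructor
  · have h1 := (strictMono_cdfInt hf).monotone.le_of_tendsto (tendsto_cdfInt_atBot hf) (x - 1)
    exact h1.trans_lt (strictMono_cdfInt hf (by linarith))
  · have h1 := (strictMono_cdfInt hf).monotone.ge_of_tendsto (tendsto_cdfInt_atTop hf) (x + 1)
    exact (strictMono_cdfInt hf (by linarith)).trans_le h1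

theorem exists_cdfInt_eq {u : ℝ} (hu : u ∈ Set.Ioo (0 : ℝ) 1) :
    ∃ x, cdfInt f x = u * ∫ t, f t := by
  have hM := hf.integral_pos
  have h1 : ∀ᶠ x in atBot, cdfInt f x < u * ∫ t, f t :=
    (tendsto_cdfInt_atBot hf).eventually (gt_mem_nhds (mul_pos hu.1 hM))
  have h2 : ∀ᶠ x in atTop, u * ∫ t, f t < cdfInt f x :=
    (tendsto_cdfInt_atTop hf).eventually (lt_mem_nhds (by nlinarith [hu.2]))
  obtain ⟨x, hx⟩ := h1.exists
  obtain ⟨y, hy⟩ := h2.exists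
  exact mem_range_of_exists_le_of_exists_ge (continuous_cdfInt hf) ⟨x, hx.le⟩ ⟨y, hy.le⟩

theorem quantile_eq {u x : ℝ} (h : cdfInt f x = u * ∫ t, f t) : quantile f u = x := by
  have : {y | u * ∫ t, f t ≤ cdfInt f y} = Set.Ici x := by
    ext y
    simp only [Set.mem_ofPred_eq, ← h, (strictMono_cdfInt hf).le_iff_le, Set.mem_Ici]
  rw [quantile, this, csInf_Ici]

theorem cdfInt_quantile {u : ℝ} (hu : u ∈ Set.Ioo (0 : ℝ) 1) :
    cdfInt f (quantile f u) = u * ∫ t, f t := by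
  obtain ⟨x, hx⟩ := exists_cdfInt_eq hf hu
  rw [quantile_eq hf hx, hx]

theorem quantile_le_iff {u : ℝ} (hu : u ∈ Set.Ioo (0 : ℝ) 1) (x : ℝ) :
    quantile f u ≤ x ↔ u * ∫ t, f t ≤ cdfInt f x := by
  rw [← cdfInt_quantile hf hu, (strictMono_cdfInt hf).le_iff_le]

theorem quantile_of_notMem {u : ℝ} (hu : u ∉ Set.Ioo (0 : ℝ) 1) : quantile f u = 0 := by
  have hM := hf.integral_pos
  simp only [Set.mem_Ioo, not_and_or, not_lt] at hu
  rcases hu with hu | hu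
  · have : {y | u * ∫ t, f t ≤ cdfInt f y} = Set.univ := by
      ext y
      have := (cdfInt_mem hf y).1
      simp only [Set.mem_ofPred_eq, Set.mem_univ, iff_true]
      nlinarith
    rw [quantile, this, Real.sInf_univ]
  · have : {y | u * ∫ t, f t ≤ cdfInt f y} = ∅ := by
      ext y
      have := (cdfInt_mem hf y).2
      simp only [Set.mem_ofPred_eq, Set.mem_empty_iff_false, iff_false, not_le]
      nlinarith
    rw [quantile, this, Real.sInf_empty]

theorem quantile_image : quantile f '' Set.Ioo 0 1 = Set.univ := by
  refine Set.eq_univ_of_forall fun x => ?_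
  have hM := hf.integral_pos
  have hx := cdfInt_mem hf x
  refine ⟨cdfInt f x / ∫ t, f t, ⟨div_pos hx.1 hM, (div_lt_one hM).mpr hx.2⟩, ?_⟩
  apply quantile_eq hf
  field_simp

theorem strictMonoOn_quantile : StrictMonoOn (quantile f) (Set.Ioo 0 1) := by
  intro u hu v hv huv
  rw [← (strictMono_cdfInt hf).lt_iff_lt, cdfInt_quantile hf hu, cdfInt_quantile hf hv]
  exact mul_lt_mul_of_pos_right huv hf.integral_pos

theorem hasDerivAt_quantile {u : ℝ} (hu : u ∈ Set.Ioo (0 : ℝ) 1) :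
    HasDerivAt (quantile f) ((∫ t, f t) / f (quantile f u)) u := by
  have hM := hf.integral_pos
  have hnhds : Set.Ioo (0 : ℝ) 1 ∈ 𝓝 u := Ioo_mem_nhds hu.1 hu.2
  have hc : ContinuousAt (quantile f) u :=
    (strictMonoOn_quantile hf).continuousAt_of_image_mem_nhds hnhds
      (by rw [quantile_image hf]; exact univ_mem)
  have h := HasDerivAt.of_local_left_inverse (f := fun x => cdfInt f x / ∫ t, f t)
    (g := quantile f) (a := u) hc ((hasDerivAt_cdfInt hf _).div_const _)
    (div_pos (hf.pos _) hM).ne' (by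
      filter_upwards [hnhds] with v hv
      rw [cdfInt_quantile hf hv]
      field_simp)
  rwa [inv_div] at h

theorem lintegral_quantile (φ : ℝ → ℝ≥0∞) :
    ENNReal.ofReal (∫ t, f t) * ∫⁻ u in Set.Ioo 0 1, φ (quantile f u)
      = ∫⁻ x, φ x * ENNReal.ofReal (f x) := by
  have hM := hf.integral_pos
  have h := lintegral_image_eq_lintegral_deriv_mul_of_monotoneOn (measurableSet_Ioo)
    (fun u hu => (hasDerivAt_quantile hf hu).hasDerivWithinAt)
    (strictMonoOn_quantile hf).monotoneOn (fun x => φ x * ENNReal.ofReal (f x))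
  rw [quantile_image hf, Measure.restrict_univ] at h
  rw [h, ← lintegral_const_mul' _ _ ENNReal.ofReal_ne_top]
  refine lintegral_congr fun u => ?_
  have hp := hf.pos (quantile f u)
  rw [ENNReal.ofReal_div_of_pos hp]
  have h1 : ENNReal.ofReal (f (quantile f u)) ≠ 0 := by simpa using hp
  rw [mul_comm (φ _), ← mul_assoc, ENNReal.div_mul_cancel h1 ENNReal.ofReal_ne_top]

include hg

/-- The Prékopa–Leindler inequality on the line, in transport form: the interpolation between two
quantile functions is strictly increasing, and its derivative is at least the geometric mean of the
derivatives. -/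
theorem lintegral_quantile_interpolate_le {t : ℝ} (ht : t ∈ Set.Ioo (0 : ℝ) 1) (h : ℝ → ℝ≥0∞) :
    ∫⁻ u in Set.Ioo 0 1, ENNReal.ofReal ((∫ x, f x) ^ (1 - t) * (∫ x, g x) ^ t /
        (f (quantile f u) ^ (1 - t) * g (quantile g u) ^ t)) *
        h ((1 - t) * quantile f u + t * quantile g u) ≤ ∫⁻ x, h x := by
  have hMf := hf.integral_pos
  have hMg := hg.integral_pos
  have ht1 : 0 < 1 - t := by linarith [ht.2]
  have hmono : StrictMonoOn (fun u => (1 - t) * quantile f u + t * quantile g u) (Set.Ioo 0 1) := by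
    intro u hu v hv huv
    have h1 := strictMonoOn_quantile hf hu hv huv
    have h2 := strictMonoOn_quantile hg hu hv huv
    exact add_lt_add (mul_lt_mul_of_pos_left h1 ht1) (mul_lt_mul_of_pos_left h2 ht.1)
  have hcv := lintegral_image_eq_lintegral_deriv_mul_of_monotoneOn (measurableSet_Ioo)
    (fun u hu => (((hasDerivAt_quantile hf hu).const_mul (1 - t)).add
      ((hasDerivAt_quantile hg hu).const_mul t)).hasDerivWithinAt) hmono.monotoneOn h
  calc _ ≤ ∫⁻ u in Set.Ioo 0 1, ENNReal.ofReal ((1 - t) * ((∫ x, f x) / f (quantile f u))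
        + t * ((∫ x, g x) / g (quantile g u))) *
        h ((1 - t) * quantile f u + t * quantile g u) := by
        refine lintegral_mono fun u => ?_
        gcongr
        have pf := hf.pos (quantile f u)
        have pg := hg.pos (quantile g u)
        have := Real.geom_mean_le_arith_mean2_weighted ht1.le ht.1.le
          (div_pos hMf pf).le (div_pos hMg pg).le (by ring)
        rw [Real.div_rpow hMf.le pf.le, Real.div_rpow hMg.le pg.le, div_mul_div_comm] at this
        exact this
    _ = ∫⁻ x in (fun u => (1 - t) * quantile f u + t * quantile g u) '' Set.Ioo 0 1, h x :=
        hcv.symm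
    _ ≤ ∫⁻ x, h x := setLIntegral_le_lintegral _ _

end

theorem measurable_quantile {Ω : Type} [MeasurableSpace Ω] {f : Ω → ℝ → ℝ}
    (hf : ∀ w, PosExpDecay (f w)) (hm : Measurable (Function.uncurry f)) :
    Measurable fun p : Ω × ℝ => quantile (f p.1) p.2 := by
  refine measurable_of_Iic fun x => ?_
  have hM : Measurable fun w => ∫ t, f w t :=
    (hm.stronglyMeasurable.integral_prod_right (ν := volume)).measurable
  have hF : Measurable fun w => cdfInt (f w) x :=
    (hm.stronglyMeasurable.integral_prod_right (ν := volume.restrict (Set.Iic x))).measurable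
  have : (fun p : Ω × ℝ => quantile (f p.1) p.2) ⁻¹' Set.Iic x =
      ({p | p.2 ∈ Set.Ioo (0 : ℝ) 1} ∩ {p | p.2 * ∫ t, f p.1 t ≤ cdfInt (f p.1) x}) ∪
      ({p | p.2 ∈ Set.Ioo (0 : ℝ) 1}ᶜ ∩ {_p | 0 ≤ x}) := by
    ext p
    by_cases hp : p.2 ∈ Set.Ioo (0 : ℝ) 1
    · simp only [Set.mem_preimage, Set.mem_Iic, quantile_le_iff (hf p.1) hp]
      simp only [Set.mem_union, Set.mem_inter_iff, Set.mem_ofPred_eq, hp, Set.mem_compl_iff]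
      simp
    · simp only [Set.mem_preimage, Set.mem_Iic, quantile_of_notMem (hf p.1) hp]
      simp only [Set.mem_union, Set.mem_inter_iff, Set.mem_ofPred_eq, hp, Set.mem_compl_iff]
      simp
  rw [this]
  have h1 : MeasurableSet {p : Ω × ℝ | p.2 ∈ Set.Ioo (0 : ℝ) 1} :=
    measurable_snd measurableSet_Ioo
  refine (h1.inter ?_).union (h1.compl.inter (MeasurableSet.const _))
  exact measurableSet_le (measurable_snd.mul (hM.comp measurable_fst)) (hF.comp measurable_fst)

/-! #### Marginals and slices -/

variable {n : ℕ}

/-- The marginal of `f` in the first coordinate. -/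
def margZero (f : (Fin (n + 1) → ℝ) → ℝ) (x : ℝ) : ℝ := ∫ y : Fin n → ℝ, f (Fin.cons x y)

theorem norm_le_norm_cons (x : ℝ) (y : Fin n → ℝ) :
    |x| ≤ ‖(Fin.cons x y : Fin (n + 1) → ℝ)‖ ∧ ‖y‖ ≤ ‖(Fin.cons x y : Fin (n + 1) → ℝ)‖ := by
  constructor
  · simpa using norm_le_pi_norm (Fin.cons x y : Fin (n + 1) → ℝ) 0
  · refine (pi_norm_le_iff_of_nonneg (norm_nonneg _)).mpr fun i => ?_
    simpa using norm_le_pi_norm (Fin.cons x y : Fin (n + 1) → ℝ) i.succ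

theorem continuous_cons : Continuous fun p : ℝ × (Fin n → ℝ) =>
    (Fin.cons p.1 p.2 : Fin (n + 1) → ℝ) := by
  refine continuous_pi fun i => ?_
  refine Fin.cases ?_ (fun j => ?_) i
  · simpa using continuous_fst
  · simp only [Fin.cons_succ]
    fun_prop

theorem PosExpDecay.cons_le {f : (Fin (n + 1) → ℝ) → ℝ} (hf : PosExpDecay f) :
    ∃ a C : ℝ, 0 < a ∧ 0 ≤ C ∧ ∀ x y, f (Fin.cons x y)
      ≤ C * Real.exp (-(a * |x|)) * Real.exp (-(a * ‖y‖)) := by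
  obtain ⟨a, C, ha, h⟩ := hf.exists_le
  have hC : 0 ≤ C := by
    have := (hf.pos 0).le.trans (h 0)
    simpa using this
  refine ⟨a / 2, C, by positivity, hC, fun x y => (h _).trans ?_⟩
  rw [mul_assoc, ← Real.exp_add]
  have := norm_le_norm_cons x y
  gcongr
  nlinarith

theorem PosExpDecay.slice {f : (Fin (n + 1) → ℝ) → ℝ} (hf : PosExpDecay f) (x : ℝ) :
    PosExpDecay fun y : Fin n → ℝ => f (Fin.cons x y) where
  continuous := hf.continuous.comp (continuous_cons.comp (Continuous.prodMk_right x))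
  pos y := hf.pos _
  exists_le := by
    obtain ⟨a, C, ha, hC, h⟩ := hf.cons_le
    exact ⟨a, _, ha, h x⟩

theorem PosExpDecay.margZero {f : (Fin (n + 1) → ℝ) → ℝ} (hf : PosExpDecay f) :
    PosExpDecay (margZero f) where
  continuous := by
    obtain ⟨a, C, ha, hC, h⟩ := hf.cons_le
    refine continuous_of_dominated (bound := fun y => C * Real.exp (-(a * ‖y‖)))
      (fun x => (hf.slice x).continuous.aestronglyMeasurable) (fun x => ae_of_all _ fun y => ?_)
      ((integrable_exp_neg_mul_norm volume ha).const_mul C) (ae_of_all _ fun y => ?_)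
    · rw [Real.norm_of_nonneg (hf.pos _).le]
      refine (h x y).trans ?_
      gcongr
      exact mul_le_of_le_one_right hC (Real.exp_le_one_iff.mpr (by
        have := abs_nonneg x
        nlinarith))
    · exact hf.continuous.comp (continuous_cons.comp (Continuous.prodMk_left y))
  pos x := (hf.slice x).integral_pos
  exists_le := by
    obtain ⟨a, C, ha, hC, h⟩ := hf.cons_le
    refine ⟨a, C * ∫ y : Fin n → ℝ, Real.exp (-(a * ‖y‖)), ha, fun x => ?_⟩
    calc CAVI.margZero f x ≤ ∫ y : Fin n → ℝ, C * Real.exp (-(a * |x|)) * Real.exp (-(a * ‖y‖)) :=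
          integral_mono (hf.slice x).integrable
            ((integrable_exp_neg_mul_norm volume ha).const_mul _) (h x)
      _ = _ := by
          rw [integral_const_mul, Real.norm_eq_abs]
          ring

theorem piFinSuccAbove_zero_symm (x : ℝ) (y : Fin n → ℝ) :
    (MeasurableEquiv.piFinSuccAbove (fun _ => ℝ) 0).symm (x, y)
      = (Fin.cons x y : Fin (n + 1) → ℝ) := by
  simp [MeasurableEquiv.piFinSuccAbove, Fin.insertNthEquiv]

theorem lintegral_cons (ν : Measure ℝ) [SigmaFinite ν] (φ : (Fin (n + 1) → ℝ) → ℝ≥0∞)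
    (hφ : Measurable φ) :
    ∫⁻ x, φ x ∂(Measure.pi fun _ : Fin (n + 1) => ν)
      = ∫⁻ x, ∫⁻ y, φ (Fin.cons x y) ∂(Measure.pi fun _ : Fin n => ν) ∂ν := by
  have h := (measurePreserving_piFinSuccAbove (fun _ : Fin (n + 1) => ν) 0).symm
  rw [← h.lintegral_comp hφ, lintegral_prod]
  · simp only [piFinSuccAbove_zero_symm]
  · exact (hφ.comp h.measurable).aemeasurable

theorem integral_margZero {f : (Fin (n + 1) → ℝ) → ℝ} (hf : PosExpDecay f) :
    ∫ x, margZero f x = ∫ z, f z := by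
  have h := (measurePreserving_piFinSuccAbove (fun _ : Fin (n + 1) => (volume : Measure ℝ)) 0).symm
  have h2 := h.integral_comp' (g := f)
  rw [volume_pi, ← h2]
  rw [integral_prod]
  · simp only [piFinSuccAbove_zero_symm]
    rfl
  · exact (h.integrable_comp_emb (MeasurableEquiv.measurableEmbedding _)).mpr hf.integrable

/-! #### The Knothe map -/

/-- The uniform distribution on the unit cube. -/
def cube (n : ℕ) : Measure (Fin n → ℝ) := Measure.pi fun _ => volume.restrict (Set.Ioo (0 : ℝ) 1)

instance : IsProbabilityMeasure ((volume : Measure ℝ).restrict (Set.Ioo (0 : ℝ) 1)) :=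
  ⟨by simp⟩

instance : IsProbabilityMeasure (cube n) := by
  unfold cube
  infer_instance

/-- The Knothe map: the first coordinate is the quantile function of the first marginal of `f`, and
the other ones are the Knothe map of the slice of `f` at the first coordinate. It maps the uniform
distribution on the cube to the probability measure with density proportional to `f`. -/
def knothe : (n : ℕ) → ((Fin n → ℝ) → ℝ) → (Fin n → ℝ) → (Fin n → ℝ)
  | 0, _, u => u
  | n + 1, f, u => Fin.cons (quantile (margZero f) (u 0))
      (knothe n (fun y => f (Fin.cons (quantile (margZero f) (u 0)) y)) (Fin.tail u))

theorem knothe_cons (f : (Fin (n + 1) → ℝ) → ℝ) (s : ℝ) (u : Fin n → ℝ) :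
    knothe (n + 1) f (Fin.cons s u) = Fin.cons (quantile (margZero f) s)
      (knothe n (fun y => f (Fin.cons (quantile (margZero f) s) y)) u) := by
  simp [knothe]

theorem measurable_knothe_param (n : ℕ) : ∀ {Ω : Type} [MeasurableSpace Ω]
    {f : Ω → (Fin n → ℝ) → ℝ}, (∀ w, PosExpDecay (f w)) → Measurable (Function.uncurry f) →
    Measurable fun p : Ω × (Fin n → ℝ) => knothe n (f p.1) p.2 := by
  induction n with
  | zero =>
    intro Ω _ f _ _
    exact measurable_snd
  | succ n ih =>
    intro Ω _ f hf hm
    have hcons : Measurable fun q : (Ω × ℝ) × (Fin n → ℝ) =>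
        f q.1.1 (Fin.cons q.1.2 q.2) :=
      hm.comp (measurable_fst.fst.prodMk
        (continuous_cons.measurable.comp (measurable_fst.snd.prodMk measurable_snd)))
    have hmarg : Measurable (Function.uncurry fun w => margZero (f w)) :=
      ((hcons.stronglyMeasurable).integral_prod_right' (ν := volume)).measurable
    have hq := measurable_quantile (fun w => (hf w).margZero) hmarg
    have hq' : Measurable fun p : Ω × (Fin (n + 1) → ℝ) =>
        quantile (margZero (f p.1)) (p.2 0) :=
      hq.comp (measurable_fst.prodMk ((measurable_pi_apply 0).comp measurable_snd))
    have htail : Measurable fun p : Ω × (Fin (n + 1) → ℝ) => Fin.tail p.2 :=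
      measurable_pi_iff.mpr fun i => (measurable_pi_apply i.succ).comp measurable_snd
    have hrec := ih (Ω := Ω × ℝ) (f := fun v y => f v.1 (Fin.cons v.2 y))
      (fun w => (hf w.1).slice w.2) hcons
    exact continuous_cons.measurable.comp
      (hq'.prodMk (hrec.comp ((measurable_fst.prodMk hq').prodMk htail)))

theorem measurable_knothe {f : (Fin n → ℝ) → ℝ} (hf : PosExpDecay f) : Measurable (knothe n f) := by
  have := measurable_knothe_param n (Ω := Unit) (f := fun _ => f) (fun _ => hf)
    (hf.continuous.measurable.comp measurable_snd)
  exact this.comp (measurable_const.prodMk measurable_id : Measurable fun u => ((), u))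

theorem lintegral_knothe (n : ℕ) : ∀ {f : (Fin n → ℝ) → ℝ}, PosExpDecay f →
    ∀ φ : (Fin n → ℝ) → ℝ≥0∞, Measurable φ →
    ENNReal.ofReal (∫ x, f x) * ∫⁻ u, φ (knothe n f u) ∂(cube n)
      = ∫⁻ x, φ x * ENNReal.ofReal (f x) := by
  induction n with
  | zero =>
    intro f hf φ hφ
    have e : ∀ y : Fin 0 → ℝ, y = 0 := fun y => Subsingleton.elim _ _
    simp only [e (knothe _ _ _), fun x => congrArg f (e x), fun x => congrArg φ (e x)]
    simp [cube, volume_pi, measureReal_def, mul_comm]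
  | succ n ih =>
    intro f hf φ hφ
    have hmk := measurable_knothe hf
    rw [cube, lintegral_cons _ _ (by fun_prop)]
    simp only [knothe_cons]
    rw [← integral_margZero hf]
    refine (lintegral_quantile hf.margZero fun x : ℝ =>
      ∫⁻ u, φ (Fin.cons x (knothe n (fun y => f (Fin.cons x y)) u)) ∂(cube n)).trans ?_
    rw [volume_pi, lintegral_cons _ _ (by
      have := hf.continuous.measurable
      fun_prop)]
    refine lintegral_congr fun x => ?_
    rw [mul_comm]
    exact ih (hf.slice x) (fun y => φ (Fin.cons x y))
      (hφ.comp (continuous_cons.measurable.comp measurable_prodMk_left))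

/-- The transport form of the Prékopa–Leindler inequality, for the interpolation between the Knothe
maps of `f` and `g`. -/
theorem lintegral_knothe_interpolate_le {t : ℝ} (ht : t ∈ Set.Ioo (0 : ℝ) 1) (n : ℕ) :
    ∀ {f g : (Fin n → ℝ) → ℝ}, PosExpDecay f → PosExpDecay g →
    ∀ h : (Fin n → ℝ) → ℝ≥0∞, Measurable h →
    ∫⁻ u, ENNReal.ofReal ((∫ x, f x) ^ (1 - t) * (∫ x, g x) ^ t /
        (f (knothe n f u) ^ (1 - t) * g (knothe n g u) ^ t)) *
        h ((1 - t) • knothe n f u + t • knothe n g u) ∂(cube n) ≤ ∫⁻ x, h x := by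
  induction n with
  | zero =>
    intro f g hf hg h hh
    have e : ∀ y : Fin 0 → ℝ, y = 0 := fun y => Subsingleton.elim _ _
    simp only [e]
    have pf := Real.rpow_pos_of_pos (hf.pos ![]) (1 - t)
    have pg := Real.rpow_pos_of_pos (hg.pos ![]) t
    simp [cube, volume_pi, measureReal_def, div_self (mul_pos pf pg).ne']
  | succ n ih =>
    intro f g hf hg h hh
    have hmf := measurable_knothe hf
    have hmg := measurable_knothe hg
    have hfm := hf.continuous.measurable
    have hgm := hg.continuous.measurable
    rw [cube, lintegral_cons _ _ (by fun_prop)]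
    simp only [knothe_cons]
    set H : ℝ → ℝ≥0∞ := fun x => ∫⁻ y : Fin n → ℝ, h (Fin.cons x y) with hH
    calc _ ≤ ∫⁻ s in Set.Ioo (0 : ℝ) 1, ENNReal.ofReal
          ((∫ x, margZero f x) ^ (1 - t) * (∫ x, margZero g x) ^ t /
          (margZero f (quantile (margZero f) s) ^ (1 - t) *
            margZero g (quantile (margZero g) s) ^ t)) *
          H ((1 - t) * quantile (margZero f) s + t * quantile (margZero g) s) := by
          refine lintegral_mono fun s => ?_
          set x := quantile (margZero f) s with hx
          set y := quantile (margZero g) s with hy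
          have hi := ih (hf.slice x) (hg.slice y)
            (fun z => h (Fin.cons ((1 - t) * x + t * y) z))
            (hh.comp (continuous_cons.measurable.comp measurable_prodMk_left))
          refine le_trans (le_of_eq ?_) (mul_le_mul_right hi _)
          rw [← lintegral_const_mul' _ _ ENNReal.ofReal_ne_top]
          refine lintegral_congr fun u => ?_
          rw [← mul_assoc, ← ENNReal.ofReal_mul]
          · congr 2
            · rw [integral_margZero hf, integral_margZero hg]
              have p1 := Real.rpow_pos_of_pos (hf.margZero.pos x) (1 - t)
              have p2 := Real.rpow_pos_of_pos (hg.margZero.pos y) t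
              change _ = _ * (margZero f x ^ (1 - t) * margZero g y ^ t / _)
              field_simp
            · funext i
              refine Fin.cases ?_ (fun j => ?_) i <;> simp
          · have p1 := hf.margZero.integral_pos
            have p2 := hg.margZero.integral_pos
            have p3 := hf.margZero.pos x
            have p4 := hg.margZero.pos y
            positivity
      _ ≤ ∫⁻ x, H x := lintegral_quantile_interpolate_le hf.margZero hg.margZero ht H
      _ = ∫⁻ z, h z := by
          rw [volume_pi, lintegral_cons _ _ hh]
          rfl

/-! #### The coupling of two densities on a Euclidean space -/

/-- The Knothe map of a function on Euclidean space. -/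
def knotheE (f : EuclideanSpace ℝ (Fin n) → ℝ) (u : Fin n → ℝ) : EuclideanSpace ℝ (Fin n) :=
  WithLp.toLp 2 (knothe n (fun x => f (WithLp.toLp 2 x)) u)

theorem PosExpDecay.comp_toLp {f : EuclideanSpace ℝ (Fin n) → ℝ} (hf : PosExpDecay f) :
    PosExpDecay fun x : Fin n → ℝ => f (WithLp.toLp 2 x) where
  continuous := hf.continuous.comp (PiLp.continuous_toLp 2 _)
  pos x := hf.pos _
  exists_le := by
    obtain ⟨a, C, ha, h⟩ := hf.exists_le
    have hC : 0 ≤ C := by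
      have := (hf.pos 0).le.trans (h 0)
      simpa using this
    refine ⟨a, C, ha, fun x => (h _).trans ?_⟩
    have : ‖x‖ ≤ ‖(WithLp.toLp 2 x : EuclideanSpace ℝ (Fin n))‖ :=
      (pi_norm_le_iff_of_nonneg (norm_nonneg _)).mpr fun i =>
        PiLp.norm_apply_le (WithLp.toLp 2 x : EuclideanSpace ℝ (Fin n)) i
    gcongr

variable {f g : EuclideanSpace ℝ (Fin n) → ℝ}

theorem lintegral_comp_toLp (φ : EuclideanSpace ℝ (Fin n) → ℝ≥0∞) :
    ∫⁻ x : Fin n → ℝ, φ (WithLp.toLp 2 x) = ∫⁻ x, φ x :=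
  (PiLp.volume_preserving_toLp (Fin n)).lintegral_comp_emb
    (MeasurableEquiv.toLp 2 (Fin n → ℝ)).measurableEmbedding φ

theorem integral_comp_toLp (φ : EuclideanSpace ℝ (Fin n) → ℝ) :
    ∫ x : Fin n → ℝ, φ (WithLp.toLp 2 x) = ∫ x, φ x :=
  (PiLp.volume_preserving_toLp (Fin n)).integral_comp
    (MeasurableEquiv.toLp 2 (Fin n → ℝ)).measurableEmbedding φ

theorem measurable_knotheE (hf : PosExpDecay f) : Measurable (knotheE f) :=
  (PiLp.continuous_toLp 2 _).measurable.comp (measurable_knothe hf.comp_toLp)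

theorem map_knotheE (hf : PosExpDecay f) (hf1 : ∫ x, f x = 1) :
    (cube n).map (knotheE f) = volume.withDensity fun x => ENNReal.ofReal (f x) := by
  ext s hs
  have hind : Measurable (s.indicator (1 : EuclideanSpace ℝ (Fin n) → ℝ≥0∞)) :=
    measurable_one.indicator hs
  have h := lintegral_knothe n hf.comp_toLp (fun x => s.indicator 1 (WithLp.toLp 2 x))
    (hind.comp (PiLp.continuous_toLp 2 _).measurable)
  rw [integral_comp_toLp f, hf1, ENNReal.ofReal_one, one_mul,
    lintegral_comp_toLp fun x => s.indicator 1 x * ENNReal.ofReal (f x)] at h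
  rw [← lintegral_indicator_one hs, lintegral_map hind (measurable_knotheE hf),
    withDensity_apply _ hs, ← lintegral_indicator hs]
  refine h.trans (lintegral_congr fun x => ?_)
  by_cases hx : x ∈ s <;> simp [hx]

theorem lintegral_knotheE_interpolate_le (hf : PosExpDecay f) (hf1 : ∫ x, f x = 1)
    (hg : PosExpDecay g)
    (hg1 : ∫ x, g x = 1) {t : ℝ} (ht : t ∈ Set.Ioo (0 : ℝ) 1)
    (h : EuclideanSpace ℝ (Fin n) → ℝ≥0∞) (hh : Measurable h) :
    ∫⁻ u, ENNReal.ofReal (1 / (f (knotheE f u) ^ (1 - t) * g (knotheE g u) ^ t)) *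
        h ((1 - t) • knotheE f u + t • knotheE g u) ∂(cube n) ≤ ∫⁻ x, h x := by
  have key := lintegral_knothe_interpolate_le ht n hf.comp_toLp hg.comp_toLp
    (fun x => h (WithLp.toLp 2 x)) (hh.comp (PiLp.continuous_toLp 2 _).measurable)
  rw [integral_comp_toLp f, integral_comp_toLp g, hf1, hg1, Real.one_rpow, Real.one_rpow, one_mul,
    lintegral_comp_toLp h] at key
  exact key

/-- Displacement convexity of the entropy along the Knothe coupling, tested against `log f`. It
follows from the Prékopa–Leindler inequality for the test function `f` and `log r ≤ r - 1`. -/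
theorem integral_log_knotheE_interpolate_le (hf : PosExpDecay f) (hf1 : ∫ x, f x = 1)
    (hg : PosExpDecay g)
    (hg1 : ∫ x, g x = 1) {t : ℝ} (ht : t ∈ Set.Ioo (0 : ℝ) 1)
    (hint : Integrable (fun u => Real.log (f ((1 - t) • knotheE f u + t • knotheE g u))) (cube n))
    (hfint : Integrable (fun u => Real.log (f (knotheE f u))) (cube n))
    (hgint : Integrable (fun u => Real.log (g (knotheE g u))) (cube n)) :
    ∫ u, Real.log (f ((1 - t) • knotheE f u + t • knotheE g u)) ∂(cube n) ≤
      (1 - t) * ∫ u, Real.log (f (knotheE f u)) ∂(cube n) +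
        t * ∫ u, Real.log (g (knotheE g u)) ∂(cube n) := by
  have hmf := measurable_knotheE hf
  have hmg := measurable_knotheE hg
  have hfm := hf.continuous.measurable
  have hgm := hg.continuous.measurable
  set r : (Fin n → ℝ) → ℝ := fun u => 1 / (f (knotheE f u) ^ (1 - t) * g (knotheE g u) ^ t) *
    f ((1 - t) • knotheE f u + t • knotheE g u) with hr
  have hrpos : ∀ u, 0 < r u := by
    intro u
    have p1 := hf.pos (knotheE f u)
    have p2 := hg.pos (knotheE g u)
    have p3 := hf.pos ((1 - t) • knotheE f u + t • knotheE g u)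
    positivity
  have hrm : Measurable r := by fun_prop
  have hle : ∫⁻ u, ENNReal.ofReal (r u) ∂(cube n) ≤ 1 := by
    have h := lintegral_knotheE_interpolate_le hf hf1 hg hg1 ht
      (fun x => ENNReal.ofReal (f x)) (by fun_prop)
    rw [← ofReal_integral_eq_lintegral_ofReal hf.integrable (ae_of_all _ fun x => (hf.pos x).le),
      hf1, ENNReal.ofReal_one] at h
    refine le_trans (le_of_eq (lintegral_congr fun u => ?_)) h
    rw [← ENNReal.ofReal_mul]
    have p1 := hf.pos (knotheE f u)
    have p2 := hg.pos (knotheE g u)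
    positivity
  have hrint : Integrable r (cube n) :=
    ⟨hrm.aestronglyMeasurable, by
      rw [hasFiniteIntegral_iff_ofReal (ae_of_all _ fun u => (hrpos u).le)]
      exact hle.trans_lt ENNReal.one_lt_top⟩
  have hr1 : ∫ u, r u ∂(cube n) ≤ 1 := by
    rw [integral_eq_lintegral_of_nonneg_ae (ae_of_all _ fun u => (hrpos u).le)
      hrm.aestronglyMeasurable]
    exact ENNReal.toReal_le_of_le_ofReal zero_le_one (by simpa using hle)
  have hlog : ∀ u, Real.log (r u) = Real.log (f ((1 - t) • knotheE f u + t • knotheE g u)) -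
      ((1 - t) * Real.log (f (knotheE f u)) + t * Real.log (g (knotheE g u))) := by
    intro u
    have p1 := hf.pos (knotheE f u)
    have p2 := hg.pos (knotheE g u)
    have p3 := hf.pos ((1 - t) • knotheE f u + t • knotheE g u)
    rw [hr]
    simp only
    rw [one_div_mul_eq_div, Real.log_div p3.ne' (by positivity), Real.log_mul (by positivity)
      (by positivity), Real.log_rpow p1, Real.log_rpow p2]
  have hI : ∫ u, Real.log (r u) ∂(cube n) ≤ ∫ u, (r u - 1) ∂(cube n) := by
    refine integral_mono ?_ (hrint.sub (integrable_const _))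
      fun u => Real.log_le_sub_one_of_pos (hrpos u)
    simp_rw [hlog]
    exact hint.sub ((hfint.const_mul _).add (hgint.const_mul _))
  rw [integral_sub hrint (integrable_const _)] at hI
  simp_rw [hlog] at hI
  have hfg : Integrable (fun u => (1 - t) * Real.log (f (knotheE f u)) +
      t * Real.log (g (knotheE g u))) (cube n) := (hfint.const_mul _).add (hgint.const_mul _)
  rw [integral_sub hint hfg, integral_add (hfint.const_mul _) (hgint.const_mul _),
    integral_const_mul, integral_const_mul] at hI
  simp only [integral_const, probReal_univ, smul_eq_mul, mul_one] at hI
  linarith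

end Knothe

/-! ### Product measures -/

section ProductMeasures

variable {ι : Type*} [Fintype ι] [DecidableEq ι] {α : ι → Type*} [∀ i, MeasurableSpace (α i)]

/-- Resampling one coordinate of a product measure. -/
theorem measurePreserving_update_pi (m : (i : ι) → Measure (α i)) [∀ i, IsProbabilityMeasure (m i)]
    (i : ι) (ν : Measure (α i)) [IsProbabilityMeasure ν] :
    MeasurePreserving (fun q : α i × ((j : ι) → α j) => Function.update q.2 i q.1)
      (ν.prod (Measure.pi m)) (Measure.pi (Function.update m i ν)) := by
  have hmeas : Measurable (fun q : α i × ((j : ι) → α j) => Function.update q.2 i q.1) := by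
    refine measurable_pi_iff.mpr fun j => ?_
    by_cases h : j = i
    · subst h
      simpa using measurable_fst
    · simp only [Function.update_of_ne h]
      fun_prop
  have hprob : ∀ j, IsProbabilityMeasure (Function.update m i ν j) := by
    intro j
    by_cases h : j = i
    · subst h
      simpa
    · simp only [Function.update_of_ne h]
      infer_instance
  refine ⟨hmeas, (Measure.pi_eq fun s hs => ?_).symm⟩
  rw [Measure.map_apply hmeas (MeasurableSet.univ_pi hs)]
  have hset : (fun q : α i × ((j : ι) → α j) => Function.update q.2 i q.1) ⁻¹' (Set.univ.pi s)
      = s i ×ˢ (Set.univ.pi (Function.update s i Set.univ)) := by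
    ext q
    simp only [Set.mem_preimage, Set.mem_univ_pi, Set.mem_prod]
    constructor
    · intro h
      refine ⟨by simpa using h i, fun j => ?_⟩
      by_cases hj : j = i
      · subst hj
        simp
      · simpa [hj] using h j
    · rintro ⟨h1, h2⟩ j
      by_cases hj : j = i
      · subst hj
        simpa using h1
      · simpa [hj] using h2 j
  rw [hset, Measure.prod_prod, Measure.pi_pi,
    ← Finset.mul_prod_erase _ _ (Finset.mem_univ i),
    ← Finset.mul_prod_erase _ _ (Finset.mem_univ i)]
  simp only [Function.update_self, measure_univ, one_mul]
  congr 1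
  refine Finset.prod_congr rfl fun j hj => ?_
  have hj' : j ≠ i := Finset.ne_of_mem_erase hj
  simp [hj']

theorem integral_pi_update {E : Type*} [NormedAddCommGroup E] [NormedSpace ℝ E]
    (m : (i : ι) → Measure (α i)) [∀ i, IsProbabilityMeasure (m i)]
    (i : ι) (ν : Measure (α i)) [IsProbabilityMeasure ν] {h : ((j : ι) → α j) → E}
    (hh : Integrable h (Measure.pi (Function.update m i ν))) :
    ∫ y, h y ∂(Measure.pi (Function.update m i ν))
      = ∫ x, ∫ y, h (Function.update y i x) ∂(Measure.pi m) ∂ν := by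
  have hmp := measurePreserving_update_pi m i ν
  rw [← hmp.map_eq] at hh ⊢
  rw [integral_map hmp.measurable.aemeasurable hh.aestronglyMeasurable]
  exact integral_prod _ ((integrable_map_measure hh.aestronglyMeasurable
    hmp.measurable.aemeasurable).mp hh)

theorem pi_withDensity_ofReal (μ : (i : ι) → Measure (α i)) [∀ i, SigmaFinite (μ i)]
    {f : (i : ι) → α i → ℝ} (hf : ∀ i x, 0 ≤ f i x) (hi : ∀ i, Integrable (f i) (μ i)) :
    Measure.pi (fun i => (μ i).withDensity fun x => ENNReal.ofReal (f i x))
      = (Measure.pi μ).withDensity fun x => ENNReal.ofReal (∏ i, f i (x i)) := by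
  have hfin : ∀ i, IsFiniteMeasure ((μ i).withDensity fun x => ENNReal.ofReal (f i x)) :=
    fun i => isFiniteMeasure_withDensity_ofReal (hi i).2
  refine Measure.pi_eq fun s hs => ?_
  rw [withDensity_apply _ (MeasurableSet.univ_pi hs), Measure.restrict_pi_pi,
    ← ofReal_integral_eq_lintegral_ofReal
      (Integrable.fintype_prod_dep fun i => (hi i).integrableOn)
      (ae_of_all _ fun x => Finset.prod_nonneg fun i _ => hf i _),
    integral_fintype_prod_eq_prod f,
    ENNReal.ofReal_prod_of_nonneg fun i _ => integral_nonneg (hf i)]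
  refine Finset.prod_congr rfl fun i _ => ?_
  rw [withDensity_apply _ (hs i), ofReal_integral_eq_lintegral_ofReal (hi i).integrableOn
    (ae_of_all _ fun x => hf i x)]

theorem ae_forall_pi (μ : (i : ι) → Measure (α i)) [∀ i, SigmaFinite (μ i)]
    {P : (i : ι) → α i → Prop} (h : ∀ i, ∀ᵐ x ∂(μ i), P i x) :
    ∀ᵐ y ∂(Measure.pi μ), ∀ i, P i (y i) :=
  ae_all_iff.mpr fun i => (Measure.quasiMeasurePreserving_eval μ i).ae (h i)

end ProductMeasures

/-! ### Product densities -/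

section ProductDensities

variable {d : ℕ} {k : Fin d → ℕ}

/-- The measures on the blocks with Lebesgue densities `f i`. -/
def ofDens (f : (i : Fin d) → Block k i → ℝ) (i : Fin d) : Measure (Block k i) :=
  volume.withDensity fun x => ENNReal.ofReal (f i x)

theorem ofDens_update (f : (i : Fin d) → Block k i → ℝ) (i : Fin d) (g : Block k i → ℝ) :
    ofDens (Function.update f i g)
      = Function.update (ofDens f) i (volume.withDensity fun x => ENNReal.ofReal (g x)) := by
  funext j
  by_cases h : j = i
  · subst h
    simp [ofDens]
  · simp [ofDens, h]

variable {a C : ℝ} {f g : (i : Fin d) → Block k i → ℝ}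

theorem ofDens_congr (h : ∀ i, f i =ᵐ[volume] g i) : ofDens f = ofDens g := by
  funext i
  refine withDensity_congr_ae ?_
  filter_upwards [h i] with x hx
  rw [hx]

theorem isProbabilityMeasure_withDensity {E : Type*} [NormedAddCommGroup E] [NormedSpace ℝ E]
    [FiniteDimensional ℝ E] [MeasureSpace E] [BorelSpace E]
    [(volume : Measure E).IsAddHaarMeasure] {u : E → ℝ} (hu : ExpDensity a C u) (ha : 0 < a) :
    IsProbabilityMeasure (volume.withDensity fun x => ENNReal.ofReal (u x)) := by
  refine ⟨?_⟩
  rw [withDensity_apply _ MeasurableSet.univ, Measure.restrict_univ]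
  rw [← ofReal_integral_eq_lintegral_ofReal (hu.integrable ha) (ae_of_all _ hu.nonneg),
    hu.integral_eq, ENNReal.ofReal_one]

end ProductDensities

section MeanField

theorem withDensity_integral {X : Type*} [MeasurableSpace X] {μ : Measure X} {u : X → ℝ}
    (hu : Measurable u) (h0 : ∀ x, 0 ≤ u x) (h : X → ℝ) :
    ∫ x, h x ∂(μ.withDensity fun x => ENNReal.ofReal (u x)) = ∫ x, h x * u x ∂μ := by
  rw [integral_withDensity_eq_integral_toReal_smul (by fun_prop)
    (ae_of_all _ fun _ => ENNReal.ofReal_lt_top)]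
  refine integral_congr_ae (ae_of_all _ fun x => ?_)
  simp only [smul_eq_mul, ENNReal.toReal_ofReal (h0 x), mul_comm]

theorem withDensity_integrable_iff {X : Type*} [MeasurableSpace X] {μ : Measure X} {u : X → ℝ}
    (hu : Measurable u) (h0 : ∀ x, 0 ≤ u x) (h : X → ℝ) :
    Integrable h (μ.withDensity fun x => ENNReal.ofReal (u x)) ↔
      Integrable (fun x => h x * u x) μ := by
  rw [integrable_withDensity_iff_integrable_smul' (by fun_prop)
    (ae_of_all _ fun _ => ENNReal.ofReal_lt_top)]
  simp only [smul_eq_mul, ENNReal.toReal_ofReal (h0 _), mul_comm]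

variable {d : ℕ} {k : Fin d → ℕ} {a C : ℝ} {f g : (i : Fin d) → Block k i → ℝ}

/-- The product density `∏ i, f i (x i)`. -/
def prodDens (f : (i : Fin d) → Block k i → ℝ) (y : Pt k) : ℝ := ∏ i, f i (y i)

theorem measurable_prodDens (hf : ∀ i, Measurable (f i)) : Measurable (prodDens f) := by
  unfold prodDens
  fun_prop

theorem prodDens_nonneg (hf : ∀ i x, 0 ≤ f i x) (y : Pt k) : 0 ≤ prodDens f y :=
  Finset.prod_nonneg fun i _ => hf i _

theorem pi_ofDens (hf : ∀ i, ExpDensity a C (f i)) (ha : 0 < a) :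
    Measure.pi (ofDens f) = volume.withDensity fun y => ENNReal.ofReal (prodDens f y) :=
  pi_withDensity_ofReal (fun _ => volume) (fun i => (hf i).nonneg) fun i => (hf i).integrable ha

theorem isProbabilityMeasure_ofDens (hf : ∀ i, ExpDensity a C (f i)) (ha : 0 < a) (i : Fin d) :
    IsProbabilityMeasure (ofDens f i) :=
  isProbabilityMeasure_withDensity (hf i) ha

theorem integral_ofDens (hf : ∀ i, ExpDensity a C (f i)) (i : Fin d) (h : Block k i → ℝ) :
    ∫ x, h x ∂(ofDens f i) = ∫ x, h x * f i x :=
  withDensity_integral (hf i).measurable (hf i).nonneg h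

theorem integral_pi_ofDens (hf : ∀ i, ExpDensity a C (f i)) (ha : 0 < a) (h : Pt k → ℝ) :
    ∫ y, h y ∂(Measure.pi (ofDens f)) = ∫ y, h y * prodDens f y := by
  rw [pi_ofDens hf ha, withDensity_integral (measurable_prodDens fun i => (hf i).measurable)
    (prodDens_nonneg fun i => (hf i).nonneg)]

theorem one_add_norm_le_prod (y : Pt k) : 1 + ‖y‖ ≤ ∏ i, (1 + ‖y i‖) := by
  have h1 : ∀ s : Finset (Fin d), 1 ≤ ∏ i ∈ s, (1 + ‖y i‖) := fun s =>
    Finset.prod_induction _ (fun r : ℝ => 1 ≤ r)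
      (fun _ _ h h' => one_le_mul_of_one_le_of_one_le h h')
      le_rfl fun i _ => by linarith [norm_nonneg (y i)]
  have h2 : ‖y‖ ≤ ∏ i, (1 + ‖y i‖) - 1 := by
    refine (pi_norm_le_iff_of_nonneg (by linarith [h1 Finset.univ])).mpr fun j => ?_
    rw [← Finset.mul_prod_erase _ _ (Finset.mem_univ j)]
    have := h1 (Finset.univ.erase j)
    have := norm_nonneg (y j)
    nlinarith
  linarith

theorem one_add_norm_rpow_le_prod {p : ℝ} (hp : 0 ≤ p) (y : Pt k) :
    (1 + ‖y‖) ^ p ≤ ∏ i, (1 + ‖y i‖) ^ p := by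
  rw [Real.finsetProd_rpow Finset.univ (fun i => 1 + ‖y i‖) (fun i _ => by positivity)]
  gcongr
  exact one_add_norm_le_prod y

/-- A family of probability measures with finite `p`-th moments. The weight `(1 + ‖x‖) ^ p` is used
because it is submultiplicative over the blocks. -/
structure HasMoment (p : ℝ) (m : (i : Fin d) → Measure (Block k i)) : Prop where
  isProb : ∀ i, IsProbabilityMeasure (m i)
  integrable : ∀ i, Integrable (fun x => (1 + ‖x‖) ^ p) (m i)

theorem HasMoment.update {p : ℝ} {m : (i : Fin d) → Measure (Block k i)} (hm : HasMoment p m)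
    (i : Fin d) {ν : Measure (Block k i)} (hν : IsProbabilityMeasure ν)
    (hi : Integrable (fun x => (1 + ‖x‖) ^ p) ν) : HasMoment p (Function.update m i ν) := by
  constructor
  · intro j
    by_cases h : j = i
    · subst h
      simpa
    · simpa [h] using hm.isProb j
  · intro j
    by_cases h : j = i
    · subst h
      simpa
    · simpa [h] using hm.integrable j

theorem ExpDensity.integrable_weight_withDensity {E : Type*} [NormedAddCommGroup E]
    [NormedSpace ℝ E] [FiniteDimensional ℝ E] [MeasureSpace E] [BorelSpace E]
    [(volume : Measure E).IsAddHaarMeasure] {u : E → ℝ} (hu : ExpDensity a C u) (ha : 0 < a)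
    {p : ℝ} (hp : 0 ≤ p) :
    Integrable (fun x => (1 + ‖x‖) ^ p) (volume.withDensity fun x => ENNReal.ofReal (u x)) := by
  rw [withDensity_integrable_iff hu.measurable hu.nonneg]
  exact hu.integrable_weight_mul ha hp

theorem hasMoment_ofDens (hf : ∀ i, ExpDensity a C (f i)) (ha : 0 < a) {p : ℝ} (hp : 0 ≤ p) :
    HasMoment p (ofDens f) :=
  ⟨isProbabilityMeasure_ofDens hf ha, fun i => (hf i).integrable_weight_withDensity ha hp⟩

theorem HasMoment.integrable_pi {p : ℝ} {m : (i : Fin d) → Measure (Block k i)}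
    (hm : HasMoment p m) (hp : 0 ≤ p) : Integrable (fun y => (1 + ‖y‖) ^ p) (Measure.pi m) := by
  have := hm.isProb
  refine (Integrable.fintype_prod_dep hm.integrable).mono' ?_ (ae_of_all _ fun y => ?_)
  · exact Measurable.aestronglyMeasurable (by fun_prop)
  · rw [Real.norm_of_nonneg (by positivity)]
    exact one_add_norm_rpow_le_prod hp y

theorem HasMoment.integrable_of_le {p : ℝ} {m : (i : Fin d) → Measure (Block k i)}
    (hm : HasMoment p m) (hp : 0 ≤ p) {h : Pt k → ℝ} (hh : Measurable h) {K : ℝ}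
    (hb : ∀ y, |h y| ≤ K * (1 + ‖y‖) ^ p) : Integrable h (Measure.pi m) :=
  ((hm.integrable_pi hp).const_mul K).mono' hh.aestronglyMeasurable (ae_of_all _ hb)

/-- Integrals of functions of polynomial growth are continuous along dominated pointwise
convergence of the densities. -/
theorem tendsto_integral_pi_ofDens {u : ℕ → (i : Fin d) → Block k i → ℝ}
    (hu : ∀ n i, ExpDensity a C (u n i)) (hf : ∀ i, ExpDensity a C (f i)) (ha : 0 < a)
    (hlim : ∀ i, ∀ᵐ x, Tendsto (fun n => u n i x) atTop (𝓝 (f i x))) {p K : ℝ} (hp : 0 ≤ p)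
    {h : Pt k → ℝ} (hh : Measurable h) (hb : ∀ y, |h y| ≤ K * (1 + ‖y‖) ^ p) :
    Tendsto (fun n => ∫ y, h y ∂(Measure.pi (ofDens (u n)))) atTop
      (𝓝 (∫ y, h y ∂(Measure.pi (ofDens f)))) := by
  simp_rw [fun n => integral_pi_ofDens (hu n) ha h]
  rw [integral_pi_ofDens hf ha h]
  refine tendsto_integral_of_dominated_convergence
    (fun y => K * ∏ i, (C * ((1 + ‖y i‖) ^ p * Real.exp (-(a * ‖y i‖)))))
    (fun n => (hh.mul (measurable_prodDens fun i => (hu n i).measurable)).aestronglyMeasurable)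
    ?_ (fun n => ae_of_all _ fun y => ?_) ?_
  · exact (Integrable.fintype_prod_dep
      (f := fun i (x : Block k i) => C * ((1 + ‖x‖) ^ p * Real.exp (-(a * ‖x‖))))
      fun i => (integrable_one_add_norm_rpow_mul_exp volume hp ha).const_mul C).const_mul K
  · have hK : 0 ≤ K * (1 + ‖y‖) ^ p := (abs_nonneg _).trans (hb y)
    have hK0 : 0 ≤ K := nonneg_of_mul_nonneg_left hK (by positivity)
    rw [norm_mul, Real.norm_of_nonneg (prodDens_nonneg (fun i => (hu n i).nonneg) y)]
    calc |h y| * prodDens (u n) y ≤ K * (∏ i, (1 + ‖y i‖) ^ p) *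
          ∏ i, (C * Real.exp (-(a * ‖y i‖))) := by
          refine mul_le_mul ((hb y).trans ?_) ?_ (prodDens_nonneg (fun i => (hu n i).nonneg) y)
            (by positivity)
          · gcongr
            exact one_add_norm_rpow_le_prod hp y
          · exact Finset.prod_le_prod (fun i _ => (hu n i).nonneg _) fun i _ => (hu n i).le _
      _ = _ := by
          rw [mul_assoc, ← Finset.prod_mul_distrib]
          congr 1
          exact Finset.prod_congr rfl fun i _ => by ring
  · filter_upwards [ae_forall_pi (fun i => (volume : Measure (Block k i))) hlim] with y hy
    exact (tendsto_finsetProd _ fun i _ => hy i).const_mul _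

/-! ### Potentials and block updates -/

/-- The quantitative consequences of the assumptions on the potential `ψ`. Here `‖x‖` is the maximum
of the Euclidean norms of the blocks, which is equivalent to the Euclidean norm of `x`. -/
structure Admissible (ψ : Pt k → ℝ) (a b c p : ℝ) : Prop where
  convex : ConvexOn ℝ Set.univ ψ
  a_pos : 0 < a
  low : ∀ x, a * ‖x‖ - b ≤ ψ x
  c_nonneg : 0 ≤ c
  p_nonneg : 0 ≤ p
  up : ∀ x, |ψ x| ≤ c * (1 + ‖x‖) ^ p

variable {ψ : Pt k → ℝ} {b c p : ℝ}

theorem Admissible.continuous (H : Admissible ψ a b c p) : Continuous ψ :=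
  H.convex.locallyLipschitz.continuous

theorem continuous_update_left (i : Fin d) (x : Block k i) :
    Continuous fun y : Pt k => Function.update y i x := by fun_prop

theorem norm_update_le (y : Pt k) (i : Fin d) (x : Block k i) :
    ‖Function.update y i x‖ ≤ ‖x‖ + ‖y‖ := by
  refine (pi_norm_le_iff_of_nonneg (by positivity)).mpr fun j => ?_
  by_cases h : j = i
  · subst h
    simp
  · rw [Function.update_of_ne h]
    exact (norm_le_pi_norm y j).trans (by linarith [norm_nonneg x])

theorem norm_le_norm_update (y : Pt k) (i : Fin d) (x : Block k i) :
    ‖x‖ ≤ ‖Function.update y i x‖ := by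
  simpa using norm_le_pi_norm (Function.update y i x) i

theorem one_add_norm_update_rpow_le {p : ℝ} (hp : 0 ≤ p) (y : Pt k) (i : Fin d) (x : Block k i) :
    (1 + ‖Function.update y i x‖) ^ p ≤ (1 + ‖x‖) ^ p * (1 + ‖y‖) ^ p := by
  rw [← Real.mul_rpow (by positivity) (by positivity)]
  gcongr
  have := norm_update_le y i x
  have := mul_nonneg (norm_nonneg x) (norm_nonneg y)
  linarith

theorem Admissible.abs_update_le (H : Admissible ψ a b c p) (y : Pt k) (i : Fin d)
    (x : Block k i) :
    |ψ (Function.update y i x)| ≤ c * (1 + ‖x‖) ^ p * (1 + ‖y‖) ^ p := by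
  refine (H.up _).trans ?_
  rw [mul_assoc]
  exact mul_le_mul_of_nonneg_left (one_add_norm_update_rpow_le H.p_nonneg y i x) H.c_nonneg

variable {m : (i : Fin d) → Measure (Block k i)}

theorem Admissible.integrable (H : Admissible ψ a b c p) (hm : HasMoment p m) :
    Integrable ψ (Measure.pi m) :=
  hm.integrable_of_le H.p_nonneg H.continuous.measurable H.up

theorem Admissible.integrable_update (H : Admissible ψ a b c p) (hm : HasMoment p m) (i : Fin d)
    (x : Block k i) : Integrable (fun y => ψ (Function.update y i x)) (Measure.pi m) :=
  hm.integrable_of_le H.p_nonneg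
    (H.continuous.comp (continuous_update_left i x)).measurable fun y => H.abs_update_le y i x

theorem Admissible.abs_blockPotential_le (H : Admissible ψ a b c p) (hm : HasMoment p m)
    (i : Fin d) (x : Block k i) :
    |blockPotential ψ m i x| ≤ c * (∫ y, (1 + ‖y‖) ^ p ∂(Measure.pi m)) * (1 + ‖x‖) ^ p := by
  rw [blockPotential, ← Real.norm_eq_abs]
  calc _ ≤ ∫ y, c * (1 + ‖x‖) ^ p * (1 + ‖y‖) ^ p ∂(Measure.pi m) :=
        norm_integral_le_of_norm_le ((hm.integrable_pi H.p_nonneg).const_mul _)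
          (ae_of_all _ fun y => H.abs_update_le y i x)
    _ = _ := by
        rw [integral_const_mul]
        ring

theorem Admissible.le_blockPotential (H : Admissible ψ a b c p) (hm : HasMoment p m) (i : Fin d)
    (x : Block k i) : a * ‖x‖ - b ≤ blockPotential ψ m i x := by
  have := hm.isProb
  calc a * ‖x‖ - b = ∫ _y : Pt k, (a * ‖x‖ - b) ∂(Measure.pi m) := by simp
    _ ≤ _ := integral_mono (integrable_const _) (H.integrable_update hm i x) fun y => by
        refine le_trans ?_ (H.low _)
        have := norm_le_norm_update y i x
        have := H.a_pos
        gcongr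

theorem Admissible.abs_blockPotential_sub_le (H : Admissible ψ a b c p) (hm : HasMoment p m)
    (i : Fin d) (x x' : Block k i) :
    |blockPotential ψ m i x - blockPotential ψ m i x'| ≤
      2 * c * (∫ y, (1 + ‖y‖) ^ p ∂(Measure.pi m)) * (2 + ‖x‖ + ‖x'‖) ^ p * ‖x - x'‖ := by
  have key : ∀ y : Pt k, |ψ (Function.update y i x) - ψ (Function.update y i x')| ≤
      2 * c * (2 + ‖x‖ + ‖x'‖) ^ p * ‖x - x'‖ * (1 + ‖y‖) ^ p := by
    intro y
    refine (H.convex.abs_sub_le_of_growth H.c_nonneg H.p_nonneg H.up _ _).trans ?_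
    have e : ‖Function.update y i x - Function.update y i x'‖ ≤ ‖x - x'‖ := by
      refine (pi_norm_le_iff_of_nonneg (norm_nonneg _)).mpr fun j => ?_
      by_cases h : j = i
      · subst h
        simp
      · simp [h]
    have e2 : (2 + ‖Function.update y i x‖ + ‖Function.update y i x'‖) ^ p ≤
        (2 + ‖x‖ + ‖x'‖) ^ p * (1 + ‖y‖) ^ p := by
      have := H.p_nonneg
      rw [← Real.mul_rpow (by positivity) (by positivity)]
      gcongr
      have := norm_update_le y i x
      have := norm_update_le y i x'
      nlinarith [norm_nonneg y, norm_nonneg x, norm_nonneg x',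
        mul_nonneg (norm_nonneg x) (norm_nonneg y), mul_nonneg (norm_nonneg x') (norm_nonneg y)]
    have hc := H.c_nonneg
    calc _ ≤ 2 * c * ((2 + ‖x‖ + ‖x'‖) ^ p * (1 + ‖y‖) ^ p) * ‖x - x'‖ := by gcongr
      _ = _ := by ring
  rw [blockPotential, blockPotential,
    ← integral_sub (H.integrable_update hm i x) (H.integrable_update hm i x'), ← Real.norm_eq_abs]
  calc _ ≤ ∫ y, 2 * c * (2 + ‖x‖ + ‖x'‖) ^ p * ‖x - x'‖ * (1 + ‖y‖) ^ p ∂(Measure.pi m) :=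
        norm_integral_le_of_norm_le ((hm.integrable_pi H.p_nonneg).const_mul _)
          (ae_of_all _ key)
    _ = _ := by
        rw [integral_const_mul]
        ring

theorem Admissible.continuous_blockPotential (H : Admissible ψ a b c p) (hm : HasMoment p m)
    (i : Fin d) : Continuous (blockPotential ψ m i) := by
  refine continuous_iff_continuousAt.mpr fun x => ?_
  rw [ContinuousAt, tendsto_iff_dist_tendsto_zero]
  have h := H.abs_blockPotential_sub_le hm i
  have hc : Continuous fun z : Block k i => 2 * c * (∫ y, (1 + ‖y‖) ^ p ∂(Measure.pi m)) *
      (2 + ‖z‖ + ‖x‖) ^ p * ‖z - x‖ := by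
    have := H.p_nonneg
    have h1 : Continuous fun z : Block k i => (2 + ‖z‖ + ‖x‖) ^ p :=
      (by fun_prop : Continuous fun z : Block k i => 2 + ‖z‖ + ‖x‖).rpow_const
        fun _ => Or.inr this
    fun_prop
  refine squeeze_zero (fun _ => dist_nonneg) (fun z => (Real.dist_eq _ _).trans_le (h z x)) ?_
  simpa using hc.tendsto x

theorem Admissible.integrable_exp_blockPotential (H : Admissible ψ a b c p) (hm : HasMoment p m)
    (i : Fin d) : Integrable fun x => Real.exp (-blockPotential ψ m i x) :=
  integrable_exp_neg_of_le H.a_pos (H.continuous_blockPotential hm i).measurable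
    (H.le_blockPotential hm i)

theorem Admissible.updateWellDefined (H : Admissible ψ a b c p) (hm : HasMoment p m) (i : Fin d) :
    UpdateWellDefined ψ m i :=
  ⟨H.integrable_update hm i, H.integrable_exp_blockPotential hm i,
    integral_exp_neg_pos (H.integrable_exp_blockPotential hm i)⟩

theorem blockUpdate_eq (ψ : Pt k → ℝ) (m : (i : Fin d) → Measure (Block k i)) (i : Fin d) :
    blockUpdate ψ m i
      = volume.withDensity fun x => ENNReal.ofReal (gibbs (blockPotential ψ m i) x) := rfl

theorem Admissible.expDensity_gibbs (H : Admissible ψ a b c p) (hm : HasMoment p m) (i : Fin d) :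
    ExpDensity a (Real.exp b / ∫ y, Real.exp (-blockPotential ψ m i y))
      (gibbs (blockPotential ψ m i)) :=
  gibbs_expDensity H.a_pos (H.continuous_blockPotential hm i).measurable
    (H.le_blockPotential hm i)

theorem Admissible.hasMoment_update (H : Admissible ψ a b c p) (hm : HasMoment p m) (i : Fin d) :
    HasMoment p (Function.update m i (blockUpdate ψ m i)) :=
  hm.update i (isProbabilityMeasure_withDensity (H.expDensity_gibbs hm i) H.a_pos)
    ((H.expDensity_gibbs hm i).integrable_weight_withDensity H.a_pos H.p_nonneg)

theorem Admissible.hasMoment_partialSweep (H : Admissible ψ a b c p) (hm : HasMoment p m) (j : ℕ) :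
    HasMoment p (partialSweep ψ m j) := by
  induction j with
  | zero => exact hm
  | succ j ih =>
    simp only [partialSweep]
    split_ifs with h
    · exact H.hasMoment_update ih _
    · exact ih

theorem Admissible.hasMoment_marginals (H : Admissible ψ a b c p) (hm : HasMoment p m) (n : ℕ) :
    HasMoment p (marginals ψ m n) := by
  induction n with
  | zero => exact hm
  | succ n ih => exact H.hasMoment_partialSweep ih d

theorem Admissible.integral_update_eq (H : Admissible ψ a b c p) (hm : HasMoment p m)
    (i : Fin d) {ν : Measure (Block k i)} (hν : IsProbabilityMeasure ν)
    (hi : Integrable (fun x => (1 + ‖x‖) ^ p) ν) :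
    ∫ y, ψ y ∂(Measure.pi (Function.update m i ν)) = ∫ x, blockPotential ψ m i x ∂ν := by
  have := hm.isProb
  rw [integral_pi_update m i ν (H.integrable (hm.update i hν hi))]
  rfl

/-! ### The energy of a product density -/

/-- The relative entropy of the product density `f` with respect to the target, up to a constant:
`∫ ψ f + ∑ i, ∫ f i log (f i)`. -/
def energy (ψ : Pt k → ℝ) (f : (i : Fin d) → Block k i → ℝ) : ℝ :=
  ∫ y, ψ y ∂(Measure.pi (ofDens f)) + ∑ i, negEnt (f i)

/-- The density of the `i`-th block after its update, from the marginals with densities `f`. -/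
def stepDens (ψ : Pt k → ℝ) (f : (i : Fin d) → Block k i → ℝ) (i : Fin d) : Block k i → ℝ :=
  gibbs (blockPotential ψ (ofDens f) i)

theorem energy_congr {f g : (i : Fin d) → Block k i → ℝ} (h : ∀ i, f i =ᵐ[volume] g i) :
    energy ψ f = energy ψ g := by
  rw [energy, energy, ofDens_congr h]
  congr 1
  refine Finset.sum_congr rfl fun i _ => integral_congr_ae ?_
  filter_upwards [h i] with x hx
  rw [hx]

theorem expDensity_update (hf : ∀ i, ExpDensity a C (f i)) (i : Fin d) {u : Block k i → ℝ}
    (hu : ExpDensity a C u) (j : Fin d) : ExpDensity a C (Function.update f i u j) := by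
  by_cases h : j = i
  · subst h
    simpa
  · simpa [h] using hf j

theorem Admissible.energy_update (H : Admissible ψ a b c p) (hf : ∀ i, ExpDensity a C (f i))
    (i : Fin d) {C' : ℝ} {u : Block k i → ℝ} (hu : ExpDensity a C' u) :
    energy ψ (Function.update f i u) = (negEnt u + ∫ x, blockPotential ψ (ofDens f) i x * u x) +
      ∑ j ∈ Finset.univ.erase i, negEnt (f j) := by
  have hm := hasMoment_ofDens hf H.a_pos H.p_nonneg
  rw [energy, ofDens_update, H.integral_update_eq hm i
    (isProbabilityMeasure_withDensity hu H.a_pos)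
    (hu.integrable_weight_withDensity H.a_pos H.p_nonneg),
    withDensity_integral hu.measurable hu.nonneg, ← Finset.add_sum_erase _ _ (Finset.mem_univ i)]
  simp only [Function.update_self]
  have : ∑ j ∈ Finset.univ.erase i, negEnt (Function.update f i u j)
      = ∑ j ∈ Finset.univ.erase i, negEnt (f j) :=
    Finset.sum_congr rfl fun j hj => by rw [Function.update_of_ne (Finset.ne_of_mem_erase hj)]
  rw [this]
  ring

theorem Admissible.expDensity_stepDens (H : Admissible ψ a b c p)
    (hf : ∀ i, ExpDensity a C (f i)) (i : Fin d) :
    ExpDensity a (Real.exp b / ∫ y, Real.exp (-blockPotential ψ (ofDens f) i y))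
      (stepDens ψ f i) :=
  H.expDensity_gibbs (hasMoment_ofDens hf H.a_pos H.p_nonneg) i

theorem Admissible.energy_update_gibbs (H : Admissible ψ a b c p)
    (hf : ∀ i, ExpDensity a C (f i)) (i : Fin d) :
    energy ψ (Function.update f i (stepDens ψ f i)) =
      -Real.log (∫ x, Real.exp (-blockPotential ψ (ofDens f) i x)) +
        ∑ j ∈ Finset.univ.erase i, negEnt (f j) := by
  have hm := hasMoment_ofDens hf H.a_pos H.p_nonneg
  have hu := H.expDensity_stepDens hf i
  have hV := (H.continuous_blockPotential hm i).measurable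
  rw [H.energy_update hf i hu]
  congr 1
  refine ((gibbs_variational hu H.a_pos H.a_pos hV (H.le_blockPotential hm i) ?_).2).mpr ?_
  · exact hu.integrable_mul H.a_pos hV H.p_nonneg (H.abs_blockPotential_le hm i)
  · rfl

/-- Updating a block decreases the energy, strictly unless the block does not change. -/
theorem Admissible.energy_step (H : Admissible ψ a b c p) (hf : ∀ i, ExpDensity a C (f i))
    (i : Fin d) :
    energy ψ (Function.update f i (stepDens ψ f i)) ≤ energy ψ f ∧
    (energy ψ f = energy ψ (Function.update f i (stepDens ψ f i)) →
      f i =ᵐ[volume] stepDens ψ f i) := by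
  have hm := hasMoment_ofDens hf H.a_pos H.p_nonneg
  have hV := (H.continuous_blockPotential hm i).measurable
  have h1 := H.energy_update hf i (hf i)
  rw [Function.update_eq_self] at h1
  have h2 := gibbs_variational (hf i) H.a_pos H.a_pos hV (H.le_blockPotential hm i)
    ((hf i).integrable_mul H.a_pos hV H.p_nonneg (H.abs_blockPotential_le hm i))
  rw [H.energy_update_gibbs hf i, h1]
  refine ⟨by linarith [h2.1], fun h => h2.2.mp (by linarith)⟩

/-- Along dominated pointwise convergence of the densities, the potentials and the updated
densities converge pointwise. -/
theorem Admissible.tendsto_stepDens (H : Admissible ψ a b c p)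
    {u : ℕ → (i : Fin d) → Block k i → ℝ}
    (hu : ∀ n i, ExpDensity a C (u n i)) (hf : ∀ i, ExpDensity a C (f i))
    (hlim : ∀ i, ∀ᵐ x, Tendsto (fun n => u n i x) atTop (𝓝 (f i x))) (i : Fin d) (x : Block k i) :
    Tendsto (fun n => stepDens ψ (u n) i x) atTop (𝓝 (stepDens ψ f i x)) := by
  have hV : ∀ x, Tendsto (fun n => blockPotential ψ (ofDens (u n)) i x) atTop
      (𝓝 (blockPotential ψ (ofDens f) i x)) := fun x =>
    tendsto_integral_pi_ofDens hu hf H.a_pos hlim H.p_nonneg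
      (H.continuous.comp (continuous_update_left i x)).measurable fun y => H.abs_update_le y i x
  have hmu := fun n => hasMoment_ofDens (hu n) H.a_pos H.p_nonneg
  have hmf := hasMoment_ofDens hf H.a_pos H.p_nonneg
  have hE : ∀ x, Tendsto (fun n => Real.exp (-blockPotential ψ (ofDens (u n)) i x)) atTop
      (𝓝 (Real.exp (-blockPotential ψ (ofDens f) i x))) := fun x =>
    (Real.continuous_exp.tendsto _).comp (hV x).neg
  refine (hE x).div ?_ (integral_exp_neg_pos (H.integrable_exp_blockPotential hmf i)).ne'
  refine tendsto_integral_of_dominated_convergence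
    (fun x => Real.exp b * Real.exp (-(a * ‖x‖)))
    (fun n => (H.integrable_exp_blockPotential (hmu n) i).aestronglyMeasurable)
    ((integrable_exp_neg_mul_norm volume H.a_pos).const_mul _)
    (fun n => ae_of_all _ fun x => ?_) (ae_of_all _ hE)
  rw [Real.norm_of_nonneg (Real.exp_pos _).le, ← Real.exp_add]
  exact Real.exp_le_exp.mpr (by linarith [H.le_blockPotential (hmu n) i x])

theorem Admissible.tendsto_energy (H : Admissible ψ a b c p)
    {u : ℕ → (i : Fin d) → Block k i → ℝ}
    (hu : ∀ n i, ExpDensity a C (u n i)) (hf : ∀ i, ExpDensity a C (f i))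
    (hlim : ∀ i, ∀ᵐ x, Tendsto (fun n => u n i x) atTop (𝓝 (f i x))) :
    Tendsto (fun n => energy ψ (u n)) atTop (𝓝 (energy ψ f)) :=
  (tendsto_integral_pi_ofDens hu hf H.a_pos hlim H.p_nonneg H.continuous.measurable H.up).add
    (tendsto_finsetSum _ fun i _ => tendsto_negEnt (fun n => hu n i) H.a_pos (hlim i))

/-- A bound on the energy bounds the entropies of the blocks. The linear lower bound on `ψ` is split
into two halves: one half compensates the entropies, by Gibbs' inequality for the potential
`x ↦ a ‖x‖ / (2 d)`, and the other one bounds the first moments. -/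
theorem Admissible.exists_le_negEnt (H : Admissible ψ a b c p) (hd : 0 < d) (B : ℝ) :
    ∃ K : ℝ, ∀ (C : ℝ) (f : (i : Fin d) → Block k i → ℝ), (∀ i, ExpDensity a C (f i)) →
      energy ψ f ≤ B → ∀ i, -K ≤ negEnt (f i) := by
  have hd' : (0 : ℝ) < d := by exact_mod_cast hd
  set a' : ℝ := a / d with ha'
  have ha'0 : 0 < a' := div_pos H.a_pos hd'
  set κ : Fin d → ℝ := fun i => Real.log (∫ x : Block k i, Real.exp (-(a' / 2 * ‖x‖))) with hκ
  refine ⟨∑ i, |κ i| + |B| + |b| + ∑ i, |κ i|, fun C f hf hB i => ?_⟩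
  have hprob := isProbabilityMeasure_ofDens hf H.a_pos
  have hw : ∀ j, Integrable (fun x => ‖x‖ * f j x) := fun j =>
    (hf j).integrable_mul H.a_pos (by fun_prop) zero_le_one (c := 1) fun x => by
      rw [abs_of_nonneg (norm_nonneg x), Real.rpow_one]
      linarith
  set M : Fin d → ℝ := fun j => ∫ x, ‖x‖ * f j x with hM
  have hM0 : ∀ j, 0 ≤ M j := fun j =>
    integral_nonneg fun x => mul_nonneg (norm_nonneg x) ((hf j).nonneg x)
  have hG : ∀ j, -κ j ≤ negEnt (f j) + a' / 2 * M j := by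
    intro j
    have h1 := (gibbs_variational (V := fun x : Block k j => a' / 2 * ‖x‖) (b := 0) (hf j) H.a_pos
      (half_pos ha'0) (by fun_prop) (fun x => by simp) (by
        simp only [mul_assoc]
        exact (hw j).const_mul _)).1
    simp only [mul_assoc] at h1
    rw [integral_const_mul] at h1
    simpa only [hκ, mul_assoc] using h1
  have hψ : a' * ∑ j, M j - b ≤ ∫ y, ψ y ∂(Measure.pi (ofDens f)) := by
    have hint : ∀ j, Integrable (fun y : Pt k => ‖y j‖) (Measure.pi (ofDens f)) := fun j =>
      (hasMoment_ofDens hf H.a_pos zero_le_one).integrable_of_le (K := 1) zero_le_one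
        (by fun_prop) fun y => by
          rw [abs_of_nonneg (norm_nonneg _), Real.rpow_one]
          linarith [norm_le_pi_norm y j]
    have hval : ∀ j, ∫ y : Pt k, ‖y j‖ ∂(Measure.pi (ofDens f)) = M j := by
      intro j
      rw [hM]
      simp only
      rw [← integral_ofDens hf j fun x => ‖x‖, ← (measurePreserving_eval (ofDens f) j).map_eq,
        integral_map (measurable_pi_apply j).aemeasurable
          (by fun_prop : Measurable fun x : Block k j => ‖x‖).aestronglyMeasurable]
    calc a' * ∑ j, M j - b = ∫ y : Pt k, (a' * ∑ j, ‖y j‖ - b) ∂(Measure.pi (ofDens f)) := by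
          rw [integral_sub ((integrable_finsetSum _ fun j _ => hint j).const_mul _)
            (integrable_const _), integral_const_mul, integral_finsetSum _ fun j _ => hint j]
          simp [hval]
      _ ≤ _ := by
          refine integral_mono (((integrable_finsetSum _ fun j _ => hint j).const_mul _).sub
            (integrable_const _)) (H.integrable (hasMoment_ofDens hf H.a_pos H.p_nonneg))
            fun y => le_trans ?_ (H.low y)
          have : ∑ j, ‖y j‖ ≤ d * ‖y‖ := by
            calc ∑ j, ‖y j‖ ≤ ∑ _j : Fin d, ‖y‖ := Finset.sum_le_sum fun j _ => norm_le_pi_norm y j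
              _ = _ := by simp
          have h2 : a' * ∑ j, ‖y j‖ ≤ a * ‖y‖ := by
            calc a' * ∑ j, ‖y j‖ ≤ a' * (d * ‖y‖) := by gcongr
              _ = a * ‖y‖ := by
                rw [ha']
                field_simp
          linarith
  have hS : ∑ j, (-κ j) ≤ ∑ j, negEnt (f j) + a' / 2 * ∑ j, M j := by
    rw [Finset.mul_sum, ← Finset.sum_add_distrib]
    exact Finset.sum_le_sum fun j _ => hG j
  have hk1 : ∑ j, κ j ≤ ∑ j, |κ j| := Finset.sum_le_sum fun j _ => le_abs_self _
  have hk2 : κ i ≤ ∑ j, |κ j| := (le_abs_self _).trans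
    (Finset.single_le_sum (f := fun j => |κ j|) (fun j _ => abs_nonneg _) (Finset.mem_univ i))
  have hMi : M i ≤ ∑ j, M j := Finset.single_le_sum (fun j _ => hM0 j) (Finset.mem_univ i)
  have hGi := hG i
  have hBabs := le_abs_self B
  have hbabs := le_abs_self b
  rw [Finset.sum_neg_distrib] at hS
  rw [energy] at hB
  have hMM : a' / 2 * M i ≤ a' / 2 * ∑ j, M j := by gcongr
  linarith

/-- The normalizing constants of updates of states of bounded energy are bounded below, because the
energy after the update is minus the logarithm of the normalizing constant plus the entropies of the
other blocks. -/
theorem Admissible.exists_normalization_bound (H : Admissible ψ a b c p) (hd : 0 < d) (B : ℝ) :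
    ∃ C' : ℝ, ∀ (C : ℝ) (f : (i : Fin d) → Block k i → ℝ), (∀ i, ExpDensity a C (f i)) →
      energy ψ f ≤ B → ∀ i,
        Real.exp b / ∫ y, Real.exp (-blockPotential ψ (ofDens f) i y) ≤ C' := by
  obtain ⟨K, hK⟩ := H.exists_le_negEnt hd B
  refine ⟨Real.exp b * Real.exp (B + d * |K|), fun C f hf hB i => ?_⟩
  have hZ := integral_exp_neg_pos
    (H.integrable_exp_blockPotential (hasMoment_ofDens hf H.a_pos H.p_nonneg) i)
  have h1 := (H.energy_step hf i).1.trans hB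
  rw [H.energy_update_gibbs hf i] at h1
  have h2 : -(d * |K|) ≤ ∑ j ∈ Finset.univ.erase i, negEnt (f j) := by
    calc -(d * |K|) ≤ ∑ _j ∈ Finset.univ.erase i, -|K| := by
          have h := Finset.sum_le_sum_of_subset_of_nonneg (f := fun _ : Fin d => |K|)
            (Finset.erase_subset i Finset.univ) fun _ _ _ => abs_nonneg K
          simp only [Finset.sum_neg_distrib]
          simpa using h
      _ ≤ _ := Finset.sum_le_sum fun j _ => (neg_le_neg (le_abs_self K)).trans (hK C f hf hB j)
  rw [div_eq_mul_inv]
  gcongr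
  rw [← Real.exp_log hZ, ← Real.exp_neg]
  exact Real.exp_le_exp.mpr (by linarith)

end MeanField

/-! ### Coordinate ascent on densities -/

section Sweep

variable {d : ℕ} {k : Fin d → ℕ} {ψ : Pt k → ℝ} {a b c p C : ℝ}
  {f g : (i : Fin d) → Block k i → ℝ}

/-- The densities after the first `j` blocks have been updated. -/
def sweepDens (ψ : Pt k → ℝ) (f : (i : Fin d) → Block k i → ℝ) :
    ℕ → (i : Fin d) → Block k i → ℝ
  | 0 => f
  | j + 1 =>
    if h : j < d then
      Function.update (sweepDens ψ f j) ⟨j, h⟩ (stepDens ψ (sweepDens ψ f j) ⟨j, h⟩)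
    else sweepDens ψ f j

/-- The densities of the iterates, starting from densities `f`. -/
def densSeq (ψ : Pt k → ℝ) (f : (i : Fin d) → Block k i → ℝ) : ℕ → (i : Fin d) → Block k i → ℝ
  | 0 => f
  | n + 1 => sweepDens ψ (densSeq ψ f n) d

theorem partialSweep_ofDens (ψ : Pt k → ℝ) (f : (i : Fin d) → Block k i → ℝ) (j : ℕ) :
    partialSweep ψ (ofDens f) j = ofDens (sweepDens ψ f j) := by
  induction j with
  | zero => rfl
  | succ j ih =>
    simp only [partialSweep, sweepDens]
    split_ifs with h
    · rw [ih, ofDens_update, blockUpdate_eq]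
      rfl
    · exact ih

/-- The densities of the first iterate. The initial measures themselves need not have densities. -/
def firstDens (ψ : Pt k → ℝ) (m : (i : Fin d) → Measure (Block k i)) (i : Fin d) :
    Block k i → ℝ :=
  gibbs (blockPotential ψ (partialSweep ψ m i) i)

theorem partialSweep_eq_ofDens (ψ : Pt k → ℝ) (m : (i : Fin d) → Measure (Block k i)) :
    partialSweep ψ m d = ofDens (firstDens ψ m) := by
  funext i
  rw [partialSweep_eq_of_lt ψ m i d i.isLt, blockUpdate_eq]
  rfl

theorem marginals_succ_eq_ofDens (ψ : Pt k → ℝ) (m : (i : Fin d) → Measure (Block k i)) (n : ℕ) :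
    marginals ψ m (n + 1) = ofDens (densSeq ψ (firstDens ψ m) n) := by
  induction n with
  | zero => exact partialSweep_eq_ofDens ψ m
  | succ n ih =>
    rw [marginals, ih, partialSweep_ofDens]
    rfl

theorem sweepDens_eq_of_lt (ψ : Pt k → ℝ) (f : (i : Fin d) → Block k i → ℝ) (i : Fin d) (j : ℕ)
    (hj : (i : ℕ) < j) : sweepDens ψ f j i = stepDens ψ (sweepDens ψ f i) i := by
  induction j, hj using Nat.le_induction with
  | base => simp [sweepDens]
  | succ j hj ih =>
    simp only [sweepDens]
    split_ifs with h
    · have hne : i ≠ ⟨j, h⟩ := by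
        intro e
        rw [e] at hj
        simp at hj
      rw [Function.update_of_ne hne, ih]
    · exact ih

theorem stepDens_congr (h : ∀ i, f i =ᵐ[volume] g i) (i : Fin d) :
    stepDens ψ f i = stepDens ψ g i := by
  rw [stepDens, stepDens, ofDens_congr h]

theorem Admissible.exists_expDensity_sweepDens (H : Admissible ψ a b c p)
    (hf : ∃ C, ∀ i, ExpDensity a C (f i)) (j : ℕ) :
    ∃ C, ∀ i, ExpDensity a C (sweepDens ψ f j i) := by
  induction j with
  | zero => exact hf
  | succ j ih =>
    obtain ⟨C, hC⟩ := ih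
    simp only [sweepDens]
    split_ifs with h
    · exact ⟨_, expDensity_update (fun i => (hC i).mono (le_max_left _ _)) _
        ((H.expDensity_stepDens hC ⟨j, h⟩).mono (le_max_right C _))⟩
    · exact ⟨C, hC⟩

theorem Admissible.energy_sweepDens_succ_le (H : Admissible ψ a b c p)
    (hf : ∃ C, ∀ i, ExpDensity a C (f i)) (j : ℕ) :
    energy ψ (sweepDens ψ f (j + 1)) ≤ energy ψ (sweepDens ψ f j) := by
  obtain ⟨C, hC⟩ := H.exists_expDensity_sweepDens hf j
  rw [sweepDens]
  split_ifs with h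
  · exact (H.energy_step hC _).1
  · exact le_rfl

theorem Admissible.antitone_energy_sweepDens (H : Admissible ψ a b c p)
    (hf : ∃ C, ∀ i, ExpDensity a C (f i)) : Antitone fun j => energy ψ (sweepDens ψ f j) :=
  antitone_nat_of_succ_le (H.energy_sweepDens_succ_le hf)

theorem Admissible.energy_sweepDens_le (H : Admissible ψ a b c p)
    (hf : ∃ C, ∀ i, ExpDensity a C (f i)) (j : ℕ) : energy ψ (sweepDens ψ f j) ≤ energy ψ f := by
  have h : energy ψ (sweepDens ψ f j) ≤ energy ψ (sweepDens ψ f 0) :=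
    H.antitone_energy_sweepDens hf (Nat.zero_le j)
  rwa [sweepDens] at h

/-- If a sweep does not decrease the energy, each block is a fixed point of its update: by induction
along the sweep, no block is changed. -/
theorem Admissible.eq_stepDens_of_energy_le (H : Admissible ψ a b c p)
    (hf : ∃ C, ∀ i, ExpDensity a C (f i)) (he : energy ψ f ≤ energy ψ (sweepDens ψ f d))
    (i : Fin d) : f i =ᵐ[volume] stepDens ψ f i := by
  have hanti := H.antitone_energy_sweepDens hf
  have key : ∀ j, j ≤ d → (∀ i, sweepDens ψ f j i =ᵐ[volume] f i) ∧
      ∀ i : Fin d, (i : ℕ) < j → f i =ᵐ[volume] stepDens ψ f i := by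
    intro j
    induction j with
    | zero => exact fun _ => ⟨fun i => ae_eq_rfl, fun i hi => absurd hi (Nat.not_lt_zero _)⟩
    | succ j ih =>
      intro hj
      obtain ⟨h1, h2⟩ := ih (by omega)
      obtain ⟨C, hC⟩ := H.exists_expDensity_sweepDens hf j
      have hj' : j < d := hj
      have hE : energy ψ (sweepDens ψ f j) = energy ψ (Function.update (sweepDens ψ f j) ⟨j, hj'⟩
          (stepDens ψ (sweepDens ψ f j) ⟨j, hj'⟩)) := by
        have e1 : energy ψ (sweepDens ψ f j) ≤ energy ψ f := H.energy_sweepDens_le hf j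
        have e2 : energy ψ (sweepDens ψ f d) ≤ energy ψ (sweepDens ψ f (j + 1)) := hanti hj
        have e3 : energy ψ (sweepDens ψ f (j + 1)) ≤ energy ψ (sweepDens ψ f j) :=
          hanti (Nat.le_succ j)
        have e4 : sweepDens ψ f (j + 1) = Function.update (sweepDens ψ f j) ⟨j, hj'⟩
          (stepDens ψ (sweepDens ψ f j) ⟨j, hj'⟩) := by rw [sweepDens, dif_pos hj']
        rw [← e4]
        linarith
      have hstep := (H.energy_step hC ⟨j, hj'⟩).2 hE
      rw [stepDens_congr h1] at hstep
      have hfix : f ⟨j, hj'⟩ =ᵐ[volume] stepDens ψ f ⟨j, hj'⟩ := (h1 _).symm.trans hstep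
      refine ⟨fun i => ?_, fun i hi => ?_⟩
      · rw [sweepDens, dif_pos hj', stepDens_congr h1]
        by_cases hi : i = ⟨j, hj'⟩
        · subst hi
          rw [Function.update_self]
          exact hfix.symm
        · rw [Function.update_of_ne hi]
          exact h1 i
      · rcases Nat.lt_succ_iff_lt_or_eq.mp hi with hlt | heq
        · exact h2 i hlt
        · have : i = ⟨j, hj'⟩ := Fin.ext heq
          subst this
          exact hfix
  exact (key d le_rfl).2 i i.isLt

/-- If every update from a state of energy at most `B` obeys the bound `C`, then this bound is kept
throughout a sweep, since the energy does not increase. -/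
theorem Admissible.expDensity_sweepDens (H : Admissible ψ a b c p) {B : ℝ}
    (hC : ∀ (C' : ℝ) (f : (i : Fin d) → Block k i → ℝ), (∀ i, ExpDensity a C' (f i)) →
      energy ψ f ≤ B → ∀ i, ExpDensity a C (stepDens ψ f i))
    (hf : ∀ i, ExpDensity a C (f i)) (he : energy ψ f ≤ B) (j : ℕ) (i : Fin d) :
    ExpDensity a C (sweepDens ψ f j i) := by
  induction j generalizing i with
  | zero => exact hf i
  | succ j ih =>
    simp only [sweepDens]
    split_ifs with h
    · exact expDensity_update ih _
        (hC _ _ ih ((H.energy_sweepDens_le ⟨C, hf⟩ j).trans he) ⟨j, h⟩) i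
    · exact ih i

theorem Admissible.tendsto_sweepDens (H : Admissible ψ a b c p)
    {u : ℕ → (i : Fin d) → Block k i → ℝ}
    (hu : ∀ j n i, ExpDensity a C (sweepDens ψ (u n) j i))
    (hf : ∃ C, ∀ i, ExpDensity a C (f i))
    (hlim : ∀ i, ∀ᵐ x, Tendsto (fun n => u n i x) atTop (𝓝 (f i x))) (j : ℕ) (i : Fin d) :
    ∀ᵐ x, Tendsto (fun n => sweepDens ψ (u n) j i x) atTop (𝓝 (sweepDens ψ f j i x)) := by
  induction j generalizing i with
  | zero => exact hlim i
  | succ j ih =>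
    simp only [sweepDens]
    split_ifs with h
    · by_cases hi : i = ⟨j, h⟩
      · subst hi
        simp only [Function.update_self]
        obtain ⟨C', hC'⟩ := H.exists_expDensity_sweepDens hf j
        exact ae_of_all _ fun x => H.tendsto_stepDens (C := max C C')
          (fun n i => (hu j n i).mono (le_max_left _ _))
          (fun i => (hC' i).mono (le_max_right _ _)) ih _ x
      · simp only [Function.update_of_ne hi]
        exact ih i
    · exact ih i

/-! ### Compactness of the iterates -/

/-- The Arzelà–Ascoli argument for functions with locally uniform Lipschitz bounds: a subsequence
that converges on a countable dense set converges everywhere. -/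
theorem exists_tendsto_of_lipschitz {u : ℕ → (i : Fin d) → Block k i → ℝ} {L : ℝ} (hp : 0 ≤ p)
    (hC : ∀ n i x, |u n i x| ≤ C)
    (hL : ∀ n i x x', |u n i x - u n i x'| ≤ L * (2 + ‖x‖ + ‖x'‖) ^ p * ‖x - x'‖) :
    ∃ θ : ℕ → ℕ, StrictMono θ ∧ ∃ f : (i : Fin d) → Block k i → ℝ,
      ∀ i x, Tendsto (fun t => u (θ t) i x) atTop (𝓝 (f i x)) := by
  set v : ℕ → Fin d × ℕ → ℝ := fun n q => u n q.1 (TopologicalSpace.denseSeq (Block k q.1) q.2)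
    with hv
  have hcomp : IsCompact (Set.univ.pi fun _ : Fin d × ℕ => Set.Icc (-C) C) :=
    isCompact_univ_pi fun _ => isCompact_Icc
  obtain ⟨w, -, θ, hθ, hlim⟩ := hcomp.tendsto_subseq (x := v) fun n q _ =>
    abs_le.mp (hC n q.1 _)
  refine ⟨θ, hθ, ?_⟩
  have hcauchy : ∀ i x, CauchySeq fun t => u (θ t) i x := by
    intro i x
    refine Metric.cauchySeq_iff'.mpr fun ε hε => ?_
    have hcont : Continuous fun z : Block k i => L * (2 + ‖x‖ + ‖z‖) ^ p * ‖x - z‖ := by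
      have h1 : Continuous fun z : Block k i => (2 + ‖x‖ + ‖z‖) ^ p :=
        (by fun_prop : Continuous fun z : Block k i => 2 + ‖x‖ + ‖z‖).rpow_const
          fun _ => Or.inr hp
      fun_prop
    have hopen : IsOpen {z : Block k i | L * (2 + ‖x‖ + ‖z‖) ^ p * ‖x - z‖ < ε / 3} :=
      isOpen_lt hcont continuous_const
    obtain ⟨r, hz⟩ := (TopologicalSpace.denseRange_denseSeq (Block k i)).exists_mem_open
      hopen ⟨x, by simp only [sub_self, norm_zero, mul_zero, Set.mem_ofPred_eq]; positivity⟩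
    set z := TopologicalSpace.denseSeq (Block k i) r with hzdef
    have hz' : L * (2 + ‖x‖ + ‖z‖) ^ p * ‖x - z‖ < ε / 3 := hz
    have hc : CauchySeq fun t => u (θ t) i z :=
      ((tendsto_pi_nhds.mp hlim) (i, r)).cauchySeq
    obtain ⟨N, hN⟩ := Metric.cauchySeq_iff'.mp hc (ε / 3) (by positivity)
    refine ⟨N, fun n hn => ?_⟩
    have h1 := (hL (θ n) i x z).trans_lt hz'
    have h2 := (hL (θ N) i x z).trans_lt hz'
    have h3 := hN n hn
    rw [Real.dist_eq] at h3 ⊢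
    rw [abs_lt] at *
    constructor <;> linarith [h1.1, h1.2, h2.1, h2.2, h3.1, h3.2]
  choose f hf using fun i x => cauchySeq_tendsto_of_complete (hcauchy i x)
  exact ⟨f, hf⟩

theorem ExpDensity.of_tendsto {E : Type*} [NormedAddCommGroup E] [NormedSpace ℝ E]
    [FiniteDimensional ℝ E] [MeasureSpace E] [BorelSpace E]
    [(volume : Measure E).IsAddHaarMeasure] {u : ℕ → E → ℝ} {f : E → ℝ} (ha : 0 < a)
    (hu : ∀ n, ExpDensity a C (u n)) (hlim : ∀ x, Tendsto (fun n => u n x) atTop (𝓝 (f x))) :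
    ExpDensity a C f where
  measurable := measurable_of_tendsto_metrizable (fun n => (hu n).measurable)
    (tendsto_pi_nhds.mpr hlim)
  nonneg x := ge_of_tendsto' (hlim x) fun n => (hu n).nonneg x
  le x := le_of_tendsto' (hlim x) fun n => (hu n).le x
  integral_eq := by
    have h := tendsto_integral_of_dominated_convergence
      (fun x => C * Real.exp (-(a * ‖x‖))) (fun n => (hu n).measurable.aestronglyMeasurable)
      ((integrable_exp_neg_mul_norm volume ha).const_mul C)
      (fun n => ae_of_all _ fun x => by
        rw [Real.norm_of_nonneg ((hu n).nonneg x)]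
        exact (hu n).le x) (ae_of_all _ hlim)
    simp only [(hu _).integral_eq] at h
    exact tendsto_nhds_unique h tendsto_const_nhds

theorem abs_exp_neg_sub_le {s t B : ℝ} (hs : -s ≤ B) (ht : -t ≤ B) :
    |Real.exp (-s) - Real.exp (-t)| ≤ Real.exp B * |s - t| := by
  have key : ∀ s t : ℝ, -s ≤ B → -t ≤ B → Real.exp (-s) - Real.exp (-t) ≤ Real.exp B * |s - t| := by
    intro s t hs ht
    have h1 : Real.exp (-s) * (s - t + 1) ≤ Real.exp (-t) := by
      calc Real.exp (-s) * (s - t + 1) ≤ Real.exp (-s) * Real.exp (s - t) := by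
            gcongr
            exact Real.add_one_le_exp _
        _ = Real.exp (-t) := by
            rw [← Real.exp_add]
            ring_nf
    have h2 : Real.exp (-s) * (t - s) ≤ Real.exp B * |s - t| := by
      have : t - s ≤ |s - t| := by rw [abs_sub_comm]; exact le_abs_self _
      calc _ ≤ Real.exp (-s) * |s - t| := by gcongr
        _ ≤ _ := by gcongr
    linarith
  rw [abs_le]
  constructor
  · have := key t s ht hs
    rw [abs_sub_comm] at this
    linarith
  · exact key s t hs ht

theorem Admissible.exists_lipschitz_gibbs (H : Admissible ψ a b c p)
    {m : (i : Fin d) → Measure (Block k i)} (hm : HasMoment p m) (i : Fin d) (x x' : Block k i) :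
    |gibbs (blockPotential ψ m i) x - gibbs (blockPotential ψ m i) x'| ≤
      (Real.exp b / ∫ z, Real.exp (-blockPotential ψ m i z)) *
        (2 * c * ∫ y, (1 + ‖y‖) ^ p ∂(Measure.pi m)) * (2 + ‖x‖ + ‖x'‖) ^ p * ‖x - x'‖ := by
  have hZ := integral_exp_neg_pos (H.integrable_exp_blockPotential hm i)
  have hlow : ∀ z, -blockPotential ψ m i z ≤ b := fun z => by
    have := H.le_blockPotential hm i z
    have := mul_nonneg H.a_pos.le (norm_nonneg z)
    linarith
  have h1 := abs_exp_neg_sub_le (hlow x) (hlow x')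
  have h2 := H.abs_blockPotential_sub_le hm i x x'
  rw [gibbs, gibbs, ← sub_div, abs_div, abs_of_pos hZ, div_le_iff₀ hZ]
  calc _ ≤ Real.exp b * (2 * c * (∫ y, (1 + ‖y‖) ^ p ∂(Measure.pi m)) *
        (2 + ‖x‖ + ‖x'‖) ^ p * ‖x - x'‖) := h1.trans (by gcongr)
    _ = _ := by
        field_simp

/-- The moments of product densities are bounded in terms of the exponential bound. -/
theorem exists_moment_le (k : Fin d → ℕ) (a C : ℝ) (ha : 0 < a) (hp : 0 ≤ p) :
    ∃ M : ℝ, ∀ f : (i : Fin d) → Block k i → ℝ, (∀ i, ExpDensity a C (f i)) →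
      ∫ y, (1 + ‖y‖) ^ p ∂(Measure.pi (ofDens f)) ≤ M := by
  refine ⟨∏ i, ∫ x : Block k i, C * ((1 + ‖x‖) ^ p * Real.exp (-(a * ‖x‖))), fun f hf => ?_⟩
  rw [integral_pi_ofDens hf ha]
  rw [← integral_fintype_prod_eq_prod
    (fun i (x : Block k i) => C * ((1 + ‖x‖) ^ p * Real.exp (-(a * ‖x‖))))]
  refine integral_mono_of_nonneg (ae_of_all _ fun y => ?_) ?_ (ae_of_all _ fun y => ?_)
  · exact mul_nonneg (by positivity) (prodDens_nonneg (fun i => (hf i).nonneg) y)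
  · exact Integrable.fintype_prod_dep
      (f := fun i (x : Block k i) => C * ((1 + ‖x‖) ^ p * Real.exp (-(a * ‖x‖))))
      fun i => (integrable_one_add_norm_rpow_mul_exp volume hp ha).const_mul C
  · calc (1 + ‖y‖) ^ p * prodDens f y ≤ (∏ i, (1 + ‖y i‖) ^ p) *
          ∏ i, (C * Real.exp (-(a * ‖y i‖))) := by
          refine mul_le_mul (one_add_norm_rpow_le_prod hp y) ?_
            (prodDens_nonneg (fun i => (hf i).nonneg) y) (by positivity)
          exact Finset.prod_le_prod (fun i _ => (hf i).nonneg _) fun i _ => (hf i).le _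
      _ = _ := by
          rw [← Finset.prod_mul_distrib]
          exact Finset.prod_congr rfl fun i _ => by ring

/-- The properties of the sequence of densities of the iterates that the limit theorems use: it is
generated by sweeps, all intermediate states obey one exponential bound, and the densities are
Lipschitz with constants of polynomial growth, both uniformly along the sequence. -/
structure IsRun (ψ : Pt k → ℝ) (a C L p : ℝ) (u : ℕ → (i : Fin d) → Block k i → ℝ) : Prop where
  succ : ∀ n, u (n + 1) = sweepDens ψ (u n) d
  expDensity : ∀ n j i, ExpDensity a C (sweepDens ψ (u n) j i)
  lipschitz : ∀ n i x x', |u n i x - u n i x'| ≤ L * (2 + ‖x‖ + ‖x'‖) ^ p * ‖x - x'‖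

theorem IsRun.expDensity_zero {L : ℝ} {u : ℕ → (i : Fin d) → Block k i → ℝ}
    (hu : IsRun ψ a C L p u) (n : ℕ) (i : Fin d) : ExpDensity a C (u n i) :=
  hu.expDensity n 0 i

theorem Admissible.exists_isRun (H : Admissible ψ a b c p) (hd : 0 < d)
    {m : (i : Fin d) → Measure (Block k i)} (hm : HasMoment p m) :
    ∃ C L, IsRun ψ a C L p (densSeq ψ (firstDens ψ m)) := by
  set u := densSeq ψ (firstDens ψ m) with hudef
  have hmj := fun j => H.hasMoment_partialSweep hm j
  set C₀ : Fin d → ℝ := fun i =>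
    Real.exp b / ∫ y, Real.exp (-blockPotential ψ (partialSweep ψ m i) i y) with hC₀
  have hC₀0 : ∀ i, 0 ≤ C₀ i := fun i => by
    have := integral_exp_neg_pos (H.integrable_exp_blockPotential (hmj i) i)
    positivity
  have h0 : ∀ i, ExpDensity a (∑ i, C₀ i) (firstDens ψ m i) := fun i =>
    (H.expDensity_gibbs (hmj i) i).mono
      (Finset.single_le_sum (f := C₀) (fun j _ => hC₀0 j) (Finset.mem_univ i))
  obtain ⟨C₁, hC₁⟩ := H.exists_normalization_bound hd (energy ψ (firstDens ψ m))
  set C := max (∑ i, C₀ i) C₁ with hCdef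
  have hstep : ∀ (C' : ℝ) (f : (i : Fin d) → Block k i → ℝ), (∀ i, ExpDensity a C' (f i)) →
      energy ψ f ≤ energy ψ (firstDens ψ m) → ∀ i, ExpDensity a C (stepDens ψ f i) :=
    fun C' f hf he i =>
      (H.expDensity_stepDens hf i).mono ((hC₁ C' f hf he i).trans (le_max_right _ _))
  have hall : ∀ n, (∀ i, ExpDensity a C (u n i)) ∧ energy ψ (u n) ≤ energy ψ (firstDens ψ m) := by
    intro n
    induction n with
    | zero => exact ⟨fun i => (h0 i).mono (le_max_left _ _), le_rfl⟩
    | succ n ih =>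
      exact ⟨fun i => H.expDensity_sweepDens hstep ih.1 ih.2 d i,
        (H.energy_sweepDens_le ⟨C, ih.1⟩ d).trans ih.2⟩
  have hexp : ∀ n j i, ExpDensity a C (sweepDens ψ (u n) j i) := fun n j i =>
    H.expDensity_sweepDens hstep (hall n).1 (hall n).2 j i
  obtain ⟨M, hM⟩ := exists_moment_le k a C H.a_pos H.p_nonneg
  set L₀ : Fin d → ℝ := fun i => C₀ i *
    (2 * c * ∫ y, (1 + ‖y‖) ^ p ∂(Measure.pi (partialSweep ψ m i))) with hL₀
  have hc := H.c_nonneg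
  have hL₀0 : ∀ i, 0 ≤ L₀ i := fun i => by
    have := hC₀0 i
    have : 0 ≤ ∫ y : Pt k, (1 + ‖y‖) ^ p ∂(Measure.pi (partialSweep ψ m i)) :=
      integral_nonneg fun y => by positivity
    positivity
  refine ⟨C, max (∑ i, L₀ i) (C₁ * (2 * c * M)), fun n => rfl, hexp, fun n i x x' => ?_⟩
  have hw : 0 ≤ (2 + ‖x‖ + ‖x'‖) ^ p * ‖x - x'‖ := by positivity
  rw [mul_assoc]
  cases n with
  | zero =>
    refine (H.exists_lipschitz_gibbs (hmj i) i x x').trans ?_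
    rw [mul_assoc]
    exact mul_le_mul_of_nonneg_right ((Finset.single_le_sum (f := L₀) (fun j _ => hL₀0 j)
      (Finset.mem_univ i)).trans (le_max_left _ _)) hw
  | succ n =>
    have hmi := hasMoment_ofDens (hexp n i) H.a_pos H.p_nonneg
    have he : u (n + 1) i = gibbs (blockPotential ψ (ofDens (sweepDens ψ (u n) i)) i) :=
      sweepDens_eq_of_lt ψ (u n) i d i.isLt
    rw [he]
    refine (H.exists_lipschitz_gibbs hmi i x x').trans ?_
    rw [mul_assoc]
    refine mul_le_mul_of_nonneg_right (le_trans ?_ (le_max_right _ _)) hw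
    have h1 := hC₁ C _ (hexp n i)
      ((H.energy_sweepDens_le ⟨C, (hall n).1⟩ i).trans (hall n).2) i
    have h2 := hM _ (hexp n i)
    have h3 := integral_exp_neg_pos (H.integrable_exp_blockPotential hmi i)
    have h4 : 0 ≤ ∫ y : Pt k, (1 + ‖y‖) ^ p ∂(Measure.pi (ofDens (sweepDens ψ (u n) i))) :=
      integral_nonneg fun y => by positivity
    exact mul_le_mul h1 (by gcongr) (by positivity) ((by positivity : (0 : ℝ) ≤ _).trans h1)

/-- Any sequence of iterates has a subsequence along which the densities converge pointwise. -/
theorem IsRun.exists_tendsto {L : ℝ} {u : ℕ → (i : Fin d) → Block k i → ℝ} (ha : 0 < a)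
    (hp : 0 ≤ p) (hu : IsRun ψ a C L p u) (φ : ℕ → ℕ) :
    ∃ θ : ℕ → ℕ, StrictMono θ ∧ ∃ f : (i : Fin d) → Block k i → ℝ,
      (∀ i, ExpDensity a C (f i)) ∧
      ∀ i x, Tendsto (fun t => u (φ (θ t)) i x) atTop (𝓝 (f i x)) := by
  obtain ⟨θ, hθ, f, hf⟩ := exists_tendsto_of_lipschitz (u := fun n => u (φ n)) (C := C) hp
    (fun n i x => by
      have h := hu.expDensity_zero (φ n) i
      rw [abs_of_nonneg (h.nonneg x)]
      refine (h.le x).trans (mul_le_of_le_one_right h.C_nonneg (Real.exp_le_one_iff.mpr ?_))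
      have := mul_nonneg ha.le (norm_nonneg x)
      linarith) (fun n => hu.lipschitz (φ n))
  exact ⟨θ, hθ, f, fun i => ExpDensity.of_tendsto ha (fun n => hu.expDensity_zero _ i) (hf i), hf⟩

/-- Limit points of the iterates are fixed points: the energy is continuous and decreases along
the iterates, so that a sweep started from the limit point leaves the energy unchanged. -/
theorem Admissible.eq_stepDens_of_tendsto (H : Admissible ψ a b c p) {L : ℝ}
    {u : ℕ → (i : Fin d) → Block k i → ℝ} (hu : IsRun ψ a C L p u)
    (hf : ∀ i, ExpDensity a C (f i)) {φ : ℕ → ℕ} (hφ : Tendsto φ atTop atTop)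
    (hlim : ∀ i, ∀ᵐ x, Tendsto (fun t => u (φ t) i x) atTop (𝓝 (f i x))) (i : Fin d) :
    f i =ᵐ[volume] stepDens ψ f i := by
  have hanti : Antitone fun n => energy ψ (u n) := antitone_nat_of_succ_le fun n => by
    rw [hu.succ]
    exact H.energy_sweepDens_le ⟨C, hu.expDensity_zero n⟩ d
  have h1 : Tendsto (fun t => energy ψ (u (φ t))) atTop (𝓝 (energy ψ f)) :=
    H.tendsto_energy (fun t => hu.expDensity_zero (φ t)) hf hlim
  have h2 : Tendsto (fun t => energy ψ (sweepDens ψ (u (φ t)) d)) atTop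
      (𝓝 (energy ψ (sweepDens ψ f d))) := by
    obtain ⟨C', hC'⟩ := H.exists_expDensity_sweepDens ⟨C, hf⟩ d
    exact H.tendsto_energy (C := max C C')
      (fun t i => (hu.expDensity (φ t) d i).mono (le_max_left _ _))
      (fun i => (hC' i).mono (le_max_right _ _))
      (H.tendsto_sweepDens (fun j t i => hu.expDensity (φ t) j i) ⟨C, hf⟩ hlim d)
  have hge : ∀ n, energy ψ f ≤ energy ψ (u n) := by
    intro n
    refine le_of_tendsto h1 ?_
    filter_upwards [hφ.eventually_ge_atTop n] with t ht using hanti ht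
  refine H.eq_stepDens_of_energy_le ⟨C, hf⟩ (ge_of_tendsto' h2 fun t => ?_) i
  rw [← hu.succ]
  exact hge _

end Sweep

/-! ### Fixed points minimize the energy -/

section FixedPoint

theorem _root_.ConvexOn.ae_differentiableAt_of_growth {E : Type*} [NormedAddCommGroup E]
    [NormedSpace ℝ E] [FiniteDimensional ℝ E] [MeasurableSpace E] [BorelSpace E] (μ : Measure E)
    [μ.IsAddHaarMeasure] {ψ : E → ℝ} (hψ : ConvexOn ℝ Set.univ ψ) {c p : ℝ}
    (hc : 0 ≤ c) (hp : 0 ≤ p) (hg : ∀ x, |ψ x| ≤ c * (1 + ‖x‖) ^ p) :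
    ∀ᵐ x ∂μ, DifferentiableAt ℝ ψ x := by
  have h : ∀ n : ℕ, ∀ᵐ x ∂μ, x ∈ Metric.ball (0 : E) n → DifferentiableAt ℝ ψ x := by
    intro n
    have hL : LipschitzOnWith (Real.toNNReal (2 * c * (2 + n + n) ^ p)) ψ (Metric.ball 0 n) := by
      refine LipschitzOnWith.of_dist_le_mul fun x hx y hy => ?_
      rw [Real.dist_eq, dist_eq_norm, Real.coe_toNNReal _ (by positivity)]
      refine (hψ.abs_sub_le_of_growth hc hp hg x y).trans ?_
      rw [mem_ball_zero_iff] at hx hy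
      gcongr
    filter_upwards [hL.ae_differentiableWithinAt_of_mem (μ := μ)] with x hx hxn
    exact (hx hxn).differentiableAt (Metric.isOpen_ball.mem_nhds hxn)
  filter_upwards [ae_all_iff.mpr h] with x hx
  obtain ⟨n, hn⟩ := exists_nat_gt ‖x‖
  exact hx n (by simpa using hn)

theorem _root_.ConvexOn.fderiv_le_sub {E : Type*} [NormedAddCommGroup E] [NormedSpace ℝ E]
    {ψ : E → ℝ} (hψ : ConvexOn ℝ Set.univ ψ) {x : E} (hd : DifferentiableAt ℝ ψ x) (y : E) :
    fderiv ℝ ψ x (y - x) ≤ ψ y - ψ x := by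
  have h := (hd.hasFDerivAt.hasLineDerivAt (y - x)).tendsto_slope_zero_right
  refine le_of_tendsto h ?_
  filter_upwards [Ioo_mem_nhdsGT (zero_lt_one' ℝ)] with t ht
  have hc := hψ.2 (Set.mem_univ x) (Set.mem_univ y) (by linarith [ht.2] : 0 ≤ 1 - t) ht.1.le
    (by ring)
  have e : (1 - t) • x + t • y = x + t • (y - x) := by
    rw [smul_sub, sub_smul, one_smul]
    abel
  rw [e] at hc
  simp only [smul_eq_mul] at hc ⊢
  rw [inv_mul_le_iff₀ ht.1]
  linarith

theorem _root_.StrictConvexOn.fderiv_lt_sub {E : Type*} [NormedAddCommGroup E] [NormedSpace ℝ E]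
    {ψ : E → ℝ} (hψ : StrictConvexOn ℝ Set.univ ψ) {x : E} (hd : DifferentiableAt ℝ ψ x) {y : E}
    (hxy : x ≠ y) : fderiv ℝ ψ x (y - x) < ψ y - ψ x := by
  have h1 := hψ.convexOn.fderiv_le_sub hd ((1 / 2 : ℝ) • x + (1 / 2 : ℝ) • y)
  have h2 := hψ.2 (Set.mem_univ x) (Set.mem_univ y) hxy (by norm_num : (0 : ℝ) < 1 / 2)
    (by norm_num : (0 : ℝ) < 1 / 2) (by norm_num)
  have e : (1 / 2 : ℝ) • x + (1 / 2 : ℝ) • y - x = (1 / 2 : ℝ) • (y - x) := by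
    module
  rw [e, map_smul] at h1
  simp only [smul_eq_mul] at h1 h2
  linarith

variable {d : ℕ} {k : Fin d → ℕ} {ψ : Pt k → ℝ} {a b c p C C' : ℝ}
  {f g : (i : Fin d) → Block k i → ℝ}

theorem Admissible.posExpDecay_gibbs (H : Admissible ψ a b c p)
    {m : (i : Fin d) → Measure (Block k i)} (hm : HasMoment p m) (i : Fin d) :
    PosExpDecay (gibbs (blockPotential ψ m i)) where
  continuous := (Real.continuous_exp.comp (H.continuous_blockPotential hm i).neg).div_const _
  pos := gibbs_pos (H.integrable_exp_blockPotential hm i)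
  exists_le := ⟨a, _, H.a_pos, (H.expDensity_gibbs hm i).le⟩

/-- The product of the uniform distributions on the cubes of the blocks. -/
def cubes (k : Fin d → ℕ) : Measure ((i : Fin d) → Fin (k i) → ℝ) :=
  Measure.pi fun i => cube (k i)

instance : IsProbabilityMeasure (cubes k) := by
  unfold cubes
  infer_instance

/-- The product of the Knothe maps of the blocks. -/
def knotheMap (f : (i : Fin d) → Block k i → ℝ) (w : (i : Fin d) → Fin (k i) → ℝ) : Pt k :=
  fun i => knotheE (f i) (w i)

theorem measurePreserving_knotheE (hf : ∀ i, ExpDensity a C (f i)) (hfn : ∀ i, PosExpDecay (f i))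
    (i : Fin d) : MeasurePreserving (knotheE (f i)) (cube (k i)) (ofDens f i) :=
  ⟨measurable_knotheE (hfn i), map_knotheE (hfn i) (hf i).integral_eq⟩

theorem measurePreserving_knotheMap (hf : ∀ i, ExpDensity a C (f i)) (ha : 0 < a)
    (hfn : ∀ i, PosExpDecay (f i)) :
    MeasurePreserving (knotheMap f) (cubes k) (Measure.pi (ofDens f)) := by
  have := isProbabilityMeasure_ofDens hf ha
  exact measurePreserving_pi _ _ (measurePreserving_knotheE hf hfn)

theorem integrable_weight_knotheMap (hf : ∀ i, ExpDensity a C (f i)) (ha : 0 < a)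
    (hfn : ∀ i, PosExpDecay (f i)) {s : ℝ} (hs : 0 ≤ s) :
    Integrable (fun w => (1 + ‖knotheMap f w‖) ^ s) (cubes k) :=
  (measurePreserving_knotheMap hf ha hfn).integrable_comp_of_integrable
    ((hasMoment_ofDens hf ha hs).integrable_pi hs)

theorem one_add_rpow_mul_le {s A B : ℝ} (hA : 0 ≤ A) (hB : 0 ≤ B) :
    (1 + A) ^ s * (1 + B) ^ s ≤ (1 + A) ^ (2 * s) + (1 + B) ^ (2 * s) := by
  have e : ∀ r : ℝ, 0 ≤ r → (1 + r) ^ (2 * s) = ((1 + r) ^ s) ^ 2 := fun r hr => by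
    rw [mul_comm, Real.rpow_mul (by positivity), Real.rpow_two]
  rw [e A hA, e B hB]
  nlinarith [sq_nonneg ((1 + A) ^ s - (1 + B) ^ s), sq_nonneg ((1 + A) ^ s),
    sq_nonneg ((1 + B) ^ s)]

/-- If the `i`-th block is moved by a function `Z` of its own cube variable, then the other blocks
are independent of it and integrate out to the block potential. -/
theorem Admissible.integral_update_knotheMap (H : Admissible ψ a b c p)
    (hf : ∀ i, ExpDensity a C (f i)) (hfn : ∀ i, PosExpDecay (f i)) (i : Fin d)
    {Z : (Fin (k i) → ℝ) → Block k i}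
    (hint : Integrable (fun w => ψ (Function.update (knotheMap f w) i (Z (w i)))) (cubes k)) :
    ∫ w, ψ (Function.update (knotheMap f w) i (Z (w i))) ∂(cubes k)
      = ∫ u, blockPotential ψ (ofDens f) i (Z u) ∂(cube (k i)) := by
  have hm := hasMoment_ofDens hf H.a_pos H.p_nonneg
  have hmp := measurePreserving_knotheMap hf H.a_pos hfn
  have h := integral_pi_update (fun i => cube (k i)) i (cube (k i))
    (h := fun w => ψ (Function.update (knotheMap f w) i (Z (w i))))
    (by rw [Function.update_eq_self]; exact hint)
  rw [Function.update_eq_self] at h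
  refine h.trans (integral_congr_ae (ae_of_all _ fun u => ?_))
  have e : ∀ w : (i : Fin d) → Fin (k i) → ℝ,
      Function.update (knotheMap f (Function.update w i u)) i (Z (Function.update w i u i))
        = Function.update (knotheMap f w) i (Z u) := by
    intro w
    funext j
    by_cases hj : j = i
    · subst hj
      simp
    · simp [hj, knotheMap]
  simp only [e, blockPotential]
  rw [← hmp.map_eq]
  exact (integral_map hmp.measurable.aemeasurable (f := fun y => ψ (Function.update y i (Z u)))
    (H.continuous.comp (continuous_update_left i (Z u))).aestronglyMeasurable).symm

theorem integral_log_knotheE {n : ℕ} {f : EuclideanSpace ℝ (Fin n) → ℝ} (hf : ExpDensity a C f)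
    (ha : 0 < a) (hfn : PosExpDecay f) :
    Integrable (fun u => Real.log (f (knotheE f u))) (cube n) ∧
      ∫ u, Real.log (f (knotheE f u)) ∂(cube n) = negEnt f := by
  have hmp : MeasurePreserving (knotheE f) (cube n)
      (volume.withDensity fun x => ENNReal.ofReal (f x)) :=
    ⟨measurable_knotheE hfn, map_knotheE hfn hf.integral_eq⟩
  have hlm : Measurable fun x => Real.log (f x) := hf.measurable.log
  constructor
  · refine hmp.integrable_comp_of_integrable (g := fun x => Real.log (f x)) ?_
    rw [withDensity_integrable_iff hf.measurable hf.nonneg]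
    simp_rw [mul_comm]
    exact hf.integrable_mul_log ha
  · have := integral_map (μ := cube n) hmp.measurable.aemeasurable
      (f := fun x => Real.log (f x)) hlm.aestronglyMeasurable
    rw [← this, hmp.map_eq, withDensity_integral hf.measurable hf.nonneg, negEnt]
    simp_rw [mul_comm]

theorem norm_interpolate_le {E : Type*} [NormedAddCommGroup E] [NormedSpace ℝ E] {t : ℝ}
    (ht : t ∈ Set.Ioo (0 : ℝ) 1) (x y : E) : ‖(1 - t) • x + t • y‖ ≤ ‖x‖ + ‖y‖ := by
  have ht' : 0 ≤ 1 - t := by linarith [ht.2]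
  calc _ ≤ ‖(1 - t) • x‖ + ‖t • y‖ := norm_add_le _ _
    _ = (1 - t) * ‖x‖ + t * ‖y‖ := by
      rw [norm_smul, norm_smul, Real.norm_of_nonneg ht', Real.norm_of_nonneg ht.1.le]
    _ ≤ _ := by nlinarith [norm_nonneg x, norm_nonneg y, ht.1, ht.2]

theorem integrable_blockPotential_interpolate (H : Admissible ψ a b c p)
    {m : (i : Fin d) → Measure (Block k i)} (hm : HasMoment p m)
    (hf : ∀ i, ExpDensity a C (f i)) (hfn : ∀ i, PosExpDecay (f i))
    (hg : ∀ i, ExpDensity a C' (g i)) (hgn : ∀ i, PosExpDecay (g i)) (i : Fin d) {t : ℝ}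
    (ht : t ∈ Set.Ioo (0 : ℝ) 1) :
    Integrable (fun u => blockPotential ψ m i
      ((1 - t) • knotheE (f i) u + t • knotheE (g i) u)) (cube (k i)) := by
  have hp2 : 0 ≤ 2 * p := by linarith [H.p_nonneg]
  have h1 : Integrable (fun u => (1 + ‖knotheE (f i) u‖) ^ (2 * p)) (cube (k i)) :=
    (measurePreserving_knotheE hf hfn i).integrable_comp_of_integrable
      (g := fun x => (1 + ‖x‖) ^ (2 * p)) ((hf i).integrable_weight_withDensity H.a_pos hp2)
  have h2 : Integrable (fun u => (1 + ‖knotheE (g i) u‖) ^ (2 * p)) (cube (k i)) :=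
    (measurePreserving_knotheE hg hgn i).integrable_comp_of_integrable
      (g := fun x => (1 + ‖x‖) ^ (2 * p)) ((hg i).integrable_weight_withDensity H.a_pos hp2)
  have hVm := (H.continuous_blockPotential hm i).measurable
  have m1 := measurable_knotheE (hfn i)
  have m2 := measurable_knotheE (hgn i)
  refine ((h1.add h2).const_mul (c * ∫ y, (1 + ‖y‖) ^ p ∂(Measure.pi m))).mono'
    (Measurable.aestronglyMeasurable (by fun_prop)) (ae_of_all _ fun u => ?_)
  have hM : 0 ≤ c * ∫ y : Pt k, (1 + ‖y‖) ^ p ∂(Measure.pi m) :=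
    mul_nonneg H.c_nonneg (integral_nonneg fun y => by positivity)
  refine (H.abs_blockPotential_le hm i _).trans (mul_le_mul_of_nonneg_left ?_ hM)
  refine le_trans ?_ (one_add_rpow_mul_le (norm_nonneg _) (norm_nonneg _))
  have := H.p_nonneg
  rw [← Real.mul_rpow (by positivity) (by positivity)]
  gcongr
  have := norm_interpolate_le ht (knotheE (f i) u) (knotheE (g i) u)
  nlinarith [mul_nonneg (norm_nonneg (knotheE (f i) u)) (norm_nonneg (knotheE (g i) u))]

/-- The first order inequality for the entropy of one block at a fixed point `f`: displacement
convexity of the entropy, in which `-log (f i)` is the block potential up to a constant. -/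
theorem Admissible.mul_negEnt_sub_le (H : Admissible ψ a b c p)
    (hf : ∀ i, ExpDensity a C (f i)) (hfix : ∀ i, f i = stepDens ψ f i)
    (hg : ∀ i, ExpDensity a C' (g i)) (hgn : ∀ i, PosExpDecay (g i)) (i : Fin d) {t : ℝ}
    (ht : t ∈ Set.Ioo (0 : ℝ) 1) :
    t * (negEnt (f i) - negEnt (g i)) ≤
      ∫ u, blockPotential ψ (ofDens f) i ((1 - t) • knotheE (f i) u + t • knotheE (g i) u)
        ∂(cube (k i)) -
      ∫ u, blockPotential ψ (ofDens f) i (knotheE (f i) u) ∂(cube (k i)) := by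
  have hm := hasMoment_ofDens hf H.a_pos H.p_nonneg
  have hfn : ∀ i, PosExpDecay (f i) := fun i => by
    rw [hfix i]
    exact H.posExpDecay_gibbs hm i
  have hZ := integral_exp_neg_pos (H.integrable_exp_blockPotential hm i)
  have hlog : ∀ x, Real.log (f i x) = -blockPotential ψ (ofDens f) i x -
      Real.log (∫ x, Real.exp (-blockPotential ψ (ofDens f) i x)) := by
    intro x
    rw [hfix i, stepDens, gibbs, Real.log_div (Real.exp_pos _).ne' hZ.ne', Real.log_exp]
  have hI := integrable_blockPotential_interpolate H hm hf hfn hg hgn i ht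
  have hIX : Integrable (fun u => blockPotential ψ (ofDens f) i (knotheE (f i) u))
      (cube (k i)) := by
    have h := (integral_log_knotheE (hf i) H.a_pos (hfn i)).1
    simp_rw [hlog] at h
    refine (h.add (integrable_const
      (Real.log (∫ x, Real.exp (-blockPotential ψ (ofDens f) i x))))).neg.congr
      (ae_of_all _ fun u => ?_)
    simp
  have key := integral_log_knotheE_interpolate_le (hfn i) (hf i).integral_eq (hgn i)
    (hg i).integral_eq ht (by
      simp_rw [hlog]
      exact hI.neg.sub (integrable_const _))
    (integral_log_knotheE (hf i) H.a_pos (hfn i)).1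
    (integral_log_knotheE (hg i) H.a_pos (hgn i)).1
  rw [(integral_log_knotheE (hg i) H.a_pos (hgn i)).2,
    (integral_log_knotheE (hf i) H.a_pos (hfn i)).2] at key
  have e1 := (integral_log_knotheE (hf i) H.a_pos (hfn i)).2
  simp_rw [hlog] at key e1
  rw [integral_sub (f := fun u => -blockPotential ψ (ofDens f) i
    ((1 - t) • knotheE (f i) u + t • knotheE (g i) u)) hI.neg (integrable_const _),
    integral_neg] at key
  rw [integral_sub (f := fun u => -blockPotential ψ (ofDens f) i (knotheE (f i) u)) hIX.neg
    (integrable_const _), integral_neg] at e1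
  linarith

/-- A fixed point of all block updates has minimal energy: the entropies satisfy the first order
inequality along the Knothe couplings of the blocks, and the couplings of different blocks are
independent, so that the derivatives of the block potentials add up to the derivative of `ψ`. -/
theorem Admissible.energy_le_of_eq_stepDens (H : Admissible ψ a b c p)
    (hf : ∀ i, ExpDensity a C (f i)) (hfix : ∀ i, f i = stepDens ψ f i)
    (hg : ∀ i, ExpDensity a C' (g i)) (hgn : ∀ i, PosExpDecay (g i)) :
    energy ψ f ≤ energy ψ g ∧ (StrictConvexOn ℝ Set.univ ψ → energy ψ g ≤ energy ψ f →
      Measure.pi (ofDens f) = Measure.pi (ofDens g)) := by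
  have hm := hasMoment_ofDens hf H.a_pos H.p_nonneg
  have hfn : ∀ i, PosExpDecay (f i) := fun i => by
    rw [hfix i]
    exact H.posExpDecay_gibbs hm i
  have hp := H.p_nonneg
  have hc := H.c_nonneg
  set X := knotheMap f with hX
  set Y := knotheMap g with hY
  have hXmp := measurePreserving_knotheMap hf H.a_pos hfn
  have hYmp := measurePreserving_knotheMap hg H.a_pos hgn
  have hψX : Integrable (fun w => ψ (X w)) (cubes k) :=
    hXmp.integrable_comp_of_integrable (H.integrable hm)
  have hψY : Integrable (fun w => ψ (Y w)) (cubes k) :=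
    hYmp.integrable_comp_of_integrable (H.integrable (hasMoment_ofDens hg H.a_pos hp))
  have hEX : ∫ w, ψ (X w) ∂(cubes k) = ∫ y, ψ y ∂(Measure.pi (ofDens f)) := by
    rw [← hXmp.map_eq, integral_map hXmp.measurable.aemeasurable
      H.continuous.aestronglyMeasurable]
  have hEY : ∫ w, ψ (Y w) ∂(cubes k) = ∫ y, ψ y ∂(Measure.pi (ofDens g)) := by
    rw [← hYmp.map_eq, integral_map hYmp.measurable.aemeasurable
      H.continuous.aestronglyMeasurable]
  -- the interpolation of the `i`-th block, with the other blocks fixed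
  set U : ℝ → Fin d → ((i : Fin d) → Fin (k i) → ℝ) → Pt k := fun t i w =>
    Function.update (X w) i ((1 - t) • X w i + t • Y w i) with hU
  have hUm : ∀ t i, Measurable (U t i) := by
    intro t i
    have hX' : ∀ j, Measurable fun w => X w j := fun j =>
      (measurable_pi_apply j).comp hXmp.measurable
    have hY' : ∀ j, Measurable fun w => Y w j := fun j =>
      (measurable_pi_apply j).comp hYmp.measurable
    refine measurable_pi_iff.mpr fun j => ?_
    by_cases hj : j = i
    · subst hj
      simp only [hU, Function.update_self]
      exact ((hX' j).const_smul (1 - t)).add ((hY' j).const_smul t)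
    · simp only [hU, Function.update_of_ne hj]
      exact hX' j
  have hUX : ∀ t i w, U t i w - X w = t • Pi.single i (Y w i - X w i) := by
    intro t i w
    funext j
    by_cases hj : j = i
    · subst hj
      simp only [hU, Pi.sub_apply, Function.update_self, Pi.smul_apply, Pi.single_eq_same]
      module
    · simp [hU, hj]
  set bound : ((i : Fin d) → Fin (k i) → ℝ) → ℝ := fun w => 2 * c * 3 ^ p *
    ((1 + ‖X w‖) ^ (2 * (p + 1)) + (1 + ‖Y w‖) ^ (2 * (p + 1))) with hbound
  have hbint : Integrable bound (cubes k) :=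
    ((integrable_weight_knotheMap hf H.a_pos hfn (by positivity)).add
      (integrable_weight_knotheMap hg H.a_pos hgn (by positivity))).const_mul _
  -- the increments of `ψ` are at most `t` times an integrable function
  have hinc : ∀ t ∈ Set.Ioo (0 : ℝ) 1, ∀ i w, |ψ (U t i w) - ψ (X w)| ≤ t * bound w := by
    intro t ht i w
    refine (H.convex.abs_sub_le_of_growth hc hp H.up _ _).trans ?_
    have h1 : ‖U t i w - X w‖ ≤ t * (‖X w‖ + ‖Y w‖) := by
      rw [hUX, norm_smul, Real.norm_of_nonneg ht.1.le, Pi.norm_single]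
      refine mul_le_mul_of_nonneg_left ((norm_sub_le _ _).trans ?_) ht.1.le
      linarith [norm_le_pi_norm (X w) i, norm_le_pi_norm (Y w) i]
    have h2 : ‖U t i w‖ ≤ 2 * ‖X w‖ + ‖Y w‖ := by
      have := norm_update_le (X w) i ((1 - t) • X w i + t • Y w i)
      have := norm_interpolate_le ht (X w i) (Y w i)
      linarith [norm_le_pi_norm (X w) i, norm_le_pi_norm (Y w) i]
    have hXn := norm_nonneg (X w)
    have hYn := norm_nonneg (Y w)
    have hXY := mul_nonneg hXn hYn
    have h3 : (2 + ‖U t i w‖ + ‖X w‖) ^ p ≤ 3 ^ p * ((1 + ‖X w‖) * (1 + ‖Y w‖)) ^ p := by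
      rw [← Real.mul_rpow (by positivity) (by positivity)]
      gcongr
      nlinarith
    have h4 : ‖X w‖ + ‖Y w‖ ≤ (1 + ‖X w‖) * (1 + ‖Y w‖) := by nlinarith
    have h5 := one_add_rpow_mul_le (s := p + 1) hXn hYn
    rw [← Real.mul_rpow (by positivity) (by positivity), Real.rpow_add_one (by positivity)] at h5
    calc 2 * c * (2 + ‖U t i w‖ + ‖X w‖) ^ p * ‖U t i w - X w‖
        ≤ 2 * c * (3 ^ p * ((1 + ‖X w‖) * (1 + ‖Y w‖)) ^ p) *
          (t * ((1 + ‖X w‖) * (1 + ‖Y w‖))) := by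
          gcongr
          exact h1.trans (mul_le_mul_of_nonneg_left h4 ht.1.le)
      _ = t * (2 * c * 3 ^ p * (((1 + ‖X w‖) * (1 + ‖Y w‖)) ^ p *
          ((1 + ‖X w‖) * (1 + ‖Y w‖)))) := by ring
      _ ≤ t * bound w := by
          have := ht.1.le
          simp only [hbound]
          gcongr
  have hincint : ∀ t ∈ Set.Ioo (0 : ℝ) 1, ∀ i,
      Integrable (fun w => ψ (U t i w) - ψ (X w)) (cubes k) := fun t ht i =>
    (hbint.const_mul t).mono' ((H.continuous.measurable.comp (hUm t i)).sub
      (H.continuous.measurable.comp hXmp.measurable)).aestronglyMeasurable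
      (ae_of_all _ (hinc t ht i))
  have hψU : ∀ t ∈ Set.Ioo (0 : ℝ) 1, ∀ i, Integrable (fun w => ψ (U t i w)) (cubes k) := by
    intro t ht i
    refine ((hincint t ht i).add hψX).congr (ae_of_all _ fun w => ?_)
    simp
  have hblock : ∀ t ∈ Set.Ioo (0 : ℝ) 1, ∀ i, t * (negEnt (f i) - negEnt (g i)) ≤
      ∫ w, (ψ (U t i w) - ψ (X w)) ∂(cubes k) := by
    intro t ht i
    rw [integral_sub (hψU t ht i) hψX]
    have e1 := H.integral_update_knotheMap hf hfn i
      (Z := fun u => (1 - t) • knotheE (f i) u + t • knotheE (g i) u) (hψU t ht i)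
    have e2 := H.integral_update_knotheMap hf hfn i (Z := knotheE (f i)) (by
      have : ∀ w, Function.update (knotheMap f w) i (knotheE (f i) (w i)) = X w := fun w =>
        Function.update_eq_self i (X w)
      simp_rw [this]
      exact hψX)
    have e3 : ∀ w, Function.update (knotheMap f w) i (knotheE (f i) (w i)) = X w := fun w =>
        Function.update_eq_self i (X w)
    simp_rw [e3] at e2
    have e4 : ∫ w, ψ (U t i w) ∂(cubes k) = _ := e1
    rw [e4, e2]
    exact H.mul_negEnt_sub_le hf hfix hg hgn i ht
  -- difference quotients along `t n = 1 / (n + 2)`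
  set t : ℕ → ℝ := fun n => 1 / ((n : ℝ) + 2) with htdef
  have ht : ∀ n, t n ∈ Set.Ioo (0 : ℝ) 1 := fun n => by
    have hn : (0 : ℝ) ≤ n := n.cast_nonneg
    refine ⟨by positivity, ?_⟩
    rw [htdef]
    simp only
    rw [div_lt_one (by positivity)]
    linarith
  have ht0 : Tendsto t atTop (𝓝[>] 0) := by
    refine tendsto_nhdsWithin_iff.mpr ⟨?_, Eventually.of_forall fun n => (ht n).1⟩
    have h := (tendsto_const_div_atTop_nhds_zero_nat (1 : ℝ)).comp (tendsto_add_atTop_nat 2)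
    refine h.congr fun n => ?_
    simp [htdef]
  set Q : ℕ → ((i : Fin d) → Fin (k i) → ℝ) → ℝ := fun n w =>
    ∑ i, (t n)⁻¹ * (ψ (U (t n) i w) - ψ (X w)) with hQ
  set D : ((i : Fin d) → Fin (k i) → ℝ) → ℝ := fun w => fderiv ℝ ψ (X w) (Y w - X w) with hD
  have hQm : ∀ n, AEStronglyMeasurable (Q n) (cubes k) := fun n =>
    (integrable_finsetSum _ fun i _ =>
      (hincint (t n) (ht n) i).const_mul (t n)⁻¹).aestronglyMeasurable
  have hQb : ∀ n w, ‖Q n w‖ ≤ d * bound w := by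
    intro n w
    calc ‖Q n w‖ ≤ ∑ i, ‖(t n)⁻¹ * (ψ (U (t n) i w) - ψ (X w))‖ := norm_sum_le _ _
      _ ≤ ∑ _i : Fin d, bound w := by
          refine Finset.sum_le_sum fun i _ => ?_
          rw [norm_mul, norm_inv, Real.norm_of_nonneg (ht n).1.le, inv_mul_le_iff₀ (ht n).1]
          exact hinc (t n) (ht n) i w
      _ = _ := by simp
  have hdiff : ∀ᵐ w ∂(cubes k), DifferentiableAt ℝ ψ (X w) := by
    have h1 := H.convex.ae_differentiableAt_of_growth (volume : Measure (Pt k)) hc hp H.up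
    have h2 : Measure.pi (ofDens f) ≪ volume := by
      rw [pi_ofDens hf H.a_pos]
      exact withDensity_absolutelyContinuous _ _
    exact hXmp.quasiMeasurePreserving.ae (h2.ae_le h1)
  have hlim : ∀ᵐ w ∂(cubes k), Tendsto (fun n => Q n w) atTop (𝓝 (D w)) := by
    filter_upwards [hdiff] with w hw
    have h1 : ∀ i, Tendsto (fun n => (t n)⁻¹ * (ψ (U (t n) i w) - ψ (X w))) atTop
        (𝓝 (fderiv ℝ ψ (X w) (Pi.single i (Y w i - X w i)))) := by
      intro i
      have h := (hw.hasFDerivAt.hasLineDerivAt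
        (Pi.single i (Y w i - X w i))).tendsto_slope_zero_right.comp ht0
      refine h.congr fun n => ?_
      have e : U (t n) i w = X w + t n • Pi.single i (Y w i - X w i) := by
        rw [← hUX]
        abel
      simp [e]
    have h2 : D w = ∑ i, fderiv ℝ ψ (X w) (Pi.single i (Y w i - X w i)) := by
      rw [← map_sum, hD]
      simp only
      congr 1
      exact (Finset.univ_sum_single (Y w - X w)).symm
    rw [h2]
    exact tendsto_finsetSum _ fun i _ => h1 i
  have hDm : AEStronglyMeasurable D (cubes k) := aestronglyMeasurable_of_tendsto_ae atTop hQm hlim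
  have hDint : Integrable D (cubes k) := by
    refine (hbint.const_mul d).mono' hDm ?_
    filter_upwards [hlim] with w hw
    exact le_of_tendsto' hw.norm fun n => hQb n w
  have hconv := tendsto_integral_of_dominated_convergence _ hQm (hbint.const_mul d)
    (fun n => ae_of_all _ (hQb n)) hlim
  -- the first order inequalities of the blocks add up, as the derivative of `ψ` is linear
  have hlow : ∑ i, (negEnt (f i) - negEnt (g i)) ≤ ∫ w, D w ∂(cubes k) := by
    refine ge_of_tendsto' hconv fun n => ?_
    rw [hQ]
    simp only
    rw [integral_finsetSum _ fun i _ => (hincint (t n) (ht n) i).const_mul (t n)⁻¹]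
    refine Finset.sum_le_sum fun i _ => ?_
    rw [integral_const_mul, ← div_eq_inv_mul, le_div_iff₀ (ht n).1, mul_comm]
    exact hblock (t n) (ht n) i
  have hsub : Integrable (fun w => ψ (Y w) - ψ (X w)) (cubes k) := hψY.sub hψX
  have hDle : ∀ᵐ w ∂(cubes k), D w ≤ ψ (Y w) - ψ (X w) := by
    filter_upwards [hdiff] with w hw
    exact H.convex.fderiv_le_sub hw _
  have hup : ∫ w, D w ∂(cubes k) ≤ ∫ w, (ψ (Y w) - ψ (X w)) ∂(cubes k) :=
    integral_mono_ae hDint hsub hDle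
  have hval : ∫ w, (ψ (Y w) - ψ (X w)) ∂(cubes k) =
      ∫ y, ψ y ∂(Measure.pi (ofDens g)) - ∫ y, ψ y ∂(Measure.pi (ofDens f)) := by
    rw [integral_sub hψY hψX, hEX, hEY]
  rw [Finset.sum_sub_distrib] at hlow
  refine ⟨by rw [energy, energy]; linarith, fun hs he => ?_⟩
  rw [energy, energy] at he
  have hzero : ∫ w, (ψ (Y w) - ψ (X w) - D w) ∂(cubes k) = 0 := by
    have h0 : ∫ w, (ψ (Y w) - ψ (X w) - D w) ∂(cubes k) =
        ∫ w, (ψ (Y w) - ψ (X w)) ∂(cubes k) - ∫ w, D w ∂(cubes k) := integral_sub hsub hDint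
    linarith
  have hae := (integral_eq_zero_iff_of_nonneg_ae (hDle.mono fun w hw => by
    simp only [Pi.zero_apply, Pi.sub_apply]
    linarith) (hsub.sub hDint)).mp hzero
  -- strict convexity turns equality of the energies into equality of the couplings
  have hXY : X =ᵐ[cubes k] Y := by
    filter_upwards [hae, hdiff] with w hw hwd
    by_contra hne
    have := hs.fderiv_lt_sub hwd hne
    simp only [Pi.zero_apply, Pi.sub_apply, hD] at hw
    linarith
  rw [← hXmp.map_eq, ← hYmp.map_eq]
  exact Measure.map_congr hXY

end FixedPoint

/-! ### Relative entropy of product measures -/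

section RelativeEntropy

open InformationTheory

/-- Conditioning on an event changes the log-likelihood ratio by the constant `-log (ν B)`. -/
theorem llr_cond {X : Type*} [MeasurableSpace X] {ν ρ : Measure X} [IsProbabilityMeasure ν]
    [IsProbabilityMeasure ρ] (hac : ν ≪ ρ) {B : Set X} (hB : MeasurableSet B) (hB0 : ν B ≠ 0) :
    llr (ProbabilityTheory.cond ν B) ρ =ᵐ[ν.restrict B]
      fun x => llr ν ρ x - Real.log (ν.real B) := by
  have h1 : (ProbabilityTheory.cond ν B).rnDeriv ρ =ᵐ[ρ]
      fun x => (ν B)⁻¹ * B.indicator (ν.rnDeriv ρ) x := by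
    rw [ProbabilityTheory.cond]
    filter_upwards [
      Measure.rnDeriv_smul_left_of_ne_top (ν.restrict B) ρ (ENNReal.inv_ne_top.mpr hB0),
      Measure.rnDeriv_restrict ν ρ hB] with x hx hx'
    rw [hx, Pi.smul_apply, hx', smul_eq_mul]
  have hle : ν.restrict B ≪ ν := Measure.restrict_le_self.absolutelyContinuous
  filter_upwards [hle.ae_le (hac.ae_le h1), hle.ae_le (Measure.rnDeriv_pos hac),
    hle.ae_le (hac.ae_le (Measure.rnDeriv_lt_top ν ρ)), ae_restrict_mem hB] with x hx hpos hlt hxB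
  have hpos' : 0 < (ν B).toReal := ENNReal.toReal_pos hB0 (measure_ne_top _ _)
  rw [llr, hx, Set.indicator_of_mem hxB, ENNReal.toReal_mul, ENNReal.toReal_inv,
    Real.log_mul (inv_ne_zero hpos'.ne') (ENNReal.toReal_pos hpos.ne' hlt.ne).ne', Real.log_inv,
    llr, Measure.real]
  ring

theorem klDiv_cond {X : Type*} [MeasurableSpace X] {ν ρ : Measure X} [IsProbabilityMeasure ν]
    [IsProbabilityMeasure ρ] (hac : ν ≪ ρ) (hi : Integrable (llr ν ρ) ν) {B : Set X}
    (hB : MeasurableSet B) (hB0 : ν B ≠ 0) :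
    klDiv (ProbabilityTheory.cond ν B) ρ ≠ ⊤ ∧ (klDiv (ProbabilityTheory.cond ν B) ρ).toReal
      = (ν.real B)⁻¹ * ∫ x in B, llr ν ρ x ∂ν - Real.log (ν.real B) := by
  have := ProbabilityTheory.cond_isProbabilityMeasure hB0
  have hpos : 0 < ν.real B := ENNReal.toReal_pos hB0 (measure_ne_top _ _)
  have hcac : ProbabilityTheory.cond ν B ≪ ρ :=
    ProbabilityTheory.cond_absolutelyContinuous.trans hac
  have hll := llr_cond hac hB hB0
  have hi' : Integrable (llr (ProbabilityTheory.cond ν B) ρ) (ν.restrict B) :=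
    (hi.restrict.sub (integrable_const (Real.log (ν.real B)))).congr hll.symm
  refine ⟨klDiv_ne_top hcac (hi'.smul_measure (ENNReal.inv_ne_top.mpr hB0)), ?_⟩
  have e : ∫ x, llr (ProbabilityTheory.cond ν B) ρ x ∂(ProbabilityTheory.cond ν B)
      = ((ν B)⁻¹).toReal • ∫ x in B, llr (ProbabilityTheory.cond ν B) ρ x ∂ν := by
    conv_lhs => rw [ProbabilityTheory.cond, integral_smul_measure]
    rfl
  rw [toReal_klDiv_of_measure_eq hcac (by simp), e, integral_congr_ae hll,
    integral_sub hi.restrict (integrable_const _), integral_const,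
    ENNReal.toReal_inv, measureReal_restrict_apply MeasurableSet.univ, Set.univ_inter, smul_eq_mul,
    smul_eq_mul, mul_sub, ← Measure.real, inv_mul_cancel_left₀ hpos.ne']

theorem cond_pi {ι : Type*} [Fintype ι] {α : ι → Type*} [∀ i, MeasurableSpace (α i)]
    (m : (i : ι) → Measure (α i)) [∀ i, IsProbabilityMeasure (m i)] {A : (i : ι) → Set (α i)}
    (hA : ∀ i, MeasurableSet (A i)) (hA0 : ∀ i, m i (A i) ≠ 0) :
    ProbabilityTheory.cond (Measure.pi m) (Set.pi Set.univ A)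
      = Measure.pi fun i => ProbabilityTheory.cond (m i) (A i) := by
  have := fun i => ProbabilityTheory.cond_isProbabilityMeasure (hA0 i)
  refine (Measure.pi_eq fun s _ => ?_).symm
  rw [ProbabilityTheory.cond_apply (MeasurableSet.univ_pi hA), ← Set.pi_inter_distrib,
    Measure.pi_pi, Measure.pi_pi, ENNReal.prod_inv_distrib, ← Finset.prod_mul_distrib]
  · exact Finset.prod_congr rfl fun i _ => (ProbabilityTheory.cond_apply (hA i) _ _).symm
  · exact fun i _ j _ _ => Or.inl (hA0 i)

variable {d : ℕ} {k : Fin d → ℕ} {a C : ℝ} {ψ : Pt k → ℝ}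
  {h f g : (i : Fin d) → Block k i → ℝ}

/-- The functions `h i` are probability densities on the blocks, without any decay. -/
structure IsDensity (h : (i : Fin d) → Block k i → ℝ) : Prop where
  measurable : ∀ i, Measurable (h i)
  nonneg : ∀ i x, 0 ≤ h i x
  isProb : ∀ i, IsProbabilityMeasure (ofDens h i)

theorem isDensity_of_expDensity (hf : ∀ i, ExpDensity a C (f i)) (ha : 0 < a) : IsDensity f :=
  ⟨fun i => (hf i).measurable, fun i => (hf i).nonneg, isProbabilityMeasure_ofDens hf ha⟩

theorem IsDensity.integrable (hh : IsDensity h) (i : Fin d) : Integrable (h i) := by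
  have h1 := (hh.isProb i).measure_univ
  rw [ofDens, withDensity_apply _ MeasurableSet.univ, Measure.restrict_univ] at h1
  exact (lintegral_ofReal_ne_top_iff_integrable (hh.measurable i).aestronglyMeasurable
    (ae_of_all _ (hh.nonneg i))).mp (by simp [h1])

theorem IsDensity.integral_eq (hh : IsDensity h) (i : Fin d) : ∫ x, h i x = 1 := by
  have h1 := (hh.isProb i).measure_univ
  rw [ofDens, withDensity_apply _ MeasurableSet.univ, Measure.restrict_univ] at h1
  rw [integral_eq_lintegral_of_nonneg_ae (ae_of_all _ (hh.nonneg i))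
    (hh.measurable i).aestronglyMeasurable, h1, ENNReal.toReal_one]

theorem IsDensity.pi_eq (hh : IsDensity h) :
    Measure.pi (ofDens h) = volume.withDensity fun y => ENNReal.ofReal (prodDens h y) :=
  pi_withDensity_ofReal (fun _ => volume) hh.nonneg hh.integrable

theorem IsDensity.absolutelyContinuous (hh : IsDensity h) : Measure.pi (ofDens h) ≪ volume := by
  rw [hh.pi_eq]
  exact withDensity_absolutelyContinuous _ _

theorem IsDensity.ae_pos (hh : IsDensity h) (i : Fin d) : ∀ᵐ x ∂(ofDens h i), 0 < h i x := by
  have := hh.measurable i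
  rw [ofDens, ae_withDensity_iff (by fun_prop)]
  filter_upwards with x hx
  simpa using hx

theorem IsDensity.ae_pos_pi (hh : IsDensity h) :
    ∀ᵐ y ∂(Measure.pi (ofDens h)), ∀ i, 0 < h i (y i) := by
  have := hh.isProb
  exact ae_forall_pi _ hh.ae_pos

theorem exists_isDensity {m : (i : Fin d) → Measure (Block k i)}
    (hm : ∀ i, IsProbabilityMeasure (m i)) (hac : Measure.pi m ≪ (volume : Measure (Pt k))) :
    ∃ h, IsDensity h ∧ ofDens h = m := by
  have hac' : ∀ i, m i ≪ volume := fun i => by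
    have h1 := (measurePreserving_eval m i).map_eq
    rw [← h1]
    have h2 : Measure.map (Function.eval i) (volume : Measure (Pt k)) ≪ volume :=
      (Measure.quasiMeasurePreserving_eval (fun i => (volume : Measure (Block k i))) i).2
    exact (hac.map (measurable_pi_apply i)).trans h2
  have e : ofDens (fun i x => ((m i).rnDeriv volume x).toReal) = m := by
    funext i
    conv_rhs => rw [← Measure.withDensity_rnDeriv_eq _ _ (hac' i)]
    refine withDensity_congr_ae ?_
    filter_upwards [Measure.rnDeriv_lt_top (m i) volume] with x hx
    rw [ENNReal.ofReal_toReal hx.ne]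
  refine ⟨fun i x => ((m i).rnDeriv volume x).toReal, ⟨fun i => ?_, fun i x => ?_, ?_⟩, e⟩
  · exact (Measure.measurable_rnDeriv _ _).ennreal_toReal
  · exact ENNReal.toReal_nonneg
  · rwa [e]

/-- The logarithm of the density of `pi (ofDens h)` with respect to the target. It has this meaning
only where all `h i (y i)` are positive, which is almost everywhere for `pi (ofDens h)`. -/
def logRatio (ψ : Pt k → ℝ) (h : (i : Fin d) → Block k i → ℝ) (y : Pt k) : ℝ :=
  ψ y + ∑ i, Real.log (h i (y i)) + Real.log (∫ x, Real.exp (-ψ x))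

theorem IsDensity.llr_eq (hh : IsDensity h) (hi : Integrable fun x => Real.exp (-ψ x)) :
    llr (Measure.pi (ofDens h)) (target ψ) =ᵐ[Measure.pi (ofDens h)] logRatio ψ h := by
  have := hh.isProb
  have hac := hh.absolutelyContinuous
  have h1 : (Measure.pi (ofDens h)).rnDeriv volume =ᵐ[volume]
      fun y => ENNReal.ofReal (prodDens h y) := by
    rw [hh.pi_eq]
    exact Measure.rnDeriv_withDensity _ (measurable_prodDens hh.measurable).ennreal_ofReal
  filter_upwards [llr_tilted_right hac hi, hac.ae_le h1, hh.ae_pos_pi] with y hy hy1 hpos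
  rw [target, hy, llr, hy1, ENNReal.toReal_ofReal (prodDens_nonneg hh.nonneg y), prodDens,
    Real.log_prod fun i _ => (hpos i).ne', logRatio]
  ring

theorem isProbabilityMeasure_target (hi : Integrable fun x => Real.exp (-ψ x)) :
    IsProbabilityMeasure (target ψ) := isProbabilityMeasure_tilted hi

theorem IsDensity.absolutelyContinuous_target (hh : IsDensity h)
    (hi : Integrable fun x => Real.exp (-ψ x)) : Measure.pi (ofDens h) ≪ target ψ :=
  hh.absolutelyContinuous.trans (absolutelyContinuous_tilted hi)

theorem Admissible.integrable_exp_neg {a b c p : ℝ} (H : Admissible ψ a b c p) :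
    Integrable fun x => Real.exp (-ψ x) :=
  integrable_exp_neg_of_le H.a_pos H.continuous.measurable H.low

/-- For exponentially decaying densities the relative entropy is finite, and it equals the
energy up to the normalization of the target. -/
theorem Admissible.klDiv_eq {a b c p : ℝ} (H : Admissible ψ a b c p)
    (hf : ∀ i, ExpDensity a C (f i)) :
    klDiv (Measure.pi (ofDens f)) (target ψ) ≠ ⊤ ∧
      (klDiv (Measure.pi (ofDens f)) (target ψ)).toReal
        = energy ψ f + Real.log (∫ x, Real.exp (-ψ x)) := by
  have hh := isDensity_of_expDensity hf H.a_pos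
  have hi := H.integrable_exp_neg
  have := hh.isProb
  have := isProbabilityMeasure_target hi
  have hac := hh.absolutelyContinuous_target hi
  have hψ := H.integrable (hasMoment_ofDens hf H.a_pos H.p_nonneg)
  have hlog : ∀ i, Integrable (fun x => Real.log (f i x)) (ofDens f i) := fun i => by
    rw [ofDens, withDensity_integrable_iff (hf i).measurable (hf i).nonneg]
    simpa only [mul_comm] using (hf i).integrable_mul_log H.a_pos
  have hlog' : ∀ i, Integrable (fun y : Pt k => Real.log (f i (y i))) (Measure.pi (ofDens f)) :=
    fun i => (measurePreserving_eval (ofDens f) i).integrable_comp_of_integrable (hlog i)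
  have hs : Integrable (fun y : Pt k => ∑ i, Real.log (f i (y i))) (Measure.pi (ofDens f)) :=
    integrable_finsetSum _ fun i _ => hlog' i
  have hsum : Integrable (logRatio ψ f) (Measure.pi (ofDens f)) :=
    (hψ.add hs).add (integrable_const _)
  refine ⟨klDiv_ne_top hac (hsum.congr (hh.llr_eq hi).symm), ?_⟩
  have e : ∀ i, ∫ y : Pt k, Real.log (f i (y i)) ∂(Measure.pi (ofDens f)) = negEnt (f i) := by
    intro i
    have h1 := integral_map (μ := Measure.pi (ofDens f)) (φ := fun y : Pt k => y i)
      (f := fun x => Real.log (f i x)) (measurable_pi_apply i).aemeasurable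
      (hf i).measurable.log.aestronglyMeasurable
    have h2 : Measure.map (fun y : Pt k => y i) (Measure.pi (ofDens f)) = ofDens f i :=
      (measurePreserving_eval (ofDens f) i).map_eq
    rw [← h1, h2, integral_ofDens hf i, negEnt]
    simp only [mul_comm]
  calc _ = ∫ y, logRatio ψ f y ∂(Measure.pi (ofDens f)) := by
        rw [toReal_klDiv_of_measure_eq hac (by simp), integral_congr_ae (hh.llr_eq hi)]
    _ = ∫ y, (ψ y + ∑ i, Real.log (f i (y i))) ∂(Measure.pi (ofDens f))
          + ∫ _, Real.log (∫ x, Real.exp (-ψ x)) ∂(Measure.pi (ofDens f)) :=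
        integral_add (f := fun y => ψ y + ∑ i, Real.log (f i (y i))) (hψ.add hs)
          (integrable_const _)
    _ = _ := by
        rw [integral_add hψ hs, integral_const, energy, integral_finsetSum _ fun i _ => hlog' i]
        simp only [probReal_univ, one_smul, e]

end RelativeEntropy

/-! ### Fixed points of the coordinate updates are minimizers -/

section Minimizers

open InformationTheory

variable {d : ℕ} {k : Fin d → ℕ} {a b c p C : ℝ} {ψ : Pt k → ℝ}
  {h f g : (i : Fin d) → Block k i → ℝ}

/-- The density of the measure with density `u`, conditioned on `A`; it is zero if `u` has no mass
on `A`. -/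
def condDens {E : Type*} [MeasureSpace E] (u : E → ℝ) (A : Set E) (x : E) : ℝ :=
  (∫ y in A, u y)⁻¹ * A.indicator u x

theorem withDensity_condDens {E : Type*} [MeasureSpace E] {u : E → ℝ} (hu : Measurable u)
    (hi : Integrable u) (h0 : ∀ x, 0 ≤ u x) {A : Set E} (hA : MeasurableSet A)
    (hA0 : (volume.withDensity fun x => ENNReal.ofReal (u x)) A ≠ 0) :
    (volume.withDensity fun x => ENNReal.ofReal (condDens u A x))
      = ProbabilityTheory.cond (volume.withDensity fun x => ENNReal.ofReal (u x)) A := by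
  have e : (volume.withDensity fun x => ENNReal.ofReal (u x)) A
      = ENNReal.ofReal (∫ y in A, u y) := by
    rw [withDensity_apply _ hA, ofReal_integral_eq_lintegral_ofReal hi.restrict (ae_of_all _ h0)]
  have hpos : 0 < ∫ y in A, u y := by
    rw [e] at hA0
    simpa using hA0
  rw [ProbabilityTheory.cond, restrict_withDensity hA, ← withDensity_indicator hA,
    ← withDensity_smul _ (by measurability), e]
  congr 1
  funext x
  rw [Pi.smul_apply, smul_eq_mul, condDens, ENNReal.ofReal_mul (inv_nonneg.mpr hpos.le),
    ENNReal.ofReal_inv_of_pos hpos]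
  by_cases hx : x ∈ A <;> simp [hx]

/-- Conditioning on a set where `u` and the norm are bounded gives an exponentially decaying
density. -/
theorem expDensity_condDens {E : Type*} [NormedAddCommGroup E] [NormedSpace ℝ E]
    [FiniteDimensional ℝ E] [MeasureSpace E] [BorelSpace E] [(volume : Measure E).IsAddHaarMeasure]
    {u : E → ℝ} (hu : Measurable u) (h0 : ∀ x, 0 ≤ u x) (ha : 0 < a) {A : Set E}
    (hA : MeasurableSet A) (hA0 : 0 < ∫ y in A, u y) {R : ℝ} (hR : 0 ≤ R)
    (hb : ∀ x ∈ A, ‖x‖ ≤ R ∧ u x ≤ R) :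
    ExpDensity a ((∫ y in A, u y)⁻¹ * (R * Real.exp (a * R))) (condDens u A) := by
  refine ⟨(hu.indicator hA).const_mul _, fun x => ?_, fun x => ?_, ?_⟩
  · exact mul_nonneg (inv_nonneg.mpr hA0.le) (Set.indicator_nonneg (fun _ _ => h0 _) _)
  · rw [condDens, mul_assoc]
    refine mul_le_mul_of_nonneg_left ?_ (inv_nonneg.mpr hA0.le)
    by_cases hx : x ∈ A
    · rw [Set.indicator_of_mem hx, mul_assoc, ← Real.exp_add]
      have h1 : 1 ≤ Real.exp (a * R + -(a * ‖x‖)) := by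
        refine Real.one_le_exp ?_
        nlinarith [(hb x hx).1]
      nlinarith [(hb x hx).2]
    · rw [Set.indicator_of_notMem hx]
      positivity
  · simp only [condDens]
    rw [integral_const_mul, integral_indicator hA, inv_mul_cancel₀ hA0.ne']

theorem ofDens_condDens (hh : IsDensity h) {A : (i : Fin d) → Set (Block k i)}
    (hA : ∀ i, MeasurableSet (A i)) (hA0 : ∀ i, ofDens h i (A i) ≠ 0) :
    ofDens (fun i => condDens (h i) (A i))
      = fun i => ProbabilityTheory.cond (ofDens h i) (A i) := by
  funext i
  exact withDensity_condDens (hh.measurable i) (hh.integrable i) (hh.nonneg i) (hA i) (hA0 i)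

/-- The set on which the `i`-th block and its density are at most `n`. -/
def truncSet (h : (i : Fin d) → Block k i → ℝ) (n : ℕ) (i : Fin d) : Set (Block k i) :=
  {x | ‖x‖ ≤ n ∧ h i x ≤ n}

theorem measurableSet_truncSet (hh : IsDensity h) (n : ℕ) (i : Fin d) :
    MeasurableSet (truncSet h n i) :=
  (measurableSet_le measurable_norm measurable_const).inter
    (measurableSet_le (hh.measurable i) measurable_const)

theorem monotone_truncSet (h : (i : Fin d) → Block k i → ℝ) :
    Monotone fun n => Set.pi Set.univ (truncSet h n) := by
  intro n m hnm
  have : (n : ℝ) ≤ m := by exact_mod_cast hnm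
  exact Set.pi_mono fun i _ x hx => ⟨hx.1.trans this, hx.2.trans this⟩

theorem iUnion_truncSet (h : (i : Fin d) → Block k i → ℝ) :
    ⋃ n, Set.pi Set.univ (truncSet h n) = Set.univ := by
  refine Set.eq_univ_of_forall fun y => ?_
  have : ∀ i, ∃ n : ℕ, ‖y i‖ ≤ n ∧ h i (y i) ≤ n := fun i => by
    obtain ⟨n, hn⟩ := exists_nat_ge (max ‖y i‖ (h i (y i)))
    exact ⟨n, (le_max_left _ _).trans hn, (le_max_right _ _).trans hn⟩
  choose n hn using this
  refine Set.mem_iUnion.mpr ⟨∑ i, n i, fun i _ => ?_⟩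
  have : (n i : ℝ) ≤ (∑ i, n i : ℕ) := by
    exact_mod_cast Finset.single_le_sum (f := n) (fun _ _ => Nat.zero_le _) (Finset.mem_univ i)
  exact ⟨(hn i).1.trans this, (hn i).2.trans this⟩

/-- A density that has least energy among the exponentially decaying ones is a minimizer of the
relative entropy among all products: every competitor of finite entropy is approximated in
entropy by its conditionings on bounded sets. -/
theorem Admissible.isMinimizer_of_energy_le (H : Admissible ψ a b c p)
    (hf : ∀ i, ExpDensity a C (f i))
    (hmin : ∀ (C' : ℝ) (g : (i : Fin d) → Block k i → ℝ), (∀ i, ExpDensity a C' (g i)) →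
      energy ψ f ≤ energy ψ g) : IsMinimizer ψ (Measure.pi (ofDens f)) := by
  have hi := H.integrable_exp_neg
  have := isProbabilityMeasure_target hi
  refine ⟨⟨_, isProbabilityMeasure_ofDens hf H.a_pos, rfl⟩, ?_⟩
  rintro _ ⟨m, hm, rfl⟩
  by_cases htop : klDiv (Measure.pi m) (target ψ) = ⊤
  · rw [htop]
    exact le_top
  obtain ⟨hac, hint⟩ := klDiv_ne_top_iff.mp htop
  obtain ⟨h, hh, rfl⟩ := exists_isDensity hm
    (hac.trans (tilted_absolutelyContinuous _ _))
  set ν := Measure.pi (ofDens h) with hν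
  set B : ℕ → Set (Pt k) := fun n => Set.pi Set.univ (truncSet h n) with hB
  have hBm : ∀ n, MeasurableSet (B n) :=
    fun n => MeasurableSet.univ_pi fun i => measurableSet_truncSet hh n i
  have hBt : Tendsto (fun n => ν.real (B n)) atTop (𝓝 1) := by
    have h1 := tendsto_measure_iUnion_atTop (μ := ν) (monotone_truncSet h)
    rw [iUnion_truncSet, measure_univ] at h1
    exact (ENNReal.tendsto_toReal ENNReal.one_ne_top).comp h1
  have hIt : Tendsto (fun n => ∫ x in B n, llr ν (target ψ) x ∂ν) atTop
      (𝓝 (∫ x, llr ν (target ψ) x ∂ν)) := by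
    have h1 := tendsto_setIntegral_of_monotone hBm (monotone_truncSet h)
      (hint.integrableOn (s := ⋃ n, B n))
    rwa [iUnion_truncSet, Measure.restrict_univ] at h1
  -- the entropies of the competitor conditioned on `B n` converge to its entropy
  have hlim : Tendsto (fun n => (ν.real (B n))⁻¹ * ∫ x in B n, llr ν (target ψ) x ∂ν
      - Real.log (ν.real (B n))) atTop (𝓝 (klDiv ν (target ψ)).toReal) := by
    rw [toReal_klDiv_of_measure_eq hac (by simp)]
    have h1 := ((hBt.inv₀ one_ne_zero).mul hIt).sub
      ((Real.continuousAt_log one_ne_zero).tendsto.comp hBt)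
    simpa using h1
  refine (ENNReal.toReal_le_toReal (H.klDiv_eq hf).1 htop).mp (ge_of_tendsto hlim ?_)
  -- once `B n` has positive probability, the conditioned competitor has decaying densities
  filter_upwards [hBt.eventually (lt_mem_nhds one_half_lt_one)] with n hn
  have hB0 : ν (B n) ≠ 0 := fun e => by
    rw [Measure.real, e] at hn
    norm_num at hn
  have hA0 : ∀ i, ofDens h i (truncSet h n i) ≠ 0 := fun i => by
    rw [hν, hB, Measure.pi_pi] at hB0
    exact Finset.prod_ne_zero_iff.mp hB0 i (Finset.mem_univ i)
  have hA0' : ∀ i, 0 < ∫ y in truncSet h n i, h i y := fun i => by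
    have h1 := hA0 i
    rw [ofDens, withDensity_apply _ (measurableSet_truncSet hh n i),
      ← ofReal_integral_eq_lintegral_ofReal (hh.integrable i).restrict
        (ae_of_all _ (hh.nonneg i))] at h1
    simpa using h1
  have hg : ∀ i, ExpDensity a (∑ i, (∫ y in truncSet h n i, h i y)⁻¹ * (n * Real.exp (a * n)))
      (condDens (h i) (truncSet h n i)) := fun i => by
    refine (expDensity_condDens (hh.measurable i) (hh.nonneg i) H.a_pos
      (measurableSet_truncSet hh n i) (hA0' i) (Nat.cast_nonneg n) fun x hx => hx).mono ?_
    exact Finset.single_le_sum (f := fun i => (∫ y in truncSet h n i, h i y)⁻¹ *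
      (n * Real.exp (a * n))) (fun j _ => mul_nonneg (inv_nonneg.mpr (hA0' j).le) (by positivity))
      (Finset.mem_univ i)
  rw [(H.klDiv_eq hf).2, ← (klDiv_cond hac hint (hBm n) hB0).2, hν, hB,
    cond_pi _ (measurableSet_truncSet hh n) hA0,
    ← ofDens_condDens hh (measurableSet_truncSet hh n) hA0, (H.klDiv_eq hg).2]
  linarith [hmin _ _ hg]

end Minimizers

/-! ### Regularity of minimizers and uniqueness -/

section Uniqueness

open InformationTheory

variable {d : ℕ} {k : Fin d → ℕ} {a b c p C : ℝ} {ψ : Pt k → ℝ}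
  {h f g : (i : Fin d) → Block k i → ℝ}

/-- Comparing a minimizer with its conditioning on the event `y i ∉ S` bounds the part of the
relative entropy that comes from `y i ∈ S`. -/
theorem setIntegral_logRatio_le (hi : Integrable fun x => Real.exp (-ψ x)) (hh : IsDensity h)
    (hmin : IsMinimizer ψ (Measure.pi (ofDens h)))
    (hfin : klDiv (Measure.pi (ofDens h)) (target ψ) ≠ ⊤) (i : Fin d) {S : Set (Block k i)}
    (hS : MeasurableSet S) :
    ∫ y in {y : Pt k | y i ∈ S}, logRatio ψ h y ∂(Measure.pi (ofDens h))
      ≤ (∫ y, logRatio ψ h y ∂(Measure.pi (ofDens h)) + 1) * (ofDens h i).real S := by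
  have := hh.isProb
  have := isProbabilityMeasure_target hi
  obtain ⟨hac, hint⟩ := klDiv_ne_top_iff.mp hfin
  have hll := hh.llr_eq hi
  set ν := Measure.pi (ofDens h) with hν
  set W := ∫ y, logRatio ψ h y ∂ν with hW
  have hwint : Integrable (logRatio ψ h) ν := hint.congr hll
  have hB : MeasurableSet {y : Pt k | y i ∈ S} := (measurable_pi_apply i) hS
  have hsplit := integral_add_compl hB hwint
  have hcompl : {y : Pt k | y i ∈ S}ᶜ
      = Set.pi Set.univ (Function.update (fun _ => Set.univ) i Sᶜ) := by
    ext y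
    rw [Set.univ_pi_update_univ]
    rfl
  have hm : ν.real {y : Pt k | y i ∈ S}ᶜ = (ofDens h i).real Sᶜ := by
    rw [Measure.real, Measure.real, ← (measurePreserving_eval (ofDens h) i).measure_preimage
      hS.compl.nullMeasurableSet]
    rfl
  have ht : (ofDens h i).real S = 1 - (ofDens h i).real Sᶜ := by
    rw [probReal_compl_eq_one_sub hS]
    ring
  set t := (ofDens h i).real Sᶜ with ht'
  have ht0 : 0 ≤ t := measureReal_nonneg
  have key : t * W + t - 1 ≤ ∫ y in {y : Pt k | y i ∈ S}ᶜ, logRatio ψ h y ∂ν := by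
    -- the value at `t = 0` is the limit of the inequality from the entropy of the conditioning,
    -- `W ≤ t⁻¹ ∫ logRatio - log t`, multiplied by `t` and weakened by `t log t ≥ t - 1`
    rcases eq_or_ne (ν {y : Pt k | y i ∈ S}ᶜ) 0 with h0 | h0
    · have : t = 0 := by rw [← hm, Measure.real, h0, ENNReal.toReal_zero]
      rw [setIntegral_measure_zero _ h0, this]
      norm_num
    · have hpos : 0 < t := by
        rw [← hm]
        exact ENNReal.toReal_pos h0 (measure_ne_top _ _)
      obtain ⟨hc1, hc2⟩ := klDiv_cond hac hint hB.compl h0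
      have hA : ∀ j, MeasurableSet (Function.update (fun _ => Set.univ) i Sᶜ j :
          Set (Block k j)) := fun j => by
        by_cases e : j = i
        · subst e
          simpa using hS
        · simp [e]
      have hA0 : ∀ j, ofDens h j (Function.update (fun _ => Set.univ) i Sᶜ j) ≠ 0 := fun j => by
        rw [hcompl, hν, Measure.pi_pi] at h0
        exact Finset.prod_ne_zero_iff.mp h0 j (Finset.mem_univ j)
      have hprod : IsProductProbability (ProbabilityTheory.cond ν {y : Pt k | y i ∈ S}ᶜ) :=
        ⟨_, fun j => ProbabilityTheory.cond_isProbabilityMeasure (hA0 j), by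
          rw [hcompl, hν, cond_pi _ hA hA0]⟩
      have h1 := ENNReal.toReal_mono hc1 (hmin.2 _ hprod)
      rw [hc2, toReal_klDiv_of_measure_eq hac (by simp), integral_congr_ae hll,
        integral_congr_ae (ae_restrict_of_ae hll), hm, ← hW] at h1
      have h2 := Real.one_sub_inv_le_log_of_pos hpos
      have h3 : t * W ≤ ∫ y in {y : Pt k | y i ∈ S}ᶜ, logRatio ψ h y ∂ν - t * Real.log t := by
        have := mul_le_mul_of_nonneg_left h1 hpos.le
        rwa [mul_sub, mul_inv_cancel_left₀ hpos.ne'] at this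
      have h4 := mul_le_mul_of_nonneg_left h2 hpos.le
      rw [mul_sub, mul_inv_cancel₀ hpos.ne'] at h4
      linarith
  rw [ht]
  nlinarith

/-- The log-density of a minimizer, averaged over all blocks but the `i`-th, is bounded above
almost everywhere: by Fubini, its integral over any set `S` is at most a constant times the mass
of `S`. -/
theorem ae_integral_logRatio_update_le
    (hi : Integrable fun x => Real.exp (-ψ x)) (hh : IsDensity h)
    (hmin : IsMinimizer ψ (Measure.pi (ofDens h)))
    (hfin : klDiv (Measure.pi (ofDens h)) (target ψ) ≠ ⊤) (i : Fin d) :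
    ∀ᵐ x ∂(ofDens h i),
      Integrable (fun y => logRatio ψ h (Function.update y i x)) (Measure.pi (ofDens h)) ∧
      ∫ y, logRatio ψ h (Function.update y i x) ∂(Measure.pi (ofDens h))
        ≤ ∫ y, logRatio ψ h y ∂(Measure.pi (ofDens h)) + 1 := by
  have := hh.isProb
  have hwint : Integrable (logRatio ψ h) (Measure.pi (ofDens h)) :=
    (klDiv_ne_top_iff.mp hfin).2.congr (hh.llr_eq hi)
  have hmp := measurePreserving_update_pi (ofDens h) i (ofDens h i)
  rw [Function.update_eq_self] at hmp
  have hprod := hmp.integrable_comp_of_integrable hwint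
  have hG := hprod.integral_prod_left
  refine hprod.prod_right_ae.and ?_
  refine ae_le_of_forall_setIntegral_le hG (integrable_const _) fun S hS _ => ?_
  have hB : MeasurableSet {y : Pt k | y i ∈ S} := (measurable_pi_apply i) hS
  have e : ∫ y in {y : Pt k | y i ∈ S}, logRatio ψ h y ∂(Measure.pi (ofDens h))
      = ∫ x in S, ∫ y, logRatio ψ h (Function.update y i x) ∂(Measure.pi (ofDens h))
        ∂(ofDens h i) := by
    have h1 := integral_pi_update (ofDens h) i (ofDens h i)
      (h := {y : Pt k | y i ∈ S}.indicator (logRatio ψ h))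
      (by rw [Function.update_eq_self]; exact hwint.indicator hB)
    rw [Function.update_eq_self, integral_indicator hB] at h1
    rw [h1, ← integral_indicator hS]
    refine integral_congr_ae (ae_of_all _ fun x => ?_)
    by_cases hx : x ∈ S <;> simp [hx, Set.indicator]
  have h2 := setIntegral_logRatio_le hi hh hmin hfin i hS
  rw [e] at h2
  rw [integral_const, smul_eq_mul, measureReal_restrict_apply MeasurableSet.univ, Set.univ_inter,
    mul_comm]
  exact h2

/-- The densities of a minimizer of finite entropy decay exponentially. The factor `1 / d` in the
rate is lost because the lower bound on `ψ`, which is in terms of the maximum of the block norms, is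
split evenly among the blocks. -/
theorem Admissible.exists_ae_le (H : Admissible ψ a b c p) (hh : IsDensity h)
    (hmin : IsMinimizer ψ (Measure.pi (ofDens h)))
    (hfin : klDiv (Measure.pi (ofDens h)) (target ψ) ≠ ⊤) (i : Fin d) :
    ∃ C, ∀ᵐ x, h i x ≤ C * Real.exp (-(a / d * ‖x‖)) := by
  have := hh.isProb
  have hdpos : (0 : ℝ) < d := by exact_mod_cast i.pos
  set a' := a / d with ha'
  have ha'pos : 0 < a' := div_pos H.a_pos hdpos
  -- the ratio of `exp (-a' ‖y j‖)` to the density, over the blocks other than `i`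
  set r : (j : Fin d) → Block k j → ℝ := fun j x =>
    if j = i then 1 else Real.exp (-(a' * ‖x‖)) / h j x with hr
  have hrint : ∀ j, Integrable (r j) (ofDens h j) := fun j => by
    by_cases e : j = i
    · simp only [hr, e, if_true]
      subst e
      exact integrable_const _
    · simp only [hr, e, if_false]
      have hmj := hh.measurable j
      rw [ofDens, withDensity_integrable_iff hmj (hh.nonneg j)]
      refine (integrable_exp_neg_mul_norm volume ha'pos).mono' (by fun_prop)
        (ae_of_all _ fun x => ?_)
      rcases (hh.nonneg j x).eq_or_lt with h0 | h0
      · rw [← h0]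
        simpa using (Real.exp_pos _).le
      · rw [div_mul_cancel₀ _ h0.ne', Real.norm_of_nonneg (Real.exp_pos _).le]
  have hRint : Integrable (fun y : Pt k => ∏ j, r j (y j)) (Measure.pi (ofDens h)) :=
    Integrable.fintype_prod_dep hrint
  set K := ∫ y : Pt k, ∏ j, r j (y j) ∂(Measure.pi (ofDens h)) with hK
  set L := Real.log (∫ x, Real.exp (-ψ x)) with hL
  set W := ∫ y, logRatio ψ h y ∂(Measure.pi (ofDens h)) with hW
  refine ⟨Real.exp (W + K + b - L), ?_⟩
  have key : ∀ᵐ x ∂(ofDens h i), h i x ≤ Real.exp (W + K + b - L) * Real.exp (-(a' * ‖x‖)) := by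
    filter_upwards [ae_integral_logRatio_update_le H.integrable_exp_neg hh
      hmin hfin i, hh.ae_pos i] with x ⟨hx1, hx2⟩ hpos
    -- `ψ` absorbs the negative parts of the logarithms of the other densities, whose sum is bounded
    -- below by `1 - ∏ j, r j (y j)` because `s + 1 ≤ exp s`
    have hlow : ∀ᵐ y ∂(Measure.pi (ofDens h)),
        Real.log (h i x) + a' * ‖x‖ - b + L + 1 - ∏ j, r j (y j)
          ≤ logRatio ψ h (Function.update y i x) := by
      filter_upwards [hh.ae_pos_pi] with y hy
      have h1 : a' * ∑ j, ‖Function.update y i x j‖ ≤ a * ‖Function.update y i x‖ := by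
        have h2 : ∑ j, ‖Function.update y i x j‖ ≤ ∑ _j : Fin d, ‖Function.update y i x‖ :=
          Finset.sum_le_sum fun j _ => norm_le_pi_norm _ j
        rw [Finset.sum_const, Finset.card_univ, Fintype.card_fin, nsmul_eq_mul] at h2
        calc _ ≤ a' * (d * ‖Function.update y i x‖) := by gcongr
          _ = _ := by rw [ha']; field_simp
      have h3 := H.low (Function.update y i x)
      have hsplit : ∀ F : (j : Fin d) → Block k j → ℝ, ∑ j, F j (Function.update y i x j)
          = F i x + ∑ j ∈ Finset.univ.erase i, F j (y j) := fun F => by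
        rw [← Finset.add_sum_erase _ _ (Finset.mem_univ i), Function.update_self]
        congr 1
        exact Finset.sum_congr rfl fun j hj => by
          rw [Function.update_of_ne (Finset.ne_of_mem_erase hj)]
      have hprod : ∏ j, r j (y j)
          = Real.exp (-∑ j ∈ Finset.univ.erase i, (a' * ‖y j‖ + Real.log (h j (y j)))) := by
        rw [← Finset.mul_prod_erase _ _ (Finset.mem_univ i), ← Finset.sum_neg_distrib,
          Real.exp_sum]
        simp only [hr, if_true, one_mul]
        refine Finset.prod_congr rfl fun j hj => ?_
        rw [if_neg (Finset.ne_of_mem_erase hj), neg_add, Real.exp_add, Real.exp_neg (Real.log _),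
          Real.exp_log (hy j), div_eq_mul_inv]
      have h4 := Real.add_one_le_exp
        (-∑ j ∈ Finset.univ.erase i, (a' * ‖y j‖ + Real.log (h j (y j))))
      rw [← hprod, Finset.sum_add_distrib, ← Finset.mul_sum] at h4
      rw [logRatio, hsplit fun j x => Real.log (h j x), ← hL]
      rw [hsplit fun j x => ‖x‖, mul_add] at h1
      linarith
    have h5 := integral_mono_ae (((integrable_const _).sub hRint).congr (ae_of_all _ fun y => rfl))
      hx1 hlow
    rw [integral_sub' (integrable_const _) hRint, integral_const, ← hK] at h5
    simp only [probReal_univ, one_smul] at h5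
    rw [← Real.exp_add, ← Real.log_le_iff_le_exp hpos]
    linarith
  have hmi := hh.measurable i
  rw [ofDens, ae_withDensity_iff (by fun_prop)] at key
  filter_upwards [key] with x hx
  rcases (hh.nonneg i x).eq_or_lt with h0 | h0
  · rw [← h0]
    positivity
  · exact hx (by simpa using h0)

theorem Admissible.mono {a' : ℝ} (H : Admissible ψ a b c p) (h0 : 0 < a') (h : a' ≤ a) :
    Admissible ψ a' b c p where
  convex := H.convex
  a_pos := h0
  low x := le_trans (by gcongr) (H.low x)
  c_nonneg := H.c_nonneg
  p_nonneg := H.p_nonneg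
  up := H.up

theorem ExpDensity.mono_left {E : Type*} [NormedAddCommGroup E] [NormedSpace ℝ E]
    [FiniteDimensional ℝ E] [MeasureSpace E] [BorelSpace E] {u : E → ℝ} {a' : ℝ}
    (hu : ExpDensity a C u) (h : a' ≤ a) : ExpDensity a' C u where
  measurable := hu.measurable
  nonneg := hu.nonneg
  le x := (hu.le x).trans (by have := hu.C_nonneg; gcongr)
  integral_eq := hu.integral_eq

theorem Admissible.exists_expDensity_of_isMinimizer (H : Admissible ψ a b c p) {ν : Measure (Pt k)}
    (hmin : IsMinimizer ψ ν) (hfin : klDiv ν (target ψ) ≠ ⊤) :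
    ∃ (C : ℝ) (f : (i : Fin d) → Block k i → ℝ),
      (∀ i, ExpDensity (a / d) C (f i)) ∧ ν = Measure.pi (ofDens f) := by
  obtain ⟨m, hm, rfl⟩ := hmin.1
  obtain ⟨h, hh, rfl⟩ := exists_isDensity hm
    ((klDiv_ne_top_iff.mp hfin).1.trans (tilted_absolutelyContinuous _ _))
  choose C hC using H.exists_ae_le hh hmin hfin
  set D := ∑ i, |C i| with hD
  have hCD : ∀ i, C i ≤ D := fun i => (le_abs_self _).trans
    (Finset.single_le_sum (f := fun i => |C i|) (fun _ _ => abs_nonneg _) (Finset.mem_univ i))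
  have hD0 : 0 ≤ D := Finset.sum_nonneg fun _ _ => abs_nonneg _
  set f : (i : Fin d) → Block k i → ℝ := fun i x =>
    min (h i x) (D * Real.exp (-(a / d * ‖x‖))) with hf
  have hfh : ∀ i, f i =ᵐ[volume] h i := fun i => by
    filter_upwards [hC i] with x hx
    exact min_eq_left (hx.trans (by gcongr; exact hCD i))
  refine ⟨D, f, fun i => ⟨?_, fun x => ?_, fun x => min_le_right _ _, ?_⟩, by
    rw [ofDens_congr hfh]⟩
  · have := hh.measurable i
    fun_prop
  · exact le_min (hh.nonneg i x) (by positivity)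
  · rw [integral_congr_ae (hfh i), hh.integral_eq]

/-- An a.e. fixed point of the updates has a version that is a fixed point everywhere. -/
theorem Admissible.exists_eq_stepDens (H : Admissible ψ a b c p) (hf : ∀ i, ExpDensity a C (f i))
    (hfix : ∀ i, f i =ᵐ[volume] stepDens ψ f i) :
    ∃ (C' : ℝ) (f' : (i : Fin d) → Block k i → ℝ), (∀ i, ExpDensity a C' (f' i)) ∧
      (∀ i, f' i = stepDens ψ f' i) ∧ (∀ i, PosExpDecay (f' i)) ∧ (∀ i, f i =ᵐ[volume] f' i) := by
  have hm := hasMoment_ofDens hf H.a_pos H.p_nonneg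
  refine ⟨∑ i, (Real.exp b / ∫ y, Real.exp (-blockPotential ψ (ofDens f) i y)), stepDens ψ f,
    fun i => (H.expDensity_stepDens hf i).mono ?_, fun i => ?_, H.posExpDecay_gibbs hm, hfix⟩
  · exact Finset.single_le_sum
      (f := fun i => Real.exp b / ∫ y, Real.exp (-blockPotential ψ (ofDens f) i y))
      (fun i _ => (H.expDensity_stepDens hf i).C_nonneg) (Finset.mem_univ i)
  · conv_rhs => rw [stepDens, ← ofDens_congr hfix]
    rfl

/-- A fixed point of the updates has least energy: by one sweep every competitor is improved to
one with positive continuous densities. -/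
theorem Admissible.energy_le_of_ae_eq_stepDens (H : Admissible ψ a b c p)
    (hf : ∀ i, ExpDensity a C (f i)) (hfix : ∀ i, f i =ᵐ[volume] stepDens ψ f i) {C' : ℝ}
    (hg : ∀ i, ExpDensity a C' (g i)) : energy ψ f ≤ energy ψ g := by
  obtain ⟨_, f', hf', hfix', _, he⟩ := H.exists_eq_stepDens hf hfix
  obtain ⟨_, hgs⟩ := H.exists_expDensity_sweepDens ⟨C', hg⟩ d
  have hgn : ∀ i, PosExpDecay (sweepDens ψ g d i) := fun i => by
    obtain ⟨_, hgi⟩ := H.exists_expDensity_sweepDens ⟨C', hg⟩ i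
    rw [sweepDens_eq_of_lt ψ g i d i.isLt]
    exact H.posExpDecay_gibbs (hasMoment_ofDens hgi H.a_pos H.p_nonneg) i
  rw [energy_congr he]
  exact (H.energy_le_of_eq_stepDens hf' hfix' hgs hgn).1.trans (H.energy_sweepDens_le ⟨C', hg⟩ d)

theorem Admissible.isMinimizer_of_ae_eq_stepDens (H : Admissible ψ a b c p)
    (hf : ∀ i, ExpDensity a C (f i)) (hfix : ∀ i, f i =ᵐ[volume] stepDens ψ f i) :
    IsMinimizer ψ (Measure.pi (ofDens f)) :=
  H.isMinimizer_of_energy_le hf fun _ _ hg => H.energy_le_of_ae_eq_stepDens hf hfix hg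

/-- For strictly convex `ψ` a fixed point of the updates is the only minimizer: another minimizer
has exponentially decaying densities, so it has an energy that no sweep decreases, and it is a fixed
point with the same energy. -/
theorem Admissible.eq_of_isMinimizer (H : Admissible ψ a b c p) (hd : 0 < d)
    (hs : StrictConvexOn ℝ Set.univ ψ)
    (hf : ∀ i, ExpDensity a C (f i)) (hfix : ∀ i, f i =ᵐ[volume] stepDens ψ f i)
    {ν : Measure (Pt k)} (hν : IsMinimizer ψ ν) : ν = Measure.pi (ofDens f) := by
  have hfmin := H.isMinimizer_of_ae_eq_stepDens hf hfix
  have hfin : klDiv ν (target ψ) ≠ ⊤ :=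
    ne_top_of_le_ne_top (H.klDiv_eq hf).1 (hν.2 _ hfmin.1)
  obtain ⟨C', h, hh, rfl⟩ := H.exists_expDensity_of_isMinimizer hν hfin
  have hdpos : (1 : ℝ) ≤ d := by exact_mod_cast hd
  have hle : a / d ≤ a := div_le_self H.a_pos.le hdpos
  have H' := H.mono (div_pos H.a_pos (by linarith)) hle
  have hf' := fun i => (hf i).mono_left hle
  have hmin : ∀ {C'' : ℝ} {g : (i : Fin d) → Block k i → ℝ},
      (∀ i, ExpDensity (a / d) C'' (g i)) → energy ψ h ≤ energy ψ g := fun hg => by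
    have h1 := ENNReal.toReal_mono (H'.klDiv_eq hg).1
      (hν.2 _ ⟨_, isProbabilityMeasure_ofDens hg H'.a_pos, rfl⟩)
    rw [(H'.klDiv_eq hg).2, (H'.klDiv_eq hh).2] at h1
    linarith
  obtain ⟨_, hsw⟩ := H'.exists_expDensity_sweepDens ⟨C', hh⟩ d
  have hhfix := H'.eq_stepDens_of_energy_le ⟨C', hh⟩ (hmin hsw)
  obtain ⟨_, f', hf1, hf2, _, hf4⟩ := H'.exists_eq_stepDens hf' hfix
  obtain ⟨_, h', hh1, _, hh3, hh4⟩ := H'.exists_eq_stepDens hh hhfix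
  rw [ofDens_congr hf4, ofDens_congr hh4]
  refine ((H'.energy_le_of_eq_stepDens hf1 hf2 hh1 hh3).2 hs ?_).symm
  rw [← energy_congr hf4, ← energy_congr hh4]
  exact hmin hf'

end Uniqueness

/-! ### Convergence of densities in `L^q` -/

section Lq

variable {d : ℕ} {k : Fin d → ℕ} {a b c p C : ℝ} {ψ : Pt k → ℝ}
  {f : (i : Fin d) → Block k i → ℝ} {q : ℝ≥0∞}

theorem memLp_exp_neg_mul_norm (ha : 0 < a) (hq0 : q ≠ 0) (hq : q ≠ ⊤) :
    MemLp (fun y : Pt k => Real.exp (-(a * ‖y‖))) q volume := by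
  refine (integrable_norm_rpow_iff (by fun_prop) hq0 hq).mp ?_
  have hpos : 0 < q.toReal := ENNReal.toReal_pos hq0 hq
  refine (integrable_exp_neg_mul_norm volume (mul_pos ha hpos)).congr (ae_of_all _ fun y => ?_)
  simp only
  rw [Real.norm_of_nonneg (Real.exp_pos _).le, ← Real.exp_mul]
  congr 1
  ring

theorem prodDens_le (hf : ∀ i, ExpDensity a C (f i)) (ha : 0 < a) (y : Pt k) :
    prodDens f y ≤ C ^ d * Real.exp (-(a * ‖y‖)) := by
  have h1 : prodDens f y ≤ ∏ i, (C * Real.exp (-(a * ‖y i‖))) :=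
    Finset.prod_le_prod (fun i _ => (hf i).nonneg _) fun i _ => (hf i).le _
  have hC : 0 ≤ C ^ d := by
    rcases d.eq_zero_or_pos with rfl | hd
    · simp
    · exact pow_nonneg (hf ⟨0, hd⟩).C_nonneg d
  have h2 : ‖y‖ ≤ ∑ i, ‖y i‖ :=
    (pi_norm_le_iff_of_nonneg (Finset.sum_nonneg fun _ _ => norm_nonneg _)).mpr fun i =>
      Finset.single_le_sum (f := fun i => ‖y i‖) (fun _ _ => norm_nonneg _) (Finset.mem_univ i)
  rw [Finset.prod_mul_distrib, Finset.prod_const, Finset.card_univ, Fintype.card_fin,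
    ← Real.exp_sum, Finset.sum_neg_distrib, ← Finset.mul_sum] at h1
  exact h1.trans (by gcongr)

theorem memLp_prodDens (hf : ∀ i, ExpDensity a C (f i)) (ha : 0 < a) (hq0 : q ≠ 0) (hq : q ≠ ⊤) :
    MemLp (prodDens f) q volume := by
  refine ((memLp_exp_neg_mul_norm ha hq0 hq).const_mul (C ^ d)).mono
    (measurable_prodDens fun i => (hf i).measurable).aestronglyMeasurable (ae_of_all _ fun y => ?_)
  rw [Real.norm_of_nonneg (prodDens_nonneg (fun i => (hf i).nonneg) y)]
  exact (prodDens_le hf ha y).trans (le_abs_self _)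

theorem density_pi_ofDens (hf : ∀ i, ExpDensity a C (f i)) (ha : 0 < a) :
    density (Measure.pi (ofDens f)) =ᵐ[volume] prodDens f := by
  rw [pi_ofDens hf ha]
  filter_upwards [Measure.rnDeriv_withDensity volume
    (measurable_prodDens fun i => (hf i).measurable).ennreal_ofReal] with y hy
  rw [density, hy, ENNReal.toReal_ofReal (prodDens_nonneg (fun i => (hf i).nonneg) y)]

theorem hasLqDensity_pi_ofDens (hf : ∀ i, ExpDensity a C (f i)) (ha : 0 < a) (hq0 : q ≠ 0)
    (hq : q ≠ ⊤) : HasLqDensity q (Measure.pi (ofDens f)) :=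
  ⟨(isDensity_of_expDensity hf ha).absolutelyContinuous,
    (memLp_prodDens hf ha hq0 hq).ae_eq (density_pi_ofDens hf ha).symm⟩

/-- Dominated convergence in `L^q`. -/
theorem tendsto_eLpNorm_sub_zero {X : Type*} [MeasurableSpace X] {μ : Measure X} {F : ℕ → X → ℝ}
    {F₀ G : X → ℝ} (hq0 : q ≠ 0) (hq : q ≠ ⊤) (hF : ∀ n, AEStronglyMeasurable (F n) μ)
    (hF₀ : AEStronglyMeasurable F₀ μ) (hG : MemLp G q μ) (hb : ∀ n, ∀ᵐ x ∂μ, ‖F n x - F₀ x‖ ≤ G x)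
    (hlim : ∀ᵐ x ∂μ, Tendsto (fun n => F n x) atTop (𝓝 (F₀ x))) :
    Tendsto (fun n => eLpNorm (F n - F₀) q μ) atTop (𝓝 0) := by
  have hpos : 0 < q.toReal := ENNReal.toReal_pos hq0 hq
  simp_rw [eLpNorm_eq_lintegral_rpow_enorm_toReal hq0 hq]
  have h1 : Tendsto (fun n => ∫⁻ x, ‖(F n - F₀) x‖ₑ ^ q.toReal ∂μ) atTop (𝓝 (∫⁻ _, 0 ∂μ)) := by
    refine tendsto_lintegral_of_dominated_convergence' (fun x => ‖G x‖ₑ ^ q.toReal)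
      (fun n => (((hF n).sub hF₀).enorm.pow_const _)) (fun n => ?_)
      (lintegral_rpow_enorm_lt_top_of_eLpNorm_lt_top hq0 hq hG.2).ne ?_
    · filter_upwards [hb n] with x hx
      gcongr
      exact enorm_le_iff_norm_le.mpr (hx.trans (le_abs_self _))
    · filter_upwards [hlim] with x hx
      have h2 : Tendsto (fun n => ‖F n x - F₀ x‖ₑ) atTop (𝓝 0) := by
        simpa using (hx.sub_const (F₀ x)).enorm
      simpa [hpos, Function.comp_def] using
        ((ENNReal.continuous_rpow_const (y := q.toReal)).tendsto _).comp h2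
  rw [lintegral_zero] at h1
  simpa [hpos, Function.comp_def] using
    ((ENNReal.continuous_rpow_const (y := 1 / q.toReal)).tendsto _).comp h1

theorem lqTendsto_pi_ofDens {u : ℕ → (i : Fin d) → Block k i → ℝ}
    (hu : ∀ n i, ExpDensity a C (u n i)) (hf : ∀ i, ExpDensity a C (f i)) (ha : 0 < a)
    (hlim : ∀ i x, Tendsto (fun n => u n i x) atTop (𝓝 (f i x))) (hq0 : q ≠ 0) (hq : q ≠ ⊤) :
    LqTendsto q (fun n => Measure.pi (ofDens (u n))) (Measure.pi (ofDens f)) := by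
  have h1 : ∀ n, eLpNorm (density (Measure.pi (ofDens (u n))) - density (Measure.pi (ofDens f)))
      q volume = eLpNorm (prodDens (u n) - prodDens f) q volume := fun n =>
    eLpNorm_congr_ae ((density_pi_ofDens (hu n) ha).sub (density_pi_ofDens hf ha))
  rw [LqTendsto]
  simp_rw [h1]
  refine tendsto_eLpNorm_sub_zero (G := fun y => 2 * C ^ d * Real.exp (-(a * ‖y‖))) hq0 hq
    (fun n => (measurable_prodDens fun i => (hu n i).measurable).aestronglyMeasurable)
    (measurable_prodDens fun i => (hf i).measurable).aestronglyMeasurable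
    ((memLp_exp_neg_mul_norm ha hq0 hq).const_mul _) (fun n => ae_of_all _ fun y => ?_)
    (ae_of_all _ fun y => tendsto_finsetProd _ fun i _ => hlim i (y i))
  have h2 := prodDens_le (hu n) ha y
  have h3 := prodDens_le hf ha y
  have h4 := prodDens_nonneg (fun i => (hu n i).nonneg) y
  have h5 := prodDens_nonneg (fun i => (hf i).nonneg) y
  rw [Real.norm_eq_abs, abs_sub_le_iff]
  constructor <;> linarith

theorem iterate_succ_eq (ψ : Pt k → ℝ) (m : (i : Fin d) → Measure (Block k i)) {n : ℕ}
    (hn : 1 ≤ n) :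
    iterate ψ m n = Measure.pi (ofDens (densSeq ψ (firstDens ψ m) (n - 1))) := by
  obtain ⟨n, rfl⟩ := Nat.exists_eq_add_of_le' hn
  rw [iterate, marginals_succ_eq_ofDens, Nat.add_sub_cancel]

/-- Any sequence of iterates with indices tending to infinity has a subsequence that converges,
both in `L^q` and weakly, to a fixed point of the updates. -/
theorem Admissible.exists_subseq_tendsto (H : Admissible ψ a b c p) (hd : 0 < d)
    {m : (i : Fin d) → Measure (Block k i)} (hm : HasMoment p m) (hq0 : q ≠ 0) (hq : q ≠ ⊤)
    {φ : ℕ → ℕ} (hφ : Tendsto φ atTop atTop) :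
    ∃ θ : ℕ → ℕ, StrictMono θ ∧ ∃ (C : ℝ) (f : (i : Fin d) → Block k i → ℝ),
      (∀ i, ExpDensity a C (f i)) ∧ (∀ i, f i =ᵐ[volume] stepDens ψ f i) ∧
      LqTendsto q (fun t => iterate ψ m (φ (θ t))) (Measure.pi (ofDens f)) ∧
      WeaklyTendsto (fun t => iterate ψ m (φ (θ t))) (Measure.pi (ofDens f)) := by
  obtain ⟨C, L, hu⟩ := H.exists_isRun hd hm
  obtain ⟨θ, hθ, f, hf, hlim⟩ := hu.exists_tendsto H.a_pos H.p_nonneg fun t => φ t - 1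
  have hφθ : Tendsto (fun t => φ (θ t)) atTop atTop := hφ.comp hθ.tendsto_atTop
  have hφ1 : Tendsto (fun t => φ (θ t) - 1) atTop atTop :=
    (tendsto_sub_atTop_nat 1).comp hφθ
  have hev : ∀ᶠ t in atTop, Measure.pi (ofDens (densSeq ψ (firstDens ψ m) (φ (θ t) - 1)))
      = iterate ψ m (φ (θ t)) := by
    filter_upwards [hφθ.eventually_ge_atTop 1] with t ht using (iterate_succ_eq ψ m ht).symm
  refine ⟨θ, hθ, C, f, hf, H.eq_stepDens_of_tendsto hu hf hφ1 fun i => ae_of_all _ (hlim i),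
    ?_, fun F => ?_⟩
  · refine (lqTendsto_pi_ofDens (fun t => hu.expDensity_zero _) hf H.a_pos hlim hq0 hq).congr' ?_
    filter_upwards [hev] with t ht
    rw [ht]
  · refine (tendsto_integral_pi_ofDens (fun t => hu.expDensity_zero _) hf H.a_pos
      (fun i => ae_of_all _ (hlim i)) (p := 0) (K := ‖F‖) le_rfl F.continuous.measurable
      fun y => ?_).congr' ?_
    · rw [Real.rpow_zero, mul_one]
      exact F.norm_coe_le_norm y
    · filter_upwards [hev] with t ht
      rw [ht]

theorem eq_of_weaklyTendsto {μ : ℕ → Measure (Pt k)} {ν ν' : Measure (Pt k)} [IsFiniteMeasure ν]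
    [IsFiniteMeasure ν'] (h : WeaklyTendsto μ ν) (h' : WeaklyTendsto μ ν') : ν = ν' :=
  ext_of_forall_integral_eq_of_IsFiniteMeasure fun F => tendsto_nhds_unique (h F) (h' F)

theorem WeaklyTendsto.comp {μ : ℕ → Measure (Pt k)} {ν : Measure (Pt k)} (h : WeaklyTendsto μ ν)
    {θ : ℕ → ℕ} (hθ : Tendsto θ atTop atTop) : WeaklyTendsto (fun t => μ (θ t)) ν :=
  fun F => (h F).comp hθ

theorem isCompact_closure_of_subseq {X : Type*} [PseudoMetricSpace X] {S : Set X}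
    (h : ∀ s : ℕ → X, (∀ n, s n ∈ S) → ∃ θ : ℕ → ℕ, StrictMono θ ∧ ∃ x,
      Tendsto (fun t => s (θ t)) atTop (𝓝 x)) : IsCompact (closure S) := by
  refine IsSeqCompact.isCompact fun s hs => ?_
  have hs' : ∀ n : ℕ, ∃ y ∈ S, dist (s n) y < 1 / ((n : ℝ) + 1) := fun n =>
    Metric.mem_closure_iff.mp (hs n) _ Nat.one_div_pos_of_nat
  choose y hy hsy using hs'
  obtain ⟨θ, hθ, x, hx⟩ := h y hy
  refine ⟨x, mem_closure_of_tendsto hx (Eventually.of_forall fun _ => hy _), θ, hθ, ?_⟩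
  refine (tendsto_iff_of_dist ?_).mpr hx
  refine squeeze_zero (fun _ => dist_nonneg) (fun t => (hsy (θ t)).le) ?_
  exact tendsto_one_div_add_atTop_nhds_zero_nat.comp hθ.tendsto_atTop

theorem Admissible.isCompact_closure_iterates (H : Admissible ψ a b c p) (hd : 0 < d)
    {m : (i : Fin d) → Measure (Block k i)} (hm : HasMoment p m) [Fact (1 ≤ q)] (hq : q ≠ ⊤) :
    IsCompact (closure {u : Lp ℝ q (volume : Measure (Pt k)) |
      ∃ n, 1 ≤ n ∧ u =ᵐ[volume] density (iterate ψ m n)}) := by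
  have hq0 : q ≠ 0 := fun e => by
    have := Fact.out (p := 1 ≤ q)
    simp [e] at this
  obtain ⟨C, L, hu⟩ := H.exists_isRun hd hm
  refine isCompact_closure_of_subseq fun s hs => ?_
  choose N hN hsN using hs
  obtain ⟨θ, hθ, f, hf, hlim⟩ := hu.exists_tendsto H.a_pos H.p_nonneg fun t => N t - 1
  have hmem := (hasLqDensity_pi_ofDens hf H.a_pos hq0 hq).2
  refine ⟨θ, hθ, hmem.toLp _, Lp.tendsto_Lp_of_tendsto_eLpNorm _ hmem ?_⟩
  refine (lqTendsto_pi_ofDens (fun t => hu.expDensity_zero _) hf H.a_pos hlim hq0 hq).congr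
    fun t => eLpNorm_congr_ae ?_
  simp only [← iterate_succ_eq ψ m (hN (θ t))]
  exact (hsN (θ t)).symm.sub EventuallyEq.rfl

end Lq

/-! ### Consequences of the growth and moment assumptions -/

section Growth

variable {d : ℕ} {k : Fin d → ℕ} {c p : ℝ} {ψ : Pt k → ℝ}

theorem norm_le_euclNorm (x : Pt k) : ‖x‖ ≤ euclNorm x :=
  (pi_norm_le_iff_of_nonneg (norm_nonneg _)).mpr fun i =>
    PiLp.norm_apply_le (WithLp.toLp 2 x : PiLp 2 (Block k)) i

theorem euclNorm_le (x : Pt k) : euclNorm x ≤ √d * ‖x‖ := by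
  rw [euclNorm, PiLp.norm_eq_of_L2]
  refine Real.sqrt_le_iff.mpr ⟨by positivity, ?_⟩
  rw [mul_pow, Real.sq_sqrt (Nat.cast_nonneg d)]
  calc ∑ i, ‖x i‖ ^ 2 ≤ ∑ _i : Fin d, ‖x‖ ^ 2 :=
        Finset.sum_le_sum fun i _ => by gcongr; exact norm_le_pi_norm x i
    _ = _ := by simp

theorem continuous_euclNorm : Continuous (euclNorm : Pt k → ℝ) :=
  (PiLp.continuous_toLp 2 _).norm

/-- The almost everywhere growth bound holds everywhere, because a convex function is continuous. -/
theorem exists_admissible (hconv : ConvexOn ℝ Set.univ ψ)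
    (hint : Integrable fun x => Real.exp (-ψ x)) (hc : 0 ≤ c) (hp : 0 ≤ p)
    (hgrowth : ∀ᵐ x ∂(volume : Measure (Pt k)), |ψ x| ≤ c * (1 + euclNorm x ^ p)) :
    ∃ a b c', Admissible ψ a b c' p := by
  obtain ⟨a, b, ha, hlow⟩ := ConvexOn.exists_mul_norm_sub_le volume hconv hint
  have hcont : Continuous ψ := hconv.locallyLipschitz.continuous
  have hclosed : IsClosed {x : Pt k | |ψ x| ≤ c * (1 + euclNorm x ^ p)} :=
    isClosed_le hcont.abs (continuous_const.mul (continuous_const.add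
      (continuous_euclNorm.rpow_const fun _ => Or.inr hp)))
  have hall : ∀ x, |ψ x| ≤ c * (1 + euclNorm x ^ p) := fun x => by
    have h1 := Measure.dense_of_ae hgrowth
    rw [← Set.mem_ofPred_eq (p := fun x => |ψ x| ≤ c * (1 + euclNorm x ^ p)),
      ← hclosed.closure_eq]
    exact h1 x
  refine ⟨a, b, c * (2 * (1 + √d) ^ p), hconv, ha, hlow, by positivity, hp, fun x => ?_⟩
  refine (hall x).trans ?_
  rw [mul_assoc c]
  refine mul_le_mul_of_nonneg_left ?_ hc
  have hs := Real.sqrt_nonneg (d : ℝ)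
  have hn := norm_nonneg x
  have h1 : euclNorm x ^ p ≤ ((1 + √d) * (1 + ‖x‖)) ^ p := by
    refine Real.rpow_le_rpow (norm_nonneg _) ((euclNorm_le x).trans ?_) hp
    nlinarith [mul_nonneg hs hn]
  have h2 : 1 ≤ ((1 + √d) * (1 + ‖x‖)) ^ p :=
    Real.one_le_rpow (by nlinarith [mul_nonneg hs hn]) hp
  rw [Real.mul_rpow (by positivity) (by positivity)] at h1 h2
  linarith

theorem hasMoment_of_integrable (hp : 0 ≤ p) {m : (i : Fin d) → Measure (Block k i)}
    (hm : ∀ i, IsProbabilityMeasure (m i))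
    (hmom : Integrable (fun x => euclNorm x ^ p) (Measure.pi m)) : HasMoment p m := by
  refine ⟨hm, fun i => ?_⟩
  have hmeas : Measurable fun x : Block k i => (1 + ‖x‖) ^ p := by fun_prop
  refine ((measurePreserving_eval m i).integrable_comp hmeas.aestronglyMeasurable).mp ?_
  refine (((integrable_const 1).add hmom).const_mul (2 ^ p)).mono'
    (hmeas.comp (measurable_pi_apply i)).aestronglyMeasurable (ae_of_all _ fun x => ?_)
  have h0 : ‖x i‖ ≤ euclNorm x := (norm_le_pi_norm x i).trans (norm_le_euclNorm x)
  have hn := norm_nonneg (x i)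
  have h1 : 0 ≤ euclNorm x := hn.trans h0
  have h2 : 0 ≤ euclNorm x ^ p := Real.rpow_nonneg h1 p
  have h3 : (0 : ℝ) < 2 ^ p := by positivity
  rw [Function.comp_apply, Function.eval, Real.norm_of_nonneg (by positivity), Pi.add_apply]
  rcases le_total (euclNorm x) 1 with h | h
  · calc (1 + ‖x i‖) ^ p ≤ 2 ^ p := Real.rpow_le_rpow (by positivity) (by linarith) hp
      _ ≤ _ := by nlinarith
  · calc (1 + ‖x i‖) ^ p ≤ (2 * euclNorm x) ^ p :=
          Real.rpow_le_rpow (by positivity) (by linarith) hp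
      _ = 2 ^ p * euclNorm x ^ p := Real.mul_rpow zero_le_two h1
      _ ≤ _ := by nlinarith

end Growth

end CAVI

end

theorem mainTheorem7 {d : ℕ} (hd : 0 < d) (k : Fin d → ℕ) (hk : ∀ i, 0 < k i)
    (ψ : CAVI.Pt k → ℝ) (hconv : ConvexOn ℝ Set.univ ψ)
    (hint : Integrable (fun x => Real.exp (- ψ x)) volume)
    (c p : ℝ) (hc : 0 < c) (hp : 2 ≤ p)
    (hgrowth : ∀ᵐ x ∂(volume : Measure (CAVI.Pt k)), |ψ x| ≤ c * (1 + CAVI.euclNorm x ^ p))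
    (g : CAVI.Pt k → CAVI.Pt k) (hg : CAVI.HasWeakGradient ψ g)
    (hgrad : ∀ᵐ x ∂(volume : Measure (CAVI.Pt k)),
      CAVI.euclNorm (g x) ≤ c * (1 + CAVI.euclNorm x ^ p))
    (μ₀ : (i : Fin d) → Measure (CAVI.Block k i)) (hμ₀ : ∀ i, IsProbabilityMeasure (μ₀ i))
    (hmom : Integrable (fun x => CAVI.euclNorm x ^ p) (Measure.pi μ₀))
    (q : ℝ≥0∞) [Fact (1 ≤ q)] (hq : q ≠ ⊤) :
    -- the iterates are well defined product probability measures
    (∀ (n : ℕ) (i : Fin d), CAVI.UpdateWellDefined ψ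
      (CAVI.partialSweep ψ (CAVI.marginals ψ μ₀ n) i) i) ∧
    (∀ n i, IsProbabilityMeasure (CAVI.marginals ψ μ₀ n i)) ∧
    -- their densities lie in `L^q` and form a precompact set there
    (∀ n, 1 ≤ n → CAVI.HasLqDensity q (CAVI.iterate ψ μ₀ n)) ∧
    IsCompact (closure {u : Lp ℝ q (volume : Measure (CAVI.Pt k)) |
      ∃ n, 1 ≤ n ∧ u =ᵐ[volume] CAVI.density (CAVI.iterate ψ μ₀ n)}) ∧
    -- every subsequence has a further one that converges in `L^q` to a minimizer
    (∀ φ : ℕ → ℕ, StrictMono φ → ∃ θ : ℕ → ℕ, StrictMono θ ∧ ∃ ν : Measure (CAVI.Pt k),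
      CAVI.IsMinimizer ψ ν ∧ CAVI.HasLqDensity q ν ∧
      CAVI.LqTendsto q (fun t => CAVI.iterate ψ μ₀ (φ (θ t))) ν) ∧
    -- every weakly convergent subsequence converges in `L^q`, and its limit is a minimizer
    (∀ φ : ℕ → ℕ, StrictMono φ → ∀ ν : Measure (CAVI.Pt k), IsProbabilityMeasure ν →
      CAVI.WeaklyTendsto (fun t => CAVI.iterate ψ μ₀ (φ t)) ν →
      CAVI.IsMinimizer ψ ν ∧ CAVI.HasLqDensity q ν ∧
      CAVI.LqTendsto q (fun t => CAVI.iterate ψ μ₀ (φ t)) ν) ∧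
    -- for strictly convex `ψ` the whole sequence converges in `L^q` to the unique minimizer
    (StrictConvexOn ℝ Set.univ ψ → ∃ ν : Measure (CAVI.Pt k),
      CAVI.IsMinimizer ψ ν ∧ (∀ ν', CAVI.IsMinimizer ψ ν' → ν' = ν) ∧
      CAVI.HasLqDensity q ν ∧ CAVI.LqTendsto q (CAVI.iterate ψ μ₀) ν) := by
  have hp0 : 0 ≤ p := by linarith
  have hq0 : q ≠ 0 := fun e => by
    have := Fact.out (p := 1 ≤ q)
    simp [e] at this
  obtain ⟨a, b, c', H⟩ := CAVI.exists_admissible hconv hint hc.le hp0 hgrowth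
  have hm := CAVI.hasMoment_of_integrable hp0 hμ₀ hmom
  have hmn := fun n => H.hasMoment_marginals hm n
  obtain ⟨C, L, hu⟩ := H.exists_isRun hd hm
  refine ⟨fun n i => H.updateWellDefined (H.hasMoment_partialSweep (hmn n) i) i,
    fun n => (hmn n).isProb, fun n hn => ?_, H.isCompact_closure_iterates hd hm hq,
    fun φ hφ => ?_, fun φ hφ ν hν hweak => ?_, fun hs => ?_⟩
  · rw [CAVI.iterate_succ_eq ψ μ₀ hn]
    exact CAVI.hasLqDensity_pi_ofDens (hu.expDensity_zero _) H.a_pos hq0 hq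
  · obtain ⟨θ, hθ, _, f, hf, hfix, hlim, _⟩ :=
      H.exists_subseq_tendsto hd hm hq0 hq hφ.tendsto_atTop
    exact ⟨θ, hθ, _, H.isMinimizer_of_ae_eq_stepDens hf hfix,
      CAVI.hasLqDensity_pi_ofDens hf H.a_pos hq0 hq, hlim⟩
  · have key : ∀ r : ℕ → ℕ, Tendsto r atTop atTop → ∃ θ : ℕ → ℕ,
        CAVI.IsMinimizer ψ ν ∧ CAVI.HasLqDensity q ν ∧
        CAVI.LqTendsto q (fun t => CAVI.iterate ψ μ₀ (φ (r (θ t)))) ν := fun r hr => by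
      obtain ⟨θ, hθ, _, f, hf, hfix, hlim, hw⟩ :=
        H.exists_subseq_tendsto hd hm hq0 hq (hφ.tendsto_atTop.comp hr)
      have := CAVI.isProbabilityMeasure_ofDens hf H.a_pos
      have e : ν = Measure.pi (CAVI.ofDens f) :=
        CAVI.eq_of_weaklyTendsto (hweak.comp (hr.comp hθ.tendsto_atTop)) hw
      rw [e]
      exact ⟨θ, H.isMinimizer_of_ae_eq_stepDens hf hfix,
        CAVI.hasLqDensity_pi_ofDens hf H.a_pos hq0 hq, hlim⟩
    obtain ⟨_, h1, h2, _⟩ := key id tendsto_id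
    refine ⟨h1, h2, tendsto_of_subseq_tendsto fun r hr => ?_⟩
    obtain ⟨θ, _, _, h3⟩ := key r hr
    exact ⟨θ, h3⟩
  · obtain ⟨_, _, _, f, hf, hfix, _⟩ := H.exists_subseq_tendsto hd hm hq0 hq tendsto_id
    refine ⟨Measure.pi (CAVI.ofDens f), H.isMinimizer_of_ae_eq_stepDens hf hfix,
      fun ν' hν' => H.eq_of_isMinimizer hd hs hf hfix hν',
      CAVI.hasLqDensity_pi_ofDens hf H.a_pos hq0 hq, tendsto_of_subseq_tendsto fun r hr => ?_⟩
    obtain ⟨θ, _, _, f', hf', hfix', hlim, _⟩ := H.exists_subseq_tendsto hd hm hq0 hq hr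
    rw [H.eq_of_isMinimizer hd hs hf hfix (H.isMinimizer_of_ae_eq_stepDens hf' hfix')] at hlim
    exact ⟨θ, hlim⟩
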